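/- **Setting.** Let $C,A_1,\dots,A_m\in\mathbb S^n$ be real symmetric matrices, $b\in\mathbb R^m$, $\langle X,Y\rangle=\operatorname{tr}(X^{\mathsf T}Y)$, $\|\cdot\|$ the Frobenius norm, $\mathcal A(X)=(\langle A_i,X\rangle)_{i}$, $\mathcal A^*(y)=\sum_i y_iA_i$, $\mathcal X_0=\{X\in\mathbb S^n:\mathcal A(X)=b\}$. Consider the semidefinite programs $$\text{(P)}\ \min\{\langle C,X\rangle:\ \mathcal A(X)=b,\ X\succeq0\},\qquad \text{(D)}\ \max\{b^{\mathsf T}y:\ Z+\mathcal A^*(y)=C,\ Z\succeq 0\},$$ with optimal solution sets $\mathcal P^\star$ and $\mathcal D^\star$. Put $D_Z=\max_{(y,Z)\in\mathcal D^\star}\operatorname{tr}Z$, $\sigma_{\mathrm p}=\max_{X\in\mathcal P^\star}\dim\operatorname{null}(X)$ and, for $\rho>0$, $F(X)=\langle C,X\rangle+\rho\max\{\lambda_{\max}(-X),0\}$; write $F(X^\star)$ for the common value of $F$ on $\mathcal P^\star$. **Algorithm $(r_{\mathrm p},r_{\mathrm c})$-SBMP** (parameters $r_{\mathrm p}\ge0$,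 $r_{\mathrm c}\ge1$, $r=r_{\mathrm p}+r_{\mathrm c}$, $\alpha>0$, $\beta\in(0,1)$, $\rho$). Start with $\Omega_0\in\mathbb S^n$, any $\bar W_0\succeq0$ with $\operatorname{tr}\bar W_0=1$, and $P_0\in\mathbb R^{n\times r}$ whose columns are $r$ orthonormal eigenvectors for the $r$ largest eigenvalues of $-\Omega_0$. For $t=0,1,2,\dots$ let $$\hat F_t(X)=\langle C,X\rangle+\rho\max\{\langle\gamma\bar W_t+P_tSP_t^{\mathsf T},-X\rangle:\ S\succeq0,\ \gamma\ge0,\ \gamma+\operatorname{tr}S\le1\}.$$ 1. Let $X^\star_{t+1}$ be the minimizer of $\hat F_t(X)+\frac\alpha2\|X-\Omega_t\|^2$ over $\mathcal X_0$. Let $(W_t^\star,y_t^\star)$, with $W_t^\star=\gamma_t^\star\bar W_t+P_tS_t^\star P_t^{\mathsf T}$, minimize $\langle W-C,\Omega_t\rangle-\langle b-\mathcal A(\Omega_t),y\rangle+\frac1{2\alpha}\|W-C+\mathcal A^*(y)\|^2$ over $y\in\mathbb R^m$ and $W=\gamma\bar W_t+P_tSP_t^{\mathsf T}$ with $S\succeq0$,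 $\gamma\ge0$, $\gamma+\operatorname{tr}S\le\rho$. 2. If $t=0$ and $\mathcal A(\Omega_0)\ne b$, set $\Omega_1=X_1^\star$. Otherwise, if $\beta(F(\Omega_t)-\hat F_t(X^\star_{t+1}))\le F(\Omega_t)-F(X^\star_{t+1})$, set $\Omega_{t+1}=X^\star_{t+1}$ (*descent step*); else set $\Omega_{t+1}=\Omega_t$ (*null step*). 3. Let $S_t^\star=Q_1\Sigma_1Q_1^{\mathsf T}+Q_2\Sigma_2Q_2^{\mathsf T}$ be an eigenvalue decomposition in which $\Sigma_1$ holds the $r_{\mathrm p}$ largest eigenvalues, and let the columns of $V_t$ be $r_{\mathrm c}$ orthonormal eigenvectors for the $r_{\mathrm c}$ largest eigenvalues of $-X^\star_{t+1}$. Let $P_{t+1}\in\mathbb R^{n\times r}$ have orthonormal columns whose span contains the columns of $V_t$ and of $P_tQ_1$, and let $\bar W_{t+1}=(\gamma_t^\star\bar W_t+P_tQ_2\Sigma_2Q_2^{\mathsf T}P_t^{\mathsf T})/(\gamma_t^\star+\operatorname{tr}\Sigma_2)$ (any positive semidefinite matrix of trace one if the denominator is $0$). **Theorem.** Suppose that $A_1,\dots,A_m$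 are linearly independent, that (P) and (D) are both strictly feasible, and that strict complementarity holds, i.e. $\operatorname{rank}X^\star+\operatorname{rank}Z^\star=n$ for some $X^\star\in\mathcal P^\star$, $(y^\star,Z^\star)\in\mathcal D^\star$. Let $\rho>2D_Z+1$. There is a constant $\eta>0$, depending only on $(A,b,C)$ and $\rho$, such that for every $\alpha\ge\eta$, $\beta\in(0,\frac12]$ and $\Omega_0\in\mathbb S^n$ there are an integer $T_0>0$ and constants $q\in(0,1)$, $K>0$ such that, for all $r_{\mathrm p}\ge0$ and $r_{\mathrm c}\ge\max\{1,\sigma_{\mathrm p}\}$, every run of $(r_{\mathrm p},r_{\mathrm c})$-SBMP from $\Omega_0$ has the following properties. (a) For every $t\ge T_0$, iteration $t$ is a descent step, $F(\Omega_{t+1})-F(X^\star)\le q\,(F(\Omega_t)-F(X^\star))$ and $\operatorname{dist}(\Omega_{t+1},\mathcal P^\star)\le q\operatorname{dist}(\Omega_t,\mathcal P^\star)$. (b) There is $X_\infty\in\mathcal P^\star$ with $\|\Omega_t-X_\infty\|\le Kq^{\,t-T_0}$ for all $t\ge T_0$. (c) For every $\varepsilon>0$ there is $t\le T_0+K\max\{1,\log(1/\varepsilon)\}$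 such that for every $s\ge t$ $$F(\Omega_s)-F(X^\star)\le\varepsilon,\qquad \mathcal A(\Omega_s)=b,\quad \lambda_{\min}(\Omega_s)\ge-\varepsilon,$$ $$\|W_s^\star+\mathcal A^*(y_s^\star)-C\|^2\le\varepsilon,\quad W_s^\star\succeq0,\qquad |\langle C,\Omega_s\rangle-\langle b,y_s^\star\rangle|\le\sqrt\varepsilon .$$ -/

import Mathlib

open Matrix

attribute [local instance] Matrix.frobeniusNormedAddCommGroup

noncomputable section

/-- The trace inner product `⟨X, Y⟩ = tr (Xᵀ Y)` of real square matrices. -/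
def traceInner {n : ℕ} (X Y : Matrix (Fin n) (Fin n) ℝ) : ℝ := (Xᵀ * Y).trace

/-- The largest eigenvalue of a real symmetric matrix. -/
def lambdaMax {n : ℕ} (X : Matrix (Fin n) (Fin n) ℝ) : ℝ := sSup (spectrum ℝ X)

/-- The smallest eigenvalue of a real symmetric matrix. -/
def lambdaMin {n : ℕ} (X : Matrix (Fin n) (Fin n) ℝ) : ℝ := sInf (spectrum ℝ X)

/-- `M = Q diag(d) Qᵀ` with `Q` orthogonal and the eigenvalues `d` in decreasing order. -/
def IsSpectralDecomposition {n : ℕ} (M Q : Matrix (Fin n) (Fin n) ℝ) (d : Fin n → ℝ) : Prop :=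
  Qᵀ * Q = 1 ∧ Antitone d ∧ M = Q * diagonal d * Qᵀ

/-- The columns of `V` are `k` orthonormal eigenvectors belonging to the `k` largest
eigenvalues (counted with multiplicity) of the symmetric matrix `M`. -/
def IsTopEigenvectors {n k : ℕ} (M : Matrix (Fin n) (Fin n) ℝ)
    (V : Matrix (Fin n) (Fin k) ℝ) : Prop :=
  ∃ (h : k ≤ n) (Q : Matrix (Fin n) (Fin n) ℝ) (d : Fin n → ℝ),
    IsSpectralDecomposition M Q d ∧ V = Q.submatrix id (Fin.castLE h)

/-- The data of a pair of primal and dual semidefinite programs: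
`min ⟨C, X⟩` subject to `⟨A i, X⟩ = b i`, `X ⪰ 0`, and
`max bᵀ y` subject to `Z + ∑ i, y i • A i = C`, `Z ⪰ 0`. -/
structure SDP (n m : ℕ) where
  A : Fin m → Matrix (Fin n) (Fin n) ℝ
  b : Fin m → ℝ
  C : Matrix (Fin n) (Fin n) ℝ
  A_symm : ∀ i, (A i).IsSymm
  C_symm : C.IsSymm

namespace SDP

variable {n m : ℕ} (D : SDP n m)

/-- The linear map `𝒜(X) = (⟨A₁, X⟩, …, ⟨A_m, X⟩)`. -/
def map (X : Matrix (Fin n) (Fin n) ℝ) : Fin m → ℝ := fun i => traceInner (D.A i) X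

/-- The adjoint map `𝒜*(y) = ∑ i, y i • A i`. -/
def adj (y : Fin m → ℝ) : Matrix (Fin n) (Fin n) ℝ := ∑ i, y i • D.A i

/-- The affine space `𝒳₀` of symmetric matrices with `𝒜(X) = b`. -/
def affine : Set (Matrix (Fin n) (Fin n) ℝ) := {X | X.IsSymm ∧ D.map X = D.b}

def primalFeasible : Set (Matrix (Fin n) (Fin n) ℝ) := {X | D.map X = D.b ∧ X.PosSemidef}

def dualFeasible : Set ((Fin m → ℝ) × Matrix (Fin n) (Fin n) ℝ) :=
  {p | p.2 + D.adj p.1 = D.C ∧ p.2.PosSemidef}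

/-- The set `𝒫*` of primal optimal solutions. -/
def primalOpt : Set (Matrix (Fin n) (Fin n) ℝ) :=
  {X | X ∈ D.primalFeasible ∧ ∀ Y ∈ D.primalFeasible, traceInner D.C X ≤ traceInner D.C Y}

/-- The set `𝒟*` of dual optimal solutions `(y, Z)`. -/
def dualOpt : Set ((Fin m → ℝ) × Matrix (Fin n) (Fin n) ℝ) :=
  {p | p ∈ D.dualFeasible ∧ ∀ p' ∈ D.dualFeasible, D.b ⬝ᵥ p'.1 ≤ D.b ⬝ᵥ p.1}

/-- Slater's condition: both programs are strictly feasible. -/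
def Slater : Prop :=
  (∃ X, D.map X = D.b ∧ X.PosDef) ∧ ∃ (y : Fin m → ℝ) (Z : Matrix (Fin n) (Fin n) ℝ),
    Z + D.adj y = D.C ∧ Z.PosDef

def StrictComplementarity : Prop :=
  ∃ X ∈ D.primalOpt, ∃ p ∈ D.dualOpt, X.rank + p.2.rank = n

/-- The largest trace of `Z` over the dual optimal solutions `(y, Z)`. -/
def maxDualTrace : ℝ := sSup ((fun p => p.2.trace) '' D.dualOpt)

/-- The largest dimension of the null space of a primal optimal solution. -/
def maxNullity : ℕ :=
  sSup ((fun X => Module.finrank ℝ (LinearMap.ker X.mulVecLin)) '' D.primalOpt)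

/-- The penalized primal cost `F(X) = ⟨C, X⟩ + ρ max {λ_max(-X), 0}`. -/
def cost (ρ : ℝ) (X : Matrix (Fin n) (Fin n) ℝ) : ℝ :=
  traceInner D.C X + ρ * max (lambdaMax (-X)) 0

/-- The set of all `γ • Wb + P S Pᵀ` with `S ⪰ 0`, `γ ≥ 0` and `γ + tr S ≤ c`. -/
def modelSet {r : ℕ} (c : ℝ) (Wb : Matrix (Fin n) (Fin n) ℝ) (P : Matrix (Fin n) (Fin r) ℝ) :
    Set (Matrix (Fin n) (Fin n) ℝ) :=
  {W | ∃ (γ : ℝ) (S : Matrix (Fin r) (Fin r) ℝ),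
    0 ≤ γ ∧ S.PosSemidef ∧ γ + S.trace ≤ c ∧ W = γ • Wb + P * S * Pᵀ}

/-- The lower model `⟨C, X⟩ + ρ max ⟨γ Wb + P S Pᵀ, -X⟩`, the maximum being over
`S ⪰ 0`, `γ ≥ 0`, `γ + tr S ≤ 1`. -/
def model {r : ℕ} (ρ : ℝ) (Wb : Matrix (Fin n) (Fin n) ℝ) (P : Matrix (Fin n) (Fin r) ℝ)
    (X : Matrix (Fin n) (Fin n) ℝ) : ℝ :=
  traceInner D.C X + ρ * sSup ((fun W => traceInner W (-X)) '' modelSet 1 Wb P)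

/-- The objective of the dual form of the master problem with proximal center `Ω`. -/
def dualMaster (α : ℝ) (Ω W : Matrix (Fin n) (Fin n) ℝ) (y : Fin m → ℝ) : ℝ :=
  traceInner (W - D.C) Ω - (D.b - D.map Ω) ⬝ᵥ y + 1 / (2 * α) * ‖W - D.C + D.adj y‖ ^ 2

/-- The sufficient decrease test comparing the center `Ω` with the candidate `X`. -/
def DescentTest {r : ℕ} (ρ β : ℝ) (Wb : Matrix (Fin n) (Fin n) ℝ)
    (P : Matrix (Fin n) (Fin r) ℝ) (Ω X : Matrix (Fin n) (Fin n) ℝ) : Prop :=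
  β * (D.cost ρ Ω - D.model ρ Wb P X) ≤ D.cost ρ Ω - D.cost ρ X

/-- A (non-terminated) run of the `(r_p, r_c)` spectral bundle method for the primal program, with
penalty `ρ`, proximal parameter `α` and descent parameter `β`. All choices that the method
leaves open (minimizers, eigenvectors, orthonormalization) are arbitrary. -/
structure SBMPRun (ρ α β : ℝ) (rp rc : ℕ) where
  /-- reference points `Ω_t` -/
  Ω : ℕ → Matrix (Fin n) (Fin n) ℝ
  /-- candidates: `cand t` is `X*_{t+1}` -/
  cand : ℕ → Matrix (Fin n) (Fin n) ℝ
  /-- weight matrices of the model -/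
  Wb : ℕ → Matrix (Fin n) (Fin n) ℝ
  /-- orthonormal matrices of the model -/
  P : ℕ → Matrix (Fin n) (Fin (rp + rc)) ℝ
  /-- `γ*_t` -/
  γ : ℕ → ℝ
  /-- `S*_t` -/
  S : ℕ → Matrix (Fin (rp + rc)) (Fin (rp + rc)) ℝ
  /-- `W*_t` -/
  W : ℕ → Matrix (Fin n) (Fin n) ℝ
  /-- dual iterates `y*_t` -/
  y : ℕ → Fin m → ℝ
  /-- eigenvectors `[Q₁ Q₂]` of `S*_t` -/
  Q : ℕ → Matrix (Fin (rp + rc)) (Fin (rp + rc)) ℝ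
  /-- eigenvalues of `S*_t`, in decreasing order -/
  σ : ℕ → Fin (rp + rc) → ℝ
  /-- top `r_c` eigenvectors of `-X*_{t+1}` -/
  V : ℕ → Matrix (Fin n) (Fin rc) ℝ
  init_symm : (Ω 0).IsSymm
  init_P : IsTopEigenvectors (-(Ω 0)) (P 0)
  init_Wb : (Wb 0).PosSemidef ∧ (Wb 0).trace = 1
  /-- `X*_{t+1}` solves the master problem. -/
  master : ∀ t, cand t ∈ D.affine ∧ IsMinOn
    (fun X => D.model ρ (Wb t) (P t) X + α / 2 * ‖X - Ω t‖ ^ 2) D.affine (cand t)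
  γ_nonneg : ∀ t, 0 ≤ γ t
  S_posSemidef : ∀ t, (S t).PosSemidef
  γ_add_trace : ∀ t, γ t + (S t).trace ≤ ρ
  W_eq : ∀ t, W t = γ t • Wb t + P t * S t * (P t)ᵀ
  /-- `(W*_t, y*_t)` solves the dual form of the master problem. -/
  dual_master : ∀ t, ∀ W' ∈ modelSet ρ (Wb t) (P t), ∀ y' : Fin m → ℝ,
    D.dualMaster α (Ω t) (W t) (y t) ≤ D.dualMaster α (Ω t) W' y'
  /-- If `Ω_0` violates the affine constraint, the first candidate is accepted. -/
  step_affine : D.map (Ω 0) ≠ D.b → Ω 1 = cand 0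
  step_descent : ∀ t, (t = 0 → D.map (Ω 0) = D.b) →
    D.DescentTest ρ β (Wb t) (P t) (Ω t) (cand t) → Ω (t + 1) = cand t
  step_null : ∀ t, (t = 0 → D.map (Ω 0) = D.b) →
    ¬ D.DescentTest ρ β (Wb t) (P t) (Ω t) (cand t) → Ω (t + 1) = Ω t
  S_eig : ∀ t, IsSpectralDecomposition (S t) (Q t) (σ t)
  V_top : ∀ t, IsTopEigenvectors (-(cand t)) (V t)
  /-- `P_{t+1}` has orthonormal columns whose span contains the columns of `V_t` and `P_t Q₁`
  (so it is spanned by them if they are independent). -/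
  P_orth : ∀ t, (P (t + 1))ᵀ * P (t + 1) = 1
  P_span_V : ∀ t, ∃ R : Matrix (Fin (rp + rc)) (Fin rc) ℝ, V t = P (t + 1) * R
  P_span_past : ∀ t, ∃ R : Matrix (Fin (rp + rc)) (Fin rp) ℝ,
    P t * (Q t).submatrix id (Fin.castAdd rc) = P (t + 1) * R
  /-- Update of the weight, `(γ + tr Σ₂) W̄_{t+1} = γ W̄_t + P_t Q₂ Σ₂ Q₂ᵀ P_tᵀ`; if `γ + tr Σ₂ = 0`
  then both sides vanish and any normalized weight is allowed. -/
  Wb_update : ∀ t, (γ t + ∑ j : Fin rc, σ t (Fin.natAdd rp j)) • Wb (t + 1) =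
    γ t • Wb t + P t * ((Q t).submatrix id (Fin.natAdd rp)
      * diagonal (fun j => σ t (Fin.natAdd rp j))
      * ((Q t).submatrix id (Fin.natAdd rp))ᵀ) * (P t)ᵀ
  Wb_normalized : ∀ t, (Wb (t + 1)).PosSemidef ∧ (Wb (t + 1)).trace = 1

/-- Iteration `t` of the run is a descent step. -/
def SBMPRun.IsDescentStep {D : SDP n m} {ρ α β : ℝ} {rp rc : ℕ}
    (R : D.SBMPRun ρ α β rp rc) (t : ℕ) : Prop :=
  (t = 0 → D.map (R.Ω 0) = D.b) ∧
    D.DescentTest ρ β (R.Wb t) (R.P t) (R.Ω t) (R.cand t) ∧ R.Ω (t + 1) = R.cand t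

/-- The triple `(Ω, W, y)` satisfies the accuracy conditions at level `ε`: cost gap,
approximate primal feasibility, approximate dual feasibility, approximate optimality. -/
def IsAccurate (ρ ε : ℝ) (Ω W : Matrix (Fin n) (Fin n) ℝ) (y : Fin m → ℝ) : Prop :=
  (∀ X ∈ D.primalOpt, D.cost ρ Ω - D.cost ρ X ≤ ε) ∧
  (D.map Ω - D.b = 0 ∧ -ε ≤ lambdaMin Ω) ∧
  (‖W + D.adj y - D.C‖ ^ 2 ≤ ε ∧ W.PosSemidef) ∧
  |traceInner D.C Ω - D.b ⬝ᵥ y| ≤ Real.sqrt ε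

end SDP

end

/-!
Write `τ(X) = max {λ_max(-X), 0}`, the least `s ≥ 0` with `X + s I ⪰ 0` (`psdDefect`).

*Geometry of the problem.* Strong duality (`exists_dualFeasible_traceInner_eq_zero`) gives, for a
dual solution `(y, Z)`, the identity `F(X) - F* = ⟨Z, X + τ(X) I⟩ + (ρ - tr Z) τ(X)` on the affine
space, with both terms nonnegative. A small gap `g` therefore makes `τ(X)` of order `g` and `Z X`
of order `√g`. A linear error bound moves `X` to a point of the affine space with `Z X = 0`, and
strict complementarity allows repairing the remaining lack of positive semidefiniteness by a step
of the same order towards a solution of maximal rank. This is quadratic growth, `μ dist(X, 𝒫*)² ≤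
F(X) - F*` for gaps at most `1` (`exists_quadratic_growth`).

*Quadratic accuracy.* If the span of `P` contains the top `r_c` eigenvectors of `-X̂` and the
remaining eigenvalues of `-X̂` are at most `-δ`, then `F - F̂ ≤ (6 ρ / δ) ‖X - X̂‖²`
(`cost_le_model_add`). By compactness of `𝒫*` and `r_c ≥ σ_p`, such a `δ` exists uniformly near
`𝒫*` (`exists_separation`), and `η = 12 ρ / δ` makes the error at most `α/2 ‖X - X̂‖²`.

*Reaching the solution set.* The first-order conditions of the dual form of the master problem
identify the candidate and provide the aggregated minorant `⟨C - W, ·⟩` (`master_eq`). As in the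
classical analysis of bundle methods, a descent step decreases `F` and a null step increases the
optimal value of the master problem by a definite amount as long as the gap is not small, so the
gap falls below any level within a number of iterations that is the same for all runs
(`exists_iteration_bound`).

*Linear rate.* When the gap of the reference point first gets small, that point is the initial
point or the last candidate, so its top eigenvectors are in the model. By quadratic accuracy the
next step is a descent step, and inductively so are all later ones (`accurate_of_gap_le`).
Moreover each such step satisfies the inequality of an exact proximal step for `F`, which together
with quadratic growth contracts the gap and the distance to `𝒫*` (`tail_convergence`). The step
lengths are then summable, and the dual residual and the duality gap are bounded by them.
-/

attribute [local instance] Matrix.frobeniusNormedSpace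

/-! ### The trace inner product and the Frobenius norm -/

section TraceInner

variable {n k : ℕ}

theorem traceInner_eq_sum (X Y : Matrix (Fin n) (Fin n) ℝ) :
    traceInner X Y = ∑ i, ∑ j, X i j * Y i j := by
  rw [Finset.sum_comm]
  simp [traceInner, Matrix.trace, Matrix.mul_apply]

theorem traceInner_comm (X Y : Matrix (Fin n) (Fin n) ℝ) :
    traceInner X Y = traceInner Y X := by
  simp only [traceInner_eq_sum, mul_comm]

theorem traceInner_add_left (X Y Z : Matrix (Fin n) (Fin n) ℝ) :
    traceInner (X + Y) Z = traceInner X Z + traceInner Y Z := by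
  simp [traceInner, Matrix.add_mul]

theorem traceInner_add_right (X Y Z : Matrix (Fin n) (Fin n) ℝ) :
    traceInner X (Y + Z) = traceInner X Y + traceInner X Z := by
  simp [traceInner, Matrix.mul_add]

theorem traceInner_sub_left (X Y Z : Matrix (Fin n) (Fin n) ℝ) :
    traceInner (X - Y) Z = traceInner X Z - traceInner Y Z := by
  simp [traceInner, Matrix.sub_mul]

theorem traceInner_sub_right (X Y Z : Matrix (Fin n) (Fin n) ℝ) :
    traceInner X (Y - Z) = traceInner X Y - traceInner X Z := by
  simp [traceInner, Matrix.mul_sub]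

theorem traceInner_neg_right (X Y : Matrix (Fin n) (Fin n) ℝ) :
    traceInner X (-Y) = -traceInner X Y := by
  simp [traceInner]

theorem traceInner_smul_left (c : ℝ) (X Y : Matrix (Fin n) (Fin n) ℝ) :
    traceInner (c • X) Y = c * traceInner X Y := by
  simp [traceInner]

theorem traceInner_smul_right (c : ℝ) (X Y : Matrix (Fin n) (Fin n) ℝ) :
    traceInner X (c • Y) = c * traceInner X Y := by
  simp [traceInner]

theorem traceInner_one_right (X : Matrix (Fin n) (Fin n) ℝ) : traceInner X 1 = X.trace := by
  simp [traceInner]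

theorem norm_sq_eq_sum (X : Matrix (Fin n) (Fin k) ℝ) : ‖X‖ ^ 2 = ∑ i, ∑ j, X i j ^ 2 := by
  have h : 0 ≤ ∑ i, ∑ j, X i j ^ 2 :=
    Finset.sum_nonneg fun i _ => Finset.sum_nonneg fun j _ => sq_nonneg _
  rw [Matrix.frobenius_norm_def, ← Real.sqrt_eq_rpow]
  simp only [Real.rpow_two, Real.norm_eq_abs, sq_abs]
  exact Real.sq_sqrt h

theorem norm_sq_eq_traceInner (X : Matrix (Fin n) (Fin n) ℝ) : ‖X‖ ^ 2 = traceInner X X := by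
  rw [norm_sq_eq_sum, traceInner_eq_sum]
  simp only [sq]

theorem norm_sq_eq_trace (X : Matrix (Fin n) (Fin k) ℝ) : ‖X‖ ^ 2 = (Xᵀ * X).trace := by
  rw [norm_sq_eq_sum, Finset.sum_comm]
  simp [Matrix.trace, Matrix.mul_apply, sq]

theorem norm_add_sq_eq (X Y : Matrix (Fin n) (Fin n) ℝ) :
    ‖X + Y‖ ^ 2 = ‖X‖ ^ 2 + 2 * traceInner X Y + ‖Y‖ ^ 2 := by
  simp only [norm_sq_eq_traceInner, traceInner_add_left, traceInner_add_right,
    traceInner_comm Y X]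
  ring

theorem abs_traceInner_le (X Y : Matrix (Fin n) (Fin n) ℝ) :
    |traceInner X Y| ≤ ‖X‖ * ‖Y‖ := by
  apply abs_le_of_sq_le_sq _ (by positivity)
  rw [mul_pow, norm_sq_eq_sum, norm_sq_eq_sum, traceInner_eq_sum]
  simp only [← Finset.sum_product']
  exact Finset.sum_mul_sq_le_sq_mul_sq _ _ _

theorem traceInner_le (X Y : Matrix (Fin n) (Fin n) ℝ) : traceInner X Y ≤ ‖X‖ * ‖Y‖ :=
  (abs_le.1 (abs_traceInner_le X Y)).2

theorem traceInner_mul_mul_transpose (V : Matrix (Fin n) (Fin k) ℝ)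
    (S : Matrix (Fin k) (Fin k) ℝ) (X : Matrix (Fin n) (Fin n) ℝ) :
    traceInner (V * S * Vᵀ) X = traceInner S (Vᵀ * X * V) := by
  simp only [traceInner, Matrix.transpose_mul, Matrix.transpose_transpose]
  rw [Matrix.mul_assoc, Matrix.trace_mul_comm]
  simp only [Matrix.mul_assoc]

theorem traceInner_vecMulVec (u v : Fin n → ℝ) (X : Matrix (Fin n) (Fin n) ℝ) :
    traceInner (vecMulVec u v) X = u ⬝ᵥ (X *ᵥ v) := by
  rw [traceInner_eq_sum]
  simp only [vecMulVec_apply, dotProduct, mulVec, Finset.mul_sum]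
  refine Finset.sum_congr rfl fun i _ => Finset.sum_congr rfl fun j _ => by ring

theorem dotProduct_self_nonneg_real (w : Fin k → ℝ) : 0 ≤ w ⬝ᵥ w :=
  Finset.sum_nonneg fun i _ => mul_self_nonneg (w i)

theorem sq_dotProduct_mulVec_le (u v : Fin n → ℝ) (X : Matrix (Fin n) (Fin n) ℝ) :
    (u ⬝ᵥ (X *ᵥ v)) ^ 2 ≤ ‖X‖ ^ 2 * ((u ⬝ᵥ u) * (v ⬝ᵥ v)) := by
  have h : ‖vecMulVec u v‖ ^ 2 = (u ⬝ᵥ u) * (v ⬝ᵥ v) := by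
    rw [norm_sq_eq_sum]
    simp only [vecMulVec_apply, dotProduct, Finset.sum_mul_sum]
    refine Finset.sum_congr rfl fun i _ => Finset.sum_congr rfl fun j _ => by ring
  rw [← h, ← traceInner_vecMulVec, ← mul_pow, mul_comm, ← sq_abs]
  exact pow_le_pow_left₀ (abs_nonneg _) (abs_traceInner_le _ _) 2

theorem abs_dotProduct_mulVec_self_le (w : Fin n → ℝ) (X : Matrix (Fin n) (Fin n) ℝ) :
    |w ⬝ᵥ (X *ᵥ w)| ≤ ‖X‖ * (w ⬝ᵥ w) := by
  have hw := dotProduct_self_nonneg_real w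
  apply abs_le_of_sq_le_sq _ (by positivity)
  rw [mul_pow, sq (w ⬝ᵥ w)]
  exact sq_dotProduct_mulVec_le w w X

theorem isSymm_mul_mul_transpose (V : Matrix (Fin n) (Fin k) ℝ)
    {S : Matrix (Fin k) (Fin k) ℝ} (hS : S.IsSymm) : (V * S * Vᵀ).IsSymm := by
  simp only [Matrix.IsSymm, Matrix.transpose_mul, Matrix.transpose_transpose, hS.eq,
    Matrix.mul_assoc]

theorem Matrix.IsSymm.dotProduct_mulVec_comm {X : Matrix (Fin n) (Fin n) ℝ} (hX : X.IsSymm)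
    (u v : Fin n → ℝ) : u ⬝ᵥ (X *ᵥ v) = v ⬝ᵥ (X *ᵥ u) := by
  rw [Matrix.dotProduct_mulVec, ← Matrix.mulVec_transpose, hX.eq, dotProduct_comm]

end TraceInner

/-! ### Positive semidefinite matrices -/

section PosSemidef

variable {n k : ℕ}

theorem posSemidef_iff_isSymm {X : Matrix (Fin n) (Fin n) ℝ} :
    X.PosSemidef ↔ X.IsSymm ∧ ∀ w, 0 ≤ w ⬝ᵥ (X *ᵥ w) := by
  rw [posSemidef_iff_dotProduct_mulVec]
  simp [Matrix.IsHermitian, Matrix.IsSymm, conjTranspose_eq_transpose_of_trivial]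

theorem Matrix.PosSemidef.isSymm {X : Matrix (Fin n) (Fin n) ℝ} (hX : X.PosSemidef) : X.IsSymm :=
  (posSemidef_iff_isSymm.1 hX).1

theorem Matrix.PosSemidef.quad_nonneg {X : Matrix (Fin n) (Fin n) ℝ} (hX : X.PosSemidef)
    (w : Fin n → ℝ) : 0 ≤ w ⬝ᵥ (X *ᵥ w) :=
  (posSemidef_iff_isSymm.1 hX).2 w

theorem Matrix.PosSemidef.exists_eq_transpose_mul_self {X : Matrix (Fin n) (Fin n) ℝ}
    (hX : X.PosSemidef) : ∃ B : Matrix (Fin n) (Fin n) ℝ, X = Bᵀ * B := by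
  open scoped MatrixOrder in
  obtain ⟨B, hB⟩ := CStarAlgebra.nonneg_iff_eq_star_mul_self.mp hX.nonneg
  exact ⟨B, by simpa [star_eq_conjTranspose, conjTranspose_eq_transpose_of_trivial] using hB⟩

theorem posSemidef_mul_mul_transpose (V : Matrix (Fin n) (Fin k) ℝ)
    {S : Matrix (Fin k) (Fin k) ℝ} (hS : S.PosSemidef) : (V * S * Vᵀ).PosSemidef := by
  simpa [conjTranspose_eq_transpose_of_trivial] using hS.mul_mul_conjTranspose_same V

theorem posSemidef_vecMulVec (a : Fin k → ℝ) : (vecMulVec a a).PosSemidef := by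
  simpa using posSemidef_vecMulVec_self_star a

/-- For positive semidefinite `Z` and `Y`, the product `Z Y` is controlled by `⟨Z, Y⟩`: factor
`Z = Bᵀ B` and `Y = Dᵀ D`, so that `Z Y = Bᵀ (B Dᵀ) D` and `‖B Dᵀ‖² = ⟨Z, Y⟩`. -/
theorem norm_mul_sq_le {Z Y : Matrix (Fin n) (Fin n) ℝ} (hZ : Z.PosSemidef)
    (hY : Y.PosSemidef) : ‖Z * Y‖ ^ 2 ≤ Z.trace * Y.trace * traceInner Z Y := by
  obtain ⟨B, rfl⟩ := hZ.exists_eq_transpose_mul_self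
  obtain ⟨D, rfl⟩ := hY.exists_eq_transpose_mul_self
  have h : traceInner (Bᵀ * B) (Dᵀ * D) = ‖B * Dᵀ‖ ^ 2 := by
    rw [norm_sq_eq_trace, traceInner]
    simp only [Matrix.transpose_mul, Matrix.transpose_transpose]
    rw [← Matrix.mul_assoc, Matrix.trace_mul_comm]
    simp only [Matrix.mul_assoc]
  rw [h, ← norm_sq_eq_trace, ← norm_sq_eq_trace, ← mul_pow, ← mul_pow]
  refine pow_le_pow_left₀ (norm_nonneg _) ?_ 2
  calc ‖Bᵀ * B * (Dᵀ * D)‖ = ‖Bᵀ * (B * Dᵀ) * D‖ := by simp only [Matrix.mul_assoc]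
    _ ≤ ‖Bᵀ‖ * ‖B * Dᵀ‖ * ‖D‖ :=
      (Matrix.frobenius_norm_mul _ _).trans
        (mul_le_mul_of_nonneg_right (Matrix.frobenius_norm_mul _ _) (norm_nonneg _))
    _ = ‖B‖ * ‖D‖ * ‖B * Dᵀ‖ := by rw [Matrix.frobenius_norm_transpose]; ring

theorem traceInner_nonneg {Z Y : Matrix (Fin n) (Fin n) ℝ} (hZ : Z.PosSemidef)
    (hY : Y.PosSemidef) : 0 ≤ traceInner Z Y := by
  obtain ⟨B, rfl⟩ := hZ.exists_eq_transpose_mul_self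
  have h := (posSemidef_mul_mul_transpose B hY).trace_nonneg
  rwa [Matrix.mul_assoc, Matrix.trace_mul_comm, Matrix.mul_assoc, Matrix.trace_mul_comm,
    ← hZ.isSymm.eq] at h

theorem mul_eq_zero_of_traceInner_eq_zero {Z Y : Matrix (Fin n) (Fin n) ℝ} (hZ : Z.PosSemidef)
    (hY : Y.PosSemidef) (h : traceInner Z Y = 0) : Z * Y = 0 := by
  have := norm_mul_sq_le hZ hY
  rw [h, mul_zero] at this
  exact norm_eq_zero.1 (pow_eq_zero_iff two_ne_zero |>.1 (le_antisymm this (sq_nonneg _)))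

theorem Matrix.PosSemidef.norm_le_trace {X : Matrix (Fin n) (Fin n) ℝ} (hX : X.PosSemidef) :
    ‖X‖ ≤ X.trace := by
  obtain ⟨B, rfl⟩ := hX.exists_eq_transpose_mul_self
  rw [← norm_sq_eq_trace, sq]
  exact (Matrix.frobenius_norm_mul _ _).trans (by rw [Matrix.frobenius_norm_transpose])

theorem dotProduct_add_smul_one_mulVec (X : Matrix (Fin n) (Fin n) ℝ) (s : ℝ) (w : Fin n → ℝ) :
    w ⬝ᵥ ((X + s • (1 : Matrix (Fin n) (Fin n) ℝ)) *ᵥ w) = w ⬝ᵥ (X *ᵥ w) + s * (w ⬝ᵥ w) := by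
  simp [Matrix.add_mulVec, Matrix.smul_mulVec, dotProduct_add]

theorem posSemidef_add_smul_one {X : Matrix (Fin n) (Fin n) ℝ} (hX : X.IsSymm) {s : ℝ}
    (h : ∀ w, -(s * (w ⬝ᵥ w)) ≤ w ⬝ᵥ (X *ᵥ w)) : (X + s • (1 : Matrix _ _ ℝ)).PosSemidef := by
  refine posSemidef_iff_isSymm.2 ⟨hX.add (by simp [Matrix.IsSymm]), fun w => ?_⟩
  rw [dotProduct_add_smul_one_mulVec]
  linarith [h w]

theorem Matrix.PosDef.exists_pos_smul_le {X : Matrix (Fin n) (Fin n) ℝ} (hX : X.PosDef) :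
    ∃ l : ℝ, 0 < l ∧ ∀ w, l * (w ⬝ᵥ w) ≤ w ⬝ᵥ (X *ᵥ w) := by
  obtain ⟨l, hl, hle⟩ : ∃ l : ℝ, 0 < l ∧ ∀ i, l ≤ hX.1.eigenvalues i := by
    rcases isEmpty_or_nonempty (Fin n) with h | h
    · exact ⟨1, one_pos, fun i => h.elim i⟩
    · obtain ⟨i, hi⟩ := Finite.exists_min hX.1.eigenvalues
      exact ⟨_, hX.eigenvalues_pos i, hi⟩
  refine ⟨l, hl, fun w => ?_⟩
  have hs : (X + (-l) • (1 : Matrix _ _ ℝ)).IsHermitian := by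
    simp [Matrix.IsHermitian, conjTranspose_eq_transpose_of_trivial, hX.posSemidef.isSymm.eq]
  have : (X + (-l) • (1 : Matrix _ _ ℝ)).PosSemidef := by
    refine posSemidef_iff_isHermitian_and_spectrum_nonneg.2 ⟨hs, fun a ha => ?_⟩
    have h1 : a + l ∈ spectrum ℝ X := by
      have := spectrum.add_mem_add_iff (r := a) (s := l)
        (a := X + (-l) • (1 : Matrix (Fin n) (Fin n) ℝ)) (R := ℝ)
      rw [← this] at ha
      simpa [Algebra.algebraMap_eq_smul_one, add_assoc] using ha
    rw [hX.1.spectrum_real_eq_range_eigenvalues] at h1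
    obtain ⟨i, hi⟩ := h1
    have := hle i
    simp only [Set.mem_ofPred_eq]
    linarith
  have := this.quad_nonneg w
  rw [dotProduct_add_smul_one_mulVec] at this
  linarith

end PosSemidef

/-! ### The negative part of the spectrum -/

section PsdDefect

variable {n : ℕ}

/-- `max {λ_max(-X), 0}`: for symmetric `X`, the least `s ≥ 0` such that `X + s I` is positive
semidefinite. -/
noncomputable def psdDefect (X : Matrix (Fin n) (Fin n) ℝ) : ℝ := max (lambdaMax (-X)) 0

theorem psdDefect_nonneg (X : Matrix (Fin n) (Fin n) ℝ) : 0 ≤ psdDefect X := le_max_right _ _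

theorem neg_mem_spectrum_of_mem_add {X : Matrix (Fin n) (Fin n) ℝ} {s a : ℝ}
    (ha : a ∈ spectrum ℝ (X + s • (1 : Matrix (Fin n) (Fin n) ℝ))) : s - a ∈ spectrum ℝ (-X) := by
  have h1 : a - s ∈ spectrum ℝ X := by
    have := spectrum.add_mem_add_iff (r := a - s) (s := s) (a := X) (R := ℝ)
    rw [← this]
    simpa [Algebra.algebraMap_eq_smul_one, add_comm] using ha
  have := spectrum.neg_eq (R := ℝ) X
  rw [← this]
  simpa using h1

theorem mem_spectrum_add_of_neg {X : Matrix (Fin n) (Fin n) ℝ} {s a : ℝ}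
    (ha : a ∈ spectrum ℝ (-X)) : s - a ∈ spectrum ℝ (X + s • (1 : Matrix (Fin n) (Fin n) ℝ)) := by
  rw [← spectrum.neg_eq, Set.mem_neg] at ha
  have := spectrum.add_mem_add_iff (r := -a) (s := s) (a := X) (R := ℝ)
  rw [← this] at ha
  simpa [Algebra.algebraMap_eq_smul_one, add_comm, sub_eq_add_neg] using ha

theorem posSemidef_add_psdDefect {X : Matrix (Fin n) (Fin n) ℝ} (hX : X.IsSymm) :
    (X + psdDefect X • (1 : Matrix (Fin n) (Fin n) ℝ)).PosSemidef := by
  have hH : (-X).IsHermitian := by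
    simpa [Matrix.IsHermitian, conjTranspose_eq_transpose_of_trivial] using hX.eq
  have hs : (X + psdDefect X • (1 : Matrix (Fin n) (Fin n) ℝ)).IsHermitian := by
    simp [Matrix.IsHermitian, conjTranspose_eq_transpose_of_trivial, hX.eq]
  refine posSemidef_iff_isHermitian_and_spectrum_nonneg.2 ⟨hs, fun a ha => ?_⟩
  have h1 := neg_mem_spectrum_of_mem_add ha
  have hb : BddAbove (spectrum ℝ (-X)) := (Matrix.finite_real_spectrum).bddAbove
  have h2 : psdDefect X - a ≤ lambdaMax (-X) := le_csSup hb h1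
  have h3 : lambdaMax (-X) ≤ psdDefect X := le_max_left _ _
  simp only [Set.mem_ofPred_eq]
  linarith

theorem psdDefect_le {X : Matrix (Fin n) (Fin n) ℝ} {s : ℝ} (hs : 0 ≤ s)
    (h : (X + s • (1 : Matrix (Fin n) (Fin n) ℝ)).PosSemidef) : psdDefect X ≤ s := by
  refine max_le (Real.sSup_le (fun a ha => ?_) hs) hs
  have := (posSemidef_iff_isHermitian_and_spectrum_nonneg.1 h).2 (mem_spectrum_add_of_neg (s := s) ha)
  simp only [Set.mem_ofPred_eq] at this
  linarith

theorem quad_ge_neg_psdDefect {X : Matrix (Fin n) (Fin n) ℝ} (hX : X.IsSymm) (w : Fin n → ℝ) :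
    -(psdDefect X * (w ⬝ᵥ w)) ≤ w ⬝ᵥ (X *ᵥ w) := by
  have := (posSemidef_add_psdDefect hX).quad_nonneg w
  rw [dotProduct_add_smul_one_mulVec] at this
  linarith

theorem psdDefect_le_of_quad {X : Matrix (Fin n) (Fin n) ℝ} (hX : X.IsSymm) {s : ℝ} (hs : 0 ≤ s)
    (h : ∀ w, -(s * (w ⬝ᵥ w)) ≤ w ⬝ᵥ (X *ᵥ w)) : psdDefect X ≤ s :=
  psdDefect_le hs (posSemidef_add_smul_one hX h)

theorem psdDefect_eq_zero {X : Matrix (Fin n) (Fin n) ℝ} (hX : X.PosSemidef) : psdDefect X = 0 :=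
  le_antisymm (psdDefect_le le_rfl (by simpa using hX)) (psdDefect_nonneg X)

theorem psdDefect_le_add_norm {X Y : Matrix (Fin n) (Fin n) ℝ} (hX : X.IsSymm) (hY : Y.IsSymm) :
    psdDefect Y ≤ psdDefect X + ‖Y - X‖ := by
  refine psdDefect_le_of_quad hY (add_nonneg (psdDefect_nonneg X) (norm_nonneg _)) fun w => ?_
  have h1 := quad_ge_neg_psdDefect hX w
  have h2 := (abs_le.1 (abs_dotProduct_mulVec_self_le w (Y - X))).1
  rw [Matrix.sub_mulVec, dotProduct_sub] at h2
  linarith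

theorem psdDefect_convex {X Y : Matrix (Fin n) (Fin n) ℝ} (hX : X.IsSymm) (hY : Y.IsSymm)
    {a b : ℝ} (ha : 0 ≤ a) (hb : 0 ≤ b) :
    psdDefect (a • X + b • Y) ≤ a * psdDefect X + b * psdDefect Y := by
  refine psdDefect_le_of_quad ((hX.smul a).add (hY.smul b))
    (add_nonneg (mul_nonneg ha (psdDefect_nonneg X)) (mul_nonneg hb (psdDefect_nonneg Y))) fun w => ?_
  have h1 := mul_le_mul_of_nonneg_left (quad_ge_neg_psdDefect hX w) ha
  have h2 := mul_le_mul_of_nonneg_left (quad_ge_neg_psdDefect hY w) hb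
  simp only [Matrix.add_mulVec, Matrix.smul_mulVec, dotProduct_add, dotProduct_smul, smul_eq_mul]
  linarith

/-- Pairing `-X` with a positive semidefinite `W` gains at most `tr W` times the negative part. -/
theorem traceInner_neg_le {W X : Matrix (Fin n) (Fin n) ℝ} (hW : W.PosSemidef) (hX : X.IsSymm) :
    traceInner W (-X) ≤ W.trace * psdDefect X := by
  have := traceInner_nonneg hW (posSemidef_add_psdDefect hX)
  rw [traceInner_add_right, traceInner_smul_right, traceInner_one_right] at this
  rw [traceInner_neg_right]
  linarith

theorem neg_le_lambdaMin {X : Matrix (Fin n) (Fin n) ℝ} {s : ℝ} (hs : 0 ≤ s)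
    (h : (X + s • (1 : Matrix (Fin n) (Fin n) ℝ)).PosSemidef) : -s ≤ lambdaMin X := by
  refine Real.le_sInf (fun a ha => ?_) (by linarith)
  have h1 : -a ∈ spectrum ℝ (-X) := by
    rw [← spectrum.neg_eq]
    simpa using ha
  have := (posSemidef_iff_isHermitian_and_spectrum_nonneg.1 h).2 (mem_spectrum_add_of_neg (s := s) h1)
  simp only [Set.mem_ofPred_eq] at this
  linarith

end PsdDefect

/-! ### Duality -/

namespace SDP

variable {n m : ℕ} (D : SDP n m)

theorem map_add (X Y : Matrix (Fin n) (Fin n) ℝ) : D.map (X + Y) = D.map X + D.map Y := by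
  ext i
  simp [map, traceInner_add_right]

theorem map_sub (X Y : Matrix (Fin n) (Fin n) ℝ) : D.map (X - Y) = D.map X - D.map Y := by
  ext i
  simp [map, traceInner_sub_right]

theorem map_smul (c : ℝ) (X : Matrix (Fin n) (Fin n) ℝ) : D.map (c • X) = c • D.map X := by
  ext i
  simp [map, traceInner_smul_right]

theorem traceInner_adj (y : Fin m → ℝ) (X : Matrix (Fin n) (Fin n) ℝ) :
    traceInner (D.adj y) X = y ⬝ᵥ D.map X := by
  simp [adj, map, traceInner, dotProduct, Matrix.transpose_sum, Matrix.sum_mul, Matrix.trace_sum]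

theorem adj_isSymm (y : Fin m → ℝ) : (D.adj y).IsSymm := by
  simp only [adj, Matrix.IsSymm, Matrix.transpose_sum, Matrix.transpose_smul]
  exact Finset.sum_congr rfl fun i _ => by rw [(D.A_symm i).eq]

theorem map_transpose (X : Matrix (Fin n) (Fin n) ℝ) : D.map Xᵀ = D.map X := by
  ext i
  simp only [map, traceInner, (D.A_symm i).eq]
  rw [← Matrix.trace_transpose, Matrix.transpose_mul, Matrix.transpose_transpose, (D.A_symm i).eq,
    Matrix.trace_mul_comm]

theorem traceInner_C_transpose (X : Matrix (Fin n) (Fin n) ℝ) :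
    traceInner D.C Xᵀ = traceInner D.C X := by
  simp only [traceInner, D.C_symm.eq]
  rw [← Matrix.trace_transpose, Matrix.transpose_mul, Matrix.transpose_transpose, D.C_symm.eq,
    Matrix.trace_mul_comm]

variable {D}

theorem traceInner_C_eq {p : (Fin m → ℝ) × Matrix (Fin n) (Fin n) ℝ} (hp : p.2 + D.adj p.1 = D.C)
    {X : Matrix (Fin n) (Fin n) ℝ} (hX : D.map X = D.b) :
    traceInner D.C X = traceInner p.2 X + D.b ⬝ᵥ p.1 := by
  rw [← hp, traceInner_add_left, traceInner_adj, hX, dotProduct_comm D.b]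

/-- The cone of matrices, not necessarily symmetric, with nonnegative quadratic form. -/
def quadCone (n : ℕ) : Set (Matrix (Fin n) (Fin n) ℝ) := {X | ∀ w, 0 ≤ w ⬝ᵥ (X *ᵥ w)}

theorem mem_interior_quadCone {X : Matrix (Fin n) (Fin n) ℝ} {l : ℝ} (hl : 0 < l)
    (h : ∀ w, l * (w ⬝ᵥ w) ≤ w ⬝ᵥ (X *ᵥ w)) : X ∈ interior (quadCone n) := by
  rw [mem_interior_iff_mem_nhds]
  refine Filter.mem_of_superset (Metric.ball_mem_nhds X hl) fun Y hY w => ?_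
  rw [Metric.mem_ball, dist_eq_norm] at hY
  have h1 := (abs_le.1 (abs_dotProduct_mulVec_self_le w (Y - X))).1
  rw [Matrix.sub_mulVec, dotProduct_sub] at h1
  have h2 := mul_le_mul_of_nonneg_right hY.le (dotProduct_self_nonneg_real w)
  linarith [h w]

theorem convex_quadCone : Convex ℝ (quadCone n) := by
  intro X hX Y hY a b ha hb _ w
  simp only [Matrix.add_mulVec, Matrix.smul_mulVec, dotProduct_add, dotProduct_smul, smul_eq_mul]
  exact add_nonneg (mul_nonneg ha (hX w)) (mul_nonneg hb (hY w))

theorem traceInner_C_le_of_mem_quadCone {X₀ : Matrix (Fin n) (Fin n) ℝ} (hX₀ : X₀ ∈ D.primalOpt)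
    {X : Matrix (Fin n) (Fin n) ℝ} (hX : D.map X = D.b) (hK : X ∈ quadCone n) :
    traceInner D.C X₀ ≤ traceInner D.C X := by
  have hps : ((1 / 2 : ℝ) • (X + Xᵀ)).PosSemidef := by
    refine posSemidef_iff_isSymm.2 ⟨by simp [Matrix.IsSymm, add_comm], fun w => ?_⟩
    have h1 := hK w
    have h2 : w ⬝ᵥ (Xᵀ *ᵥ w) = w ⬝ᵥ (X *ᵥ w) := by
      rw [Matrix.mulVec_transpose, dotProduct_comm, ← Matrix.dotProduct_mulVec]
    simp only [Matrix.add_mulVec, Matrix.smul_mulVec, dotProduct_add, dotProduct_smul, smul_eq_mul,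
      h2]
    linarith
  have h := hX₀.2 _ ⟨?_, hps⟩
  · rw [traceInner_smul_right, traceInner_add_right, traceInner_C_transpose] at h
    linarith
  · rw [map_smul, map_add, map_transpose, hX]
    ext i
    simp only [Pi.smul_apply, Pi.add_apply, smul_eq_mul]
    ring

theorem nonpos_of_forall_add_mul_lt {a b c : ℝ} (h : ∀ t : ℝ, 0 ≤ t → a + t * b < c) : b ≤ 0 := by
  by_contra! hb
  have := h (|c - a| / b) (by positivity)
  rw [div_mul_cancel₀ _ hb.ne'] at this
  linarith [le_abs_self (c - a)]

theorem eq_zero_of_forall_le_add_mul {a b c : ℝ} (h : ∀ t : ℝ, c ≤ a + t * b) : b = 0 := by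
  have h1 : b ≤ 0 := nonpos_of_forall_add_mul_lt (a := -a) (c := -c + 1) fun t _ => by
    linarith [h (-t)]
  have h2 : -b ≤ 0 := nonpos_of_forall_add_mul_lt (a := -a) (c := -c + 1) fun t _ => by
    linarith [h t]
  linarith

/-- Strong duality under primal strict feasibility. The open convex cone
`interior (quadCone n) × (0, ∞)` is separated from the set of all `(X, u)` with `𝒜(X) = b` and
`⟨C, X⟩ + u ≤ ⟨C, X₀⟩`; the separating functional is, after scaling, a dual solution. -/
theorem exists_dualFeasible_traceInner_eq_zero {Xs : Matrix (Fin n) (Fin n) ℝ}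
    (hXs : D.map Xs = D.b) (hXsp : Xs.PosDef) {X₀ : Matrix (Fin n) (Fin n) ℝ}
    (hX₀ : X₀ ∈ D.primalOpt) : ∃ p ∈ D.dualFeasible, traceInner p.2 X₀ = 0 := by
  obtain ⟨l, hl, hle⟩ := hXsp.exists_pos_smul_le
  set T : Set (Matrix (Fin n) (Fin n) ℝ × ℝ) :=
    {q | D.map q.1 = D.b ∧ traceInner D.C q.1 + q.2 ≤ traceInner D.C X₀} with hT
  have hTc : Convex ℝ T := by
    rintro ⟨X, u⟩ ⟨h1, h2⟩ ⟨Y, v⟩ ⟨h3, h4⟩ a b ha hb hab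
    simp only at h1 h2 h3 h4
    refine ⟨?_, ?_⟩
    · simp only [Prod.smul_mk, Prod.mk_add_mk, map_add, map_smul, h1, h3]
      rw [← add_smul, hab, one_smul]
    · simp only [Prod.smul_mk, Prod.mk_add_mk, traceInner_add_right, traceInner_smul_right,
        smul_eq_mul]
      have := mul_le_mul_of_nonneg_left h2 ha
      have := mul_le_mul_of_nonneg_left h4 hb
      have : (a + b) * traceInner D.C X₀ = traceInner D.C X₀ := by rw [hab, one_mul]
      linarith
  have hdisj : Disjoint (interior (quadCone n) ×ˢ Set.Ioi (0 : ℝ)) T := by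
    rw [Set.disjoint_left]
    rintro ⟨X, u⟩ ⟨h1, h2⟩ ⟨h3, h4⟩
    have := traceInner_C_le_of_mem_quadCone hX₀ h3 (interior_subset h1)
    simp only [Set.mem_Ioi] at h2
    simp only at h4
    linarith
  obtain ⟨f, c, hf1, hf2⟩ := geometric_hahn_banach_open
    (convex_quadCone.interior.prod (convex_Ioi 0)) (isOpen_interior.prod isOpen_Ioi) hTc hdisj
  set g : Matrix (Fin n) (Fin n) ℝ →ₗ[ℝ] ℝ :=
    f.toLinearMap ∘ₗ LinearMap.inl ℝ (Matrix (Fin n) (Fin n) ℝ) ℝ with hg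
  set h : ℝ := f (0, 1) with hh
  have hf : ∀ X u, f (X, u) = g X + u * h := by
    intro X u
    have : (X, u) = (X, (0 : ℝ)) + u • ((0 : Matrix (Fin n) (Fin n) ℝ), (1 : ℝ)) := by simp
    rw [this, _root_.map_add, _root_.map_smul]
    simp [hg, hh]
  have hcone : ∀ X ∈ quadCone n, ∀ s : ℝ, 0 ≤ s → g X + s * h ≤ 0 := by
    intro X hX s hs
    refine nonpos_of_forall_add_mul_lt (a := g Xs + h) (c := c) fun t ht => ?_
    have hmem : (Xs + t • X, 1 + t * s) ∈ interior (quadCone n) ×ˢ Set.Ioi (0 : ℝ) := by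
      refine ⟨mem_interior_quadCone hl fun w => ?_, ?_⟩
      · simp only [Matrix.add_mulVec, Matrix.smul_mulVec, dotProduct_add, dotProduct_smul,
          smul_eq_mul]
        linarith [hle w, mul_nonneg ht (hX w)]
      · have := mul_nonneg ht hs
        simp only [Set.mem_Ioi]
        linarith
    have := hf1 _ hmem
    rw [hf, _root_.map_add, _root_.map_smul, smul_eq_mul] at this
    linarith
  have hgK : ∀ X ∈ quadCone n, g X ≤ 0 := fun X hX => by simpa using hcone X hX 0 le_rfl
  have hh0 : h ≤ 0 := by
    simpa using hcone 0 (fun w => by simp) 1 zero_le_one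
  have hc : 0 ≤ c := by
    by_contra! hc
    have h1 : g Xs + h ≤ 0 := by simpa using hcone Xs (fun w => by
      have := mul_nonneg hl.le (dotProduct_self_nonneg_real w); linarith [hle w]) 1 zero_le_one
    obtain ⟨s, hs0, hs⟩ : ∃ s : ℝ, 0 < s ∧ c < s * (g Xs + h) := by
      rcases h1.eq_or_lt with h1 | h1
      · exact ⟨1, one_pos, by rw [h1]; linarith⟩
      · refine ⟨c / (2 * (g Xs + h)), div_pos_of_neg_of_neg hc (by linarith), ?_⟩
        have : c / (2 * (g Xs + h)) * (g Xs + h) = c / 2 := by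
          have := h1.ne
          field_simp
        rw [this]; linarith
    have hmem : (s • Xs, s) ∈ interior (quadCone n) ×ˢ Set.Ioi (0 : ℝ) := by
      refine ⟨mem_interior_quadCone (mul_pos hs0 hl) fun w => ?_, hs0⟩
      simp only [Matrix.smul_mulVec, dotProduct_smul, smul_eq_mul]
      have := mul_le_mul_of_nonneg_left (hle w) hs0.le
      linarith
    have := hf1 _ hmem
    rw [hf, _root_.map_smul, smul_eq_mul] at this
    linarith
  have hX₀K : X₀ ∈ quadCone n := fun w => hX₀.1.2.quad_nonneg w
  have hfeas : ∀ X, D.map X = D.b → c ≤ g X + (traceInner D.C X₀ - traceInner D.C X) * h := by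
    intro X hX
    rw [← hf]
    exact hf2 _ ⟨hX, by simp⟩
  have hgX₀ : g X₀ = 0 := by
    have := hfeas X₀ hX₀.1.1
    have := hgK X₀ hX₀K
    simp only [sub_self, zero_mul, add_zero] at *
    linarith
  have hker : ∀ X, D.map X = 0 → g X - traceInner D.C X * h = 0 := by
    intro X hX
    refine eq_zero_of_forall_le_add_mul (a := g X₀) (c := c) fun t => ?_
    have := hfeas (X₀ + t • X) (by rw [map_add, map_smul, hX, hX₀.1.1]; simp)
    rw [_root_.map_add, _root_.map_smul, traceInner_add_right, traceInner_smul_right,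
      smul_eq_mul] at this
    linarith
  have hneg : h < 0 := by
    refine lt_of_le_of_ne hh0 fun h0 => ?_
    have h1 := hker (Xs - X₀) (by rw [map_sub, hXs, hX₀.1.1, sub_self])
    rw [h0, mul_zero, sub_zero, _root_.map_sub, hgX₀, sub_zero] at h1
    have h2 := hf1 (Xs, 1) ⟨mem_interior_quadCone hl hle, by simp⟩
    rw [hf, h0, h1] at h2
    have h3 := hfeas X₀ hX₀.1.1
    rw [hgX₀, h0] at h3
    linarith
  -- the functional `g - h ⟨C, ·⟩` vanishes on the kernel of `𝒜`
  let Lm : Fin m → Matrix (Fin n) (Fin n) ℝ →ₗ[ℝ] ℝ := fun i =>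
    { toFun := fun X => traceInner (D.A i) X
      map_add' := traceInner_add_right _
      map_smul' := fun c X => traceInner_smul_right c _ X }
  let Cm : Matrix (Fin n) (Fin n) ℝ →ₗ[ℝ] ℝ :=
    { toFun := fun X => traceInner D.C X
      map_add' := traceInner_add_right _
      map_smul' := fun c X => traceInner_smul_right c _ X }
  have hspan : g - h • Cm ∈ Submodule.span ℝ (Set.range Lm) := by
    refine mem_span_of_iInf_ker_le_ker fun X hX => ?_
    have hX' : D.map X = 0 := by
      ext i
      exact LinearMap.mem_ker.1 ((Submodule.mem_iInf _).1 hX i)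
    have := hker X hX'
    simp only [LinearMap.mem_ker, LinearMap.sub_apply, LinearMap.smul_apply, smul_eq_mul]
    change g X - h * traceInner D.C X = 0
    linarith
  obtain ⟨a, ha⟩ := (Submodule.mem_span_range_iff_exists_fun ℝ).1 hspan
  have hag : ∀ X, a ⬝ᵥ D.map X = g X - h * traceInner D.C X := by
    intro X
    have := LinearMap.congr_fun ha X
    simp only [LinearMap.sum_apply, LinearMap.smul_apply, LinearMap.sub_apply, smul_eq_mul] at this
    exact this
  have hZ : ∀ X, traceInner (D.C - D.adj (-(h⁻¹ • a))) X = h⁻¹ * g X := by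
    intro X
    rw [traceInner_sub_left, traceInner_adj, neg_dotProduct, smul_dotProduct, hag, smul_eq_mul]
    have := hneg.ne
    field_simp
    ring
  refine ⟨(-(h⁻¹ • a), D.C - D.adj (-(h⁻¹ • a))), ⟨by simp, ?_⟩, ?_⟩
  · refine posSemidef_iff_isSymm.2 ⟨D.C_symm.sub (D.adj_isSymm _), fun w => ?_⟩
    rw [← traceInner_vecMulVec, traceInner_comm, hZ]
    exact mul_nonneg_of_nonpos_of_nonpos (inv_nonpos.2 hneg.le)
      (hgK _ fun w' => (posSemidef_vecMulVec w).quad_nonneg w')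
  · rw [hZ, hgX₀, mul_zero]

/-- Complementary slackness of any primal and any dual optimal solution. -/
theorem traceInner_eq_zero (hS : D.Slater) {X : Matrix (Fin n) (Fin n) ℝ} (hX : X ∈ D.primalOpt)
    {p : (Fin m → ℝ) × Matrix (Fin n) (Fin n) ℝ} (hp : p ∈ D.dualOpt) : traceInner p.2 X = 0 := by
  obtain ⟨⟨Xs, hXs, hXsp⟩, -⟩ := hS
  obtain ⟨p', hp', h0⟩ := exists_dualFeasible_traceInner_eq_zero hXs hXsp hX
  have h1 := traceInner_C_eq hp'.1 hX.1.1
  have h2 := traceInner_C_eq hp.1.1 hX.1.1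
  have h3 := hp.2 p' hp'
  have h4 := traceInner_nonneg hp.1.2 hX.1.2
  linarith

/-- Primal strict feasibility bounds the dual solutions, so their largest trace is a genuine
supremum. -/
theorem trace_le_maxDualTrace (hS : D.Slater) {p : (Fin m → ℝ) × Matrix (Fin n) (Fin n) ℝ}
    (hp : p ∈ D.dualOpt) : p.2.trace ≤ D.maxDualTrace := by
  obtain ⟨⟨Xs, hXs, hXsp⟩, -⟩ := hS
  obtain ⟨l, hl, hle⟩ := hXsp.exists_pos_smul_le
  refine le_csSup ⟨(traceInner D.C Xs - D.b ⬝ᵥ p.1) / l, ?_⟩ ⟨p, hp, rfl⟩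
  rintro _ ⟨p', hp', rfl⟩
  have h1 := traceInner_C_eq hp'.1.1 hXs
  have h2 := hp'.2 p hp.1
  have hs : (Xs + (-l) • (1 : Matrix (Fin n) (Fin n) ℝ)).PosSemidef :=
    posSemidef_add_smul_one hXsp.posSemidef.isSymm fun w => by linarith [hle w]
  have h3 := traceInner_nonneg hp'.1.2 hs
  rw [traceInner_add_right, traceInner_smul_right, traceInner_one_right] at h3
  rw [le_div_iff₀ hl]
  linarith

end SDP

/-! ### The exact penalty and boundedness of its level sets -/

namespace SDP

variable {n m : ℕ} {D : SDP n m}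

theorem cost_eq (ρ : ℝ) (X : Matrix (Fin n) (Fin n) ℝ) :
    D.cost ρ X = traceInner D.C X + ρ * psdDefect X := rfl

theorem cost_eq_of_mem_primalOpt (ρ : ℝ) {X Y : Matrix (Fin n) (Fin n) ℝ} (hX : X ∈ D.primalOpt)
    (hY : Y ∈ D.primalOpt) : D.cost ρ X = traceInner D.C Y := by
  rw [cost_eq, psdDefect_eq_zero hX.1.2, mul_zero, add_zero]
  exact le_antisymm (hX.2 Y hY.1) (hY.2 X hX.1)

theorem mem_affine_of_mem_primalOpt {X : Matrix (Fin n) (Fin n) ℝ} (hX : X ∈ D.primalOpt) :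
    X ∈ D.affine := ⟨hX.1.2.isSymm, hX.1.1⟩

theorem convex_affine : Convex ℝ D.affine := by
  rintro X ⟨hX, hX'⟩ Y ⟨hY, hY'⟩ a b _ _ hab
  refine ⟨(hX.smul a).add (hY.smul b), ?_⟩
  rw [map_add, map_smul, map_smul, hX', hY', ← add_smul, hab, one_smul]

/-- The penalized cost in terms of a pair `(y, Z)` satisfying the dual equality constraint. -/
theorem cost_eq_dual (ρ : ℝ) {y : Fin m → ℝ} {Z : Matrix (Fin n) (Fin n) ℝ}
    (hp : Z + D.adj y = D.C) {X : Matrix (Fin n) (Fin n) ℝ} (hX : D.map X = D.b) :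
    D.cost ρ X = D.b ⬝ᵥ y + traceInner Z (X + psdDefect X • (1 : Matrix (Fin n) (Fin n) ℝ))
      + (ρ - Z.trace) * psdDefect X := by
  rw [cost_eq, traceInner_C_eq (p := (y, Z)) hp hX, traceInner_add_right, traceInner_smul_right,
    traceInner_one_right]
  ring

theorem traceInner_C_eq_dual (hS : D.Slater) {X : Matrix (Fin n) (Fin n) ℝ}
    (hX : X ∈ D.primalOpt) {p : (Fin m → ℝ) × Matrix (Fin n) (Fin n) ℝ} (hp : p ∈ D.dualOpt) :
    traceInner D.C X = D.b ⬝ᵥ p.1 := by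
  rw [traceInner_C_eq hp.1.1 hX.1.1, traceInner_eq_zero hS hX hp, zero_add]

theorem norm_le_trace_add {X : Matrix (Fin n) (Fin n) ℝ} (hX : X.IsSymm) :
    ‖X‖ ≤ (X + psdDefect X • (1 : Matrix (Fin n) (Fin n) ℝ)).trace
      + psdDefect X * ‖(1 : Matrix (Fin n) (Fin n) ℝ)‖ := by
  have h1 := (posSemidef_add_psdDefect hX).norm_le_trace
  have h2 := norm_sub_le (X + psdDefect X • (1 : Matrix (Fin n) (Fin n) ℝ))
    (psdDefect X • (1 : Matrix (Fin n) (Fin n) ℝ))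
  rw [add_sub_cancel_right, norm_smul, Real.norm_of_nonneg (psdDefect_nonneg X)] at h2
  linarith

/-- The penalized cost is coercive on the affine space. A small step from a dual solution towards
a strictly feasible dual point gives `Z ≻ 0` with `tr Z < ρ`. -/
theorem exists_coercive (hS : D.Slater) {p : (Fin m → ℝ) × Matrix (Fin n) (Fin n) ℝ}
    (hp : p ∈ D.dualOpt) {ρ : ℝ} (hρ : p.2.trace < ρ) :
    ∃ a B : ℝ, 0 < a ∧ ∀ X ∈ D.affine, a * ‖X‖ ≤ D.cost ρ X + B := by
  obtain ⟨-, yb, Zb, hb, hZb⟩ := hS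
  obtain ⟨l, hl, hle⟩ := hZb.exists_pos_smul_le
  obtain ⟨y, Z⟩ := p
  obtain ⟨⟨hyZ, hZ⟩, -⟩ := hp
  simp only at hyZ hZ hρ
  set θ : ℝ := min (1 / 2) ((ρ - Z.trace) / (2 * (|Zb.trace - Z.trace| + 1))) with hθ
  have hd : 0 < ρ - Z.trace := by linarith
  have hθ0 : 0 < θ := lt_min (by norm_num) (by positivity)
  have hθ1 : θ ≤ 1 / 2 := min_le_left _ _
  have hθ2 : θ * (Zb.trace - Z.trace) ≤ (ρ - Z.trace) / 2 := by
    have h1 : θ * (|Zb.trace - Z.trace| + 1) ≤ (ρ - Z.trace) / 2 := by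
      have := min_le_right (1 / 2) ((ρ - Z.trace) / (2 * (|Zb.trace - Z.trace| + 1)))
      rw [← hθ, le_div_iff₀ (by positivity)] at this
      linarith
    have h2 := mul_le_mul_of_nonneg_left (le_abs_self (Zb.trace - Z.trace)) hθ0.le
    linarith
  set Zt := (1 - θ) • Z + θ • Zb with hZt
  set yt := (1 - θ) • y + θ • yb with hyt
  have hdual : Zt + D.adj yt = D.C := by
    have : D.adj yt = (1 - θ) • D.adj y + θ • D.adj yb := by
      simp only [adj, hyt, Pi.add_apply, Pi.smul_apply, add_smul, Finset.sum_add_distrib,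
        Finset.smul_sum, smul_smul, smul_eq_mul]
    rw [this, hZt]
    calc _ = (1 - θ) • (Z + D.adj y) + θ • (Zb + D.adj yb) := by module
      _ = D.C := by rw [hyZ, hb]; module
  have hps : (Zt + (-(θ * l)) • (1 : Matrix (Fin n) (Fin n) ℝ)).PosSemidef := by
    refine posSemidef_add_smul_one ((hZ.isSymm.smul _).add (hZb.posSemidef.isSymm.smul _))
      fun w => ?_
    simp only [Matrix.add_mulVec, Matrix.smul_mulVec, dotProduct_add, dotProduct_smul,
      smul_eq_mul]
    have h1 := mul_nonneg (by linarith : 0 ≤ 1 - θ) (hZ.quad_nonneg w)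
    have h2 := mul_le_mul_of_nonneg_left (hle w) hθ0.le
    linarith
  set N := ‖(1 : Matrix (Fin n) (Fin n) ℝ)‖ with hN
  have hN0 : 0 ≤ N := norm_nonneg _
  set a := min (θ * l) ((ρ - Z.trace) / (2 * (N + 1))) with ha
  have ha0 : 0 < a := lt_min (by positivity) (by positivity)
  refine ⟨a, -(D.b ⬝ᵥ yt), ha0, fun X hX => ?_⟩
  have hY := posSemidef_add_psdDefect hX.1
  have hτ := psdDefect_nonneg X
  have h1 := traceInner_nonneg hps hY
  rw [traceInner_add_left, traceInner_smul_left, traceInner_comm 1, traceInner_one_right] at h1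
  have h2 : a * (X + psdDefect X • (1 : Matrix (Fin n) (Fin n) ℝ)).trace ≤
      θ * l * (X + psdDefect X • (1 : Matrix (Fin n) (Fin n) ℝ)).trace :=
    mul_le_mul_of_nonneg_right (min_le_left _ _) hY.trace_nonneg
  have h3 : a * N ≤ (ρ - Z.trace) / 2 := by
    have h4 : a * (N + 1) ≤ (ρ - Z.trace) / 2 := by
      have := min_le_right (θ * l) ((ρ - Z.trace) / (2 * (N + 1)))
      rw [← ha, le_div_iff₀ (by positivity)] at this
      linarith
    linarith
  have h4 : (ρ - Z.trace) / 2 ≤ ρ - Zt.trace := by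
    simp only [hZt, Matrix.trace_add, Matrix.trace_smul, smul_eq_mul]
    linarith
  have h5 := mul_le_mul_of_nonneg_right (h3.trans h4) hτ
  have h6 := mul_le_mul_of_nonneg_left (norm_le_trace_add hX.1) ha0.le
  rw [cost_eq_dual ρ hdual hX.2]
  linarith

/-! ### Strict complementarity and quadratic growth -/

/-- Under strict complementarity `X + Z ≻ 0`: as `X Z = 0`, the rank condition forces
`ker X = range Z`, which meets `ker Z` only in `0`. -/
theorem posDef_add_of_rank_add_rank {X Z : Matrix (Fin n) (Fin n) ℝ} (hX : X.PosSemidef)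
    (hZ : Z.PosSemidef) (hXZ : X * Z = 0) (hr : X.rank + Z.rank = n) : (X + Z).PosDef := by
  have hle : LinearMap.range Z.mulVecLin ≤ LinearMap.ker X.mulVecLin := by
    rintro _ ⟨u, rfl⟩
    simp [Matrix.mulVec_mulVec, hXZ]
  have heq : LinearMap.range Z.mulVecLin = LinearMap.ker X.mulVecLin := by
    refine Submodule.eq_of_le_of_finrank_eq hle ?_
    have := LinearMap.finrank_range_add_finrank_ker X.mulVecLin
    simp only [Module.finrank_fintype_fun_eq_card, Fintype.card_fin] at this
    simp only [Matrix.rank] at hr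
    omega
  refine PosDef.of_dotProduct_mulVec_pos (hX.add hZ).1 fun w hw => ?_
  rw [star_trivial]
  refine lt_of_le_of_ne ((hX.add hZ).quad_nonneg w) fun h0 => hw ?_
  rw [Matrix.add_mulVec, dotProduct_add] at h0
  have h1 := hX.quad_nonneg w
  have h2 := hZ.quad_nonneg w
  have hXw : X *ᵥ w = 0 := (hX.dotProduct_mulVec_zero_iff w).1 (by rw [star_trivial]; linarith)
  have hZw : Z *ᵥ w = 0 := (hZ.dotProduct_mulVec_zero_iff w).1 (by rw [star_trivial]; linarith)
  have hw' : w ∈ LinearMap.range Z.mulVecLin := by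
    rw [heq]
    simpa using hXw
  obtain ⟨u, hu⟩ := hw'
  rw [Matrix.mulVecLin_apply] at hu
  refine dotProduct_self_eq_zero.1 ?_
  nth_rewrite 1 [← hu]
  rw [dotProduct_comm, IsSymm.dotProduct_mulVec_comm hZ.isSymm, hZw, dotProduct_zero]

/-- Let `X₀ + Z ⪰ l I`. A symmetric matrix `X'` with `Z X' = 0` and `X' ⪰ -t I` becomes positive
semidefinite after adding `s X₀` with `s l ≥ t`, since only its restriction to `ker Z` matters,
where `X₀` agrees with `X₀ + Z`. -/
theorem quad_add_smul_nonneg {X₀ Z X' : Matrix (Fin n) (Fin n) ℝ} (hX₀ : X₀.PosSemidef)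
    (hZ : Z.PosSemidef) (hZX₀ : Z * X₀ = 0) (hM : (X₀ + Z).PosDef) {l t s : ℝ}
    (hle : ∀ w, l * (w ⬝ᵥ w) ≤ w ⬝ᵥ ((X₀ + Z) *ᵥ w)) (hX' : X'.IsSymm) (hZX' : Z * X' = 0)
    (hs0 : 0 ≤ s) (hs : t ≤ s * l) (ht : ∀ w, -(t * (w ⬝ᵥ w)) ≤ w ⬝ᵥ (X' *ᵥ w)) (w : Fin n → ℝ) :
    0 ≤ w ⬝ᵥ ((X' + s • X₀) *ᵥ w) := by
  have hX₀Z : X₀ * Z = 0 := by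
    rw [← Matrix.transpose_transpose (X₀ * Z), Matrix.transpose_mul, hX₀.isSymm.eq, hZ.isSymm.eq,
      hZX₀, Matrix.transpose_zero]
  have hX'Z : X' * Z = 0 := by
    rw [← Matrix.transpose_transpose (X' * Z), Matrix.transpose_mul, hX'.eq, hZ.isSymm.eq,
      hZX', Matrix.transpose_zero]
  have hu : IsUnit (X₀ + Z).det := (Matrix.isUnit_iff_isUnit_det _).1 hM.isUnit
  have hcomm : (X₀ + Z)⁻¹ * Z = Z * (X₀ + Z)⁻¹ := by
    have h : (X₀ + Z) * Z = Z * (X₀ + Z) := by simp [Matrix.add_mul, Matrix.mul_add, hX₀Z, hZX₀]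
    calc (X₀ + Z)⁻¹ * Z = (X₀ + Z)⁻¹ * (Z * (X₀ + Z)) * (X₀ + Z)⁻¹ := by
          rw [Matrix.mul_assoc, Matrix.mul_assoc Z, Matrix.mul_nonsing_inv _ hu, Matrix.mul_one]
      _ = Z * (X₀ + Z)⁻¹ := by
          rw [← h, ← Matrix.mul_assoc, Matrix.nonsing_inv_mul _ hu, Matrix.one_mul]
  set a := (X₀ + Z)⁻¹ *ᵥ (X₀ *ᵥ w) with ha
  set b := Z *ᵥ ((X₀ + Z)⁻¹ *ᵥ w) with hb
  have hw : w = a + b := by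
    rw [ha, hb, Matrix.mulVec_mulVec, Matrix.mulVec_mulVec, ← hcomm, ← Matrix.add_mulVec,
      ← Matrix.mul_add, Matrix.nonsing_inv_mul _ hu, Matrix.one_mulVec]
  have hZa : Z *ᵥ a = 0 := by
    rw [ha, Matrix.mulVec_mulVec, Matrix.mulVec_mulVec, ← hcomm,
      Matrix.mul_assoc, hZX₀, Matrix.mul_zero, Matrix.zero_mulVec]
  have hred : ∀ Y : Matrix (Fin n) (Fin n) ℝ, Y.IsSymm → Y * Z = 0 →
      w ⬝ᵥ (Y *ᵥ w) = a ⬝ᵥ (Y *ᵥ a) := by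
    intro Y hY hYZ
    have hYb : Y *ᵥ b = 0 := by rw [hb, Matrix.mulVec_mulVec, hYZ, Matrix.zero_mulVec]
    rw [hw, Matrix.mulVec_add, hYb, add_zero, add_dotProduct,
      IsSymm.dotProduct_mulVec_comm hY b a, hYb, dotProduct_zero, add_zero]
  have h1 := hle a
  rw [Matrix.add_mulVec, hZa, add_zero] at h1
  rw [Matrix.add_mulVec, Matrix.smul_mulVec, dotProduct_add, dotProduct_smul, smul_eq_mul,
    hred X' hX' hX'Z, hred X₀ hX₀.isSymm hX₀Z]
  have h2 := mul_le_mul_of_nonneg_left h1 hs0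
  have h3 := mul_le_mul_of_nonneg_right hs (dotProduct_self_nonneg_real a)
  linarith [ht a]

/-- Linear error bound for the equations `𝒜(X) = b`, `Z X = 0` within the affine space. -/
theorem exists_affine_mul_eq_zero {Z X₀ : Matrix (Fin n) (Fin n) ℝ} (hX₀ : X₀ ∈ D.affine)
    (hZX₀ : Z * X₀ = 0) : ∃ κ : ℝ, 0 < κ ∧ ∀ X ∈ D.affine, ∃ X' ∈ D.affine,
      Z * X' = 0 ∧ ‖X - X'‖ ≤ κ * ‖Z * X‖ := by
  let T : Matrix (Fin n) (Fin n) ℝ →ₗ[ℝ]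
      (Fin m → ℝ) × Matrix (Fin n) (Fin n) ℝ × Matrix (Fin n) (Fin n) ℝ :=
    { toFun := fun X => (D.map X, Z * X, X - Xᵀ)
      map_add' := fun X Y => by
        simp only [map_add, Matrix.mul_add, Matrix.transpose_add, Prod.mk_add_mk]
        rw [add_sub_add_comm]
      map_smul' := fun c X => by
        simp only [map_smul, Matrix.mul_smul, Matrix.transpose_smul, RingHom.id_apply,
          Prod.smul_mk, smul_sub] }
  obtain ⟨κ, hκ, h⟩ := ContinuousLinearMap.exists_preimage_norm_le
    (LinearMap.toContinuousLinearMap T.rangeRestrict)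
    (fun y => by simpa using LinearMap.surjective_rangeRestrict T y)
  refine ⟨κ, hκ, fun X hX => ?_⟩
  obtain ⟨x, hx, hxn⟩ := h (T.rangeRestrict (X - X₀))
  have hx' : T x = T (X - X₀) := congrArg Subtype.val hx
  have hT : T (X - X₀) = (0, Z * X, 0) := by
    simp only [T, LinearMap.coe_mk, AddHom.coe_mk, map_sub, hX.2, hX₀.2, sub_self, Matrix.mul_sub,
      hZX₀, sub_zero, Matrix.transpose_sub, hX.1.eq, hX₀.1.eq]
  rw [hT] at hx'
  simp only [T, LinearMap.coe_mk, AddHom.coe_mk, Prod.mk.injEq] at hx'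
  obtain ⟨h1, h2, h3⟩ := hx'
  refine ⟨X - x, ⟨hX.1.sub ?_, ?_⟩, ?_, ?_⟩
  · exact (sub_eq_zero.1 h3).symm
  · rw [map_sub, h1, hX.2, sub_zero]
  · rw [Matrix.mul_sub, h2, sub_self]
  · rw [sub_sub_cancel]
    refine hxn.trans (le_of_eq ?_)
    congr 1
    change ‖T (X - X₀)‖ = _
    rw [hT]
    simp [Prod.norm_def]

theorem mem_primalOpt_of_traceInner_eq_zero (hS : D.Slater) {X₀ X : Matrix (Fin n) (Fin n) ℝ}
    (hX₀ : X₀ ∈ D.primalOpt) {p : (Fin m → ℝ) × Matrix (Fin n) (Fin n) ℝ} (hp : p ∈ D.dualOpt)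
    (hX : X ∈ D.primalFeasible) (h : traceInner p.2 X = 0) : X ∈ D.primalOpt := by
  refine ⟨hX, fun Y hY => ?_⟩
  rw [traceInner_C_eq hp.1.1 hX.1, h, zero_add, ← traceInner_C_eq_dual hS hX₀ hp]
  exact hX₀.2 Y hY

/-- On the level set `F(X) ≤ F* + 1` of the affine space, `X` is bounded, and both the violation of
`X ⪰ 0` and that of `Z X = 0` are of the order of the square root of the cost gap. -/
theorem exists_residual_bound (hS : D.Slater) {X₀ : Matrix (Fin n) (Fin n) ℝ}
    (hX₀ : X₀ ∈ D.primalOpt) {p : (Fin m → ℝ) × Matrix (Fin n) (Fin n) ℝ} (hp : p ∈ D.dualOpt)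
    {ρ : ℝ} (hρ : p.2.trace < ρ) :
    ∃ R d k : ℝ, 0 ≤ R ∧ 0 < d ∧ 0 ≤ k ∧
      ∀ X ∈ D.affine, D.cost ρ X - traceInner D.C X₀ ≤ 1 →
        ‖X‖ ≤ R ∧ 0 ≤ D.cost ρ X - traceInner D.C X₀ ∧
        psdDefect X ≤ d * √(D.cost ρ X - traceInner D.C X₀) ∧
        ‖p.2 * X‖ ≤ k * √(D.cost ρ X - traceInner D.C X₀) := by
  obtain ⟨a, B, ha, hcoer⟩ := exists_coercive hS hp hρ
  have hval := traceInner_C_eq_dual hS hX₀ hp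
  obtain ⟨y, Z⟩ := p
  have hZ : Z.PosSemidef := hp.1.2
  have hyZ : Z + D.adj y = D.C := hp.1.1
  simp only at hρ hval ⊢
  set N := ‖(1 : Matrix (Fin n) (Fin n) ℝ)‖ with hN
  have hN0 : 0 ≤ N := norm_nonneg _
  have hd : 0 < ρ - Z.trace := by linarith
  have htrZ : 0 ≤ Z.trace := hZ.trace_nonneg
  obtain ⟨d, hddef⟩ : ∃ d, d = (ρ - Z.trace)⁻¹ := ⟨_, rfl⟩
  have hd0 : 0 < d := hddef ▸ inv_pos.2 hd
  obtain ⟨R, hR⟩ : ∃ R, R = |(traceInner D.C X₀ + 1 + B) / a| := ⟨_, rfl⟩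
  have hR0 : 0 ≤ R := hR ▸ abs_nonneg _
  obtain ⟨R', hR'⟩ : ∃ R', R' = N * (R + d * N) := ⟨_, rfl⟩
  have hR'0 : 0 ≤ R' := by rw [hR']; positivity
  refine ⟨R, d, √(Z.trace * R') + d * ‖Z‖, hR0, hd0, by positivity, fun X hX hg => ?_⟩
  have hXR : ‖X‖ ≤ R := by
    rw [hR]
    refine le_trans ?_ (le_abs_self _)
    rw [le_div_iff₀ ha]
    linarith [hcoer X hX]
  have hgeq : D.cost ρ X - traceInner D.C X₀ =
      traceInner Z (X + psdDefect X • (1 : Matrix (Fin n) (Fin n) ℝ))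
        + (ρ - Z.trace) * psdDefect X := by
    rw [hval, cost_eq_dual ρ hyZ hX.2]
    ring
  generalize D.cost ρ X - traceInner D.C X₀ = g at hg hgeq ⊢
  have hτ0 : 0 ≤ psdDefect X := psdDefect_nonneg X
  have hYps := posSemidef_add_psdDefect hX.1
  generalize psdDefect X = τ at hgeq hτ0 hYps ⊢
  obtain ⟨Y, hY⟩ : ∃ Y, Y = X + τ • (1 : Matrix (Fin n) (Fin n) ℝ) := ⟨_, rfl⟩
  rw [← hY] at hgeq hYps
  have hZY := traceInner_nonneg hZ hYps
  have hmul0 : 0 ≤ (ρ - Z.trace) * τ := mul_nonneg hd.le hτ0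
  have hg0 : 0 ≤ g := by linarith
  have hZYg : traceInner Z Y ≤ g := by linarith
  have hr0 : 0 ≤ √g := Real.sqrt_nonneg g
  have hrr : √g ^ 2 = g := Real.sq_sqrt hg0
  have hr1 : √g ≤ 1 := Real.sqrt_le_one.2 hg
  have hgr : g ≤ √g := by
    have := mul_le_of_le_one_left hr0 hr1
    rwa [← sq, hrr] at this
  have hτg : τ ≤ d * √g := by
    rw [hddef, ← div_eq_inv_mul, le_div_iff₀ hd]
    linarith
  have hτd : τ ≤ d := hτg.trans (mul_le_of_le_one_right hd0.le hr1)
  have hYR : Y.trace ≤ R' := by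
    have h1 : Y.trace ≤ ‖Y‖ * N := by
      rw [← traceInner_one_right]
      exact traceInner_le _ _
    have h2 : ‖Y‖ ≤ R + d * N := by
      rw [hY]
      refine (norm_add_le _ _).trans (add_le_add hXR ?_)
      rw [norm_smul, Real.norm_of_nonneg hτ0]
      exact mul_le_mul_of_nonneg_right hτd hN0
    calc Y.trace ≤ ‖Y‖ * N := h1
      _ ≤ (R + d * N) * N := mul_le_mul_of_nonneg_right h2 hN0
      _ = R' := by rw [hR', mul_comm]
  refine ⟨hXR, hg0, hτg, ?_⟩
  have h1 : ‖Z * Y‖ ≤ √(Z.trace * R') * √g := by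
    rw [← Real.sqrt_mul (by positivity)]
    refine Real.le_sqrt_of_sq_le ((norm_mul_sq_le hZ hYps).trans ?_)
    exact mul_le_mul (mul_le_mul_of_nonneg_left hYR htrZ) hZYg hZY (by positivity)
  have h2 : Z * X = Z * Y - τ • Z := by
    rw [hY, Matrix.mul_add, Matrix.mul_smul, Matrix.mul_one, add_sub_cancel_right]
  rw [h2]
  refine (norm_sub_le _ _).trans ?_
  rw [norm_smul, Real.norm_of_nonneg hτ0, add_mul]
  have := mul_le_mul_of_nonneg_right hτg (norm_nonneg Z)
  linarith

/-- A matrix `X'` of the affine space with `Z X' = 0` and `X' ⪰ -t I` is within a multiple of `t` of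
a primal solution, obtained by moving towards a strictly complementary solution `X₀`. -/
theorem exists_mem_primalOpt_near (hS : D.Slater) {X₀ : Matrix (Fin n) (Fin n) ℝ}
    (hX₀ : X₀ ∈ D.primalOpt) {p : (Fin m → ℝ) × Matrix (Fin n) (Fin n) ℝ} (hp : p ∈ D.dualOpt)
    (hr : X₀.rank + p.2.rank = n) : ∃ l : ℝ, 0 < l ∧ ∀ X' ∈ D.affine, p.2 * X' = 0 →
      ∀ t : ℝ, 0 ≤ t → (∀ w, -(t * (w ⬝ᵥ w)) ≤ w ⬝ᵥ (X' *ᵥ w)) →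
        ∃ X ∈ D.primalOpt, ‖X' - X‖ ≤ t / l * ‖X' - X₀‖ := by
  have hZX₀ : p.2 * X₀ = 0 :=
    mul_eq_zero_of_traceInner_eq_zero hp.1.2 hX₀.1.2 (traceInner_eq_zero hS hX₀ hp)
  have hX₀Z : X₀ * p.2 = 0 := mul_eq_zero_of_traceInner_eq_zero hX₀.1.2 hp.1.2
    (by rw [traceInner_comm]; exact traceInner_eq_zero hS hX₀ hp)
  have hM := posDef_add_of_rank_add_rank hX₀.1.2 hp.1.2 hX₀Z hr
  obtain ⟨l, hl, hle⟩ := hM.exists_pos_smul_le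
  refine ⟨l, hl, fun X' hX'a hZX' t ht htX' => ?_⟩
  obtain ⟨s, hs⟩ : ∃ s, s = t / l := ⟨_, rfl⟩
  rw [← hs]
  have hs0 : 0 ≤ s := by rw [hs]; positivity
  have hquad := quad_add_smul_nonneg hX₀.1.2 hp.1.2 hZX₀ hM hle hX'a.1 hZX' hs0
    (by rw [hs, div_mul_cancel₀ _ hl.ne']) htX'
  have hs1 : 0 < 1 + s := by linarith
  obtain ⟨X, hX⟩ : ∃ X, X = (1 + s)⁻¹ • (X' + s • X₀) := ⟨_, rfl⟩
  have hXf : X ∈ D.primalFeasible := by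
    refine ⟨?_, posSemidef_iff_isSymm.2 ⟨?_, fun w => ?_⟩⟩
    · have : D.b + s • D.b = (1 + s) • D.b := by module
      rw [hX, map_smul, map_add, map_smul, hX'a.2, hX₀.1.1, this, smul_smul,
        inv_mul_cancel₀ hs1.ne', one_smul]
    · rw [hX]
      exact (hX'a.1.add (hX₀.1.2.isSymm.smul s)).smul _
    · rw [hX, Matrix.smul_mulVec, dotProduct_smul]
      exact mul_nonneg (inv_nonneg.2 hs1.le) (hquad w)
  have hZX : traceInner p.2 X = 0 := by
    have : p.2 * X = 0 := by
      rw [hX, Matrix.mul_smul, Matrix.mul_add, Matrix.mul_smul, hZX', hZX₀]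
      simp
    rw [traceInner, hp.1.2.isSymm.eq, this, Matrix.trace_zero]
  refine ⟨X, mem_primalOpt_of_traceInner_eq_zero hS hX₀ hp hXf hZX, ?_⟩
  have h1 : X' - X = (s * (1 + s)⁻¹) • (X' - X₀) := by
    have h2 : X' = (1 + s)⁻¹ • ((1 + s) • X') := by
      rw [smul_smul, inv_mul_cancel₀ hs1.ne', one_smul]
    rw [hX]
    nth_rewrite 1 [h2]
    module
  rw [h1, norm_smul, Real.norm_of_nonneg (by positivity)]
  refine mul_le_mul_of_nonneg_right ?_ (norm_nonneg _)
  exact mul_le_of_le_one_right hs0 (inv_le_one_of_one_le₀ (by linarith))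

/-- **Quadratic growth** of the penalized cost on the affine space, near the optimal value. -/
theorem exists_quadratic_growth (hS : D.Slater) {X₀ : Matrix (Fin n) (Fin n) ℝ}
    (hX₀ : X₀ ∈ D.primalOpt) {p : (Fin m → ℝ) × Matrix (Fin n) (Fin n) ℝ} (hp : p ∈ D.dualOpt)
    (hr : X₀.rank + p.2.rank = n) {ρ : ℝ} (hρ : p.2.trace < ρ) :
    ∃ μ : ℝ, 0 < μ ∧ ∀ X ∈ D.affine, D.cost ρ X - traceInner D.C X₀ ≤ 1 →
      ∃ X' ∈ D.primalOpt, μ * ‖X - X'‖ ^ 2 ≤ D.cost ρ X - traceInner D.C X₀ := by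
  have hZX₀ : p.2 * X₀ = 0 :=
    mul_eq_zero_of_traceInner_eq_zero hp.1.2 hX₀.1.2 (traceInner_eq_zero hS hX₀ hp)
  obtain ⟨R, d, k₁, hR0, hd0, hk₁0, hres⟩ := exists_residual_bound hS hX₀ hp hρ
  obtain ⟨κ, hκ, hlin⟩ := exists_affine_mul_eq_zero (mem_affine_of_mem_primalOpt hX₀) hZX₀
  obtain ⟨l, hl, hnear⟩ := exists_mem_primalOpt_near hS hX₀ hp hr
  obtain ⟨k₂, hk₂⟩ : ∃ k₂, k₂ = d + κ * k₁ := ⟨_, rfl⟩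
  have hk₂0 : 0 < k₂ := by rw [hk₂]; positivity
  obtain ⟨k₃, hk₃⟩ : ∃ k₃, k₃ = κ * k₁ + k₂ / l * (‖X₀‖ + R + κ * k₁) := ⟨_, rfl⟩
  have hk₃0 : 0 ≤ k₃ := by rw [hk₃]; positivity
  refine ⟨(k₃ ^ 2 + 1)⁻¹, by positivity, fun X hX hg => ?_⟩
  obtain ⟨hXR, hg0, hτg, hZX⟩ := hres X hX hg
  generalize D.cost ρ X - traceInner D.C X₀ = g at *
  have hr0 : 0 ≤ √g := Real.sqrt_nonneg g
  have hrr : √g ^ 2 = g := Real.sq_sqrt hg0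
  have hr1 : √g ≤ 1 := Real.sqrt_le_one.2 hg
  obtain ⟨X', hX'a, hZX', hXX'⟩ := hlin X hX
  have hXX'2 : ‖X - X'‖ ≤ κ * k₁ * √g := by
    rw [mul_assoc]
    exact hXX'.trans (mul_le_mul_of_nonneg_left hZX hκ.le)
  have hk₂r : 0 ≤ k₂ * √g := by positivity
  obtain ⟨X'', hX'', hX'X''⟩ := hnear X' hX'a hZX' (k₂ * √g) hk₂r fun w => by
    have h1 := quad_ge_neg_psdDefect hX'a.1 w
    have h2 := psdDefect_le_add_norm hX.1 hX'a.1
    rw [norm_sub_rev] at h2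
    have h3 : psdDefect X' ≤ k₂ * √g := by rw [hk₂, add_mul]; linarith
    have := mul_le_mul_of_nonneg_right h3 (dotProduct_self_nonneg_real w)
    linarith
  refine ⟨X'', hX'', ?_⟩
  have h3 : ‖X' - X₀‖ ≤ ‖X₀‖ + R + κ * k₁ := by
    have h4 : X' - X₀ = X - (X - X') - X₀ := by abel
    rw [h4]
    refine (norm_sub_le _ _).trans ?_
    have h5 := norm_sub_le X (X - X')
    have h6 : κ * k₁ * √g ≤ κ * k₁ := mul_le_of_le_one_right (by positivity) hr1
    linarith
  have hfin : ‖X - X''‖ ≤ k₃ * √g := by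
    have h1 : X - X'' = (X - X') + (X' - X'') := by abel
    have h2 : k₃ * √g = κ * k₁ * √g + k₂ * √g / l * (‖X₀‖ + R + κ * k₁) := by
      rw [hk₃]
      ring
    rw [h1, h2]
    refine (norm_add_le _ _).trans (add_le_add hXX'2 (hX'X''.trans ?_))
    exact mul_le_mul_of_nonneg_left h3 (by positivity)
  have h1 : ‖X - X''‖ ^ 2 ≤ k₃ ^ 2 * g := by
    rw [← hrr, ← mul_pow]
    exact pow_le_pow_left₀ (norm_nonneg _) hfin 2
  rw [inv_mul_le_iff₀ (by positivity)]
  linarith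

/-! ### Compactness of the primal solution set and separation of eigenvalues -/

theorem continuous_traceInner_left (Z : Matrix (Fin n) (Fin n) ℝ) :
    Continuous fun X => traceInner Z X := by
  unfold traceInner
  fun_prop

theorem isCompact_primalOpt (hS : D.Slater) {X₀ : Matrix (Fin n) (Fin n) ℝ}
    (hX₀ : X₀ ∈ D.primalOpt) {p : (Fin m → ℝ) × Matrix (Fin n) (Fin n) ℝ} (hp : p ∈ D.dualOpt)
    {ρ : ℝ} (hρ : p.2.trace < ρ) : IsCompact D.primalOpt := by
  have : ProperSpace (Matrix (Fin n) (Fin n) ℝ) := FiniteDimensional.proper_real _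
  obtain ⟨a, B, ha, hcoer⟩ := exists_coercive hS hp hρ
  refine Metric.isCompact_of_isClosed_isBounded ?_ ?_
  · have heq : D.primalOpt = (⋂ i, {X | traceInner (D.A i) X = D.b i}) ∩ ({X | Xᵀ = X} ∩
        ⋂ w, {X | 0 ≤ traceInner (vecMulVec w w) X}) ∩
        {X | traceInner D.C X ≤ traceInner D.C X₀} := by
      ext X
      simp only [Set.mem_inter_iff, Set.mem_iInter, Set.mem_ofPred_eq, traceInner_vecMulVec]
      constructor
      · intro h
        exact ⟨⟨fun i => congrFun h.1.1 i, posSemidef_iff_isSymm.1 h.1.2⟩, h.2 X₀ hX₀.1⟩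
      · rintro ⟨⟨h1, h2⟩, h3⟩
        exact ⟨⟨funext h1, posSemidef_iff_isSymm.2 h2⟩, fun Y hY => h3.trans (hX₀.2 Y hY)⟩
    rw [heq]
    refine ((isClosed_iInter fun i => ?_).inter (IsClosed.inter ?_ (isClosed_iInter fun w => ?_))).inter ?_
    · exact isClosed_eq (continuous_traceInner_left _) continuous_const
    · exact isClosed_eq (by fun_prop) continuous_id
    · exact isClosed_le continuous_const (continuous_traceInner_left _)
    · exact isClosed_le (continuous_traceInner_left _) continuous_const
  · refine isBounded_iff_forall_norm_le.2 ⟨(traceInner D.C X₀ + B) / a, fun X hX => ?_⟩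
    rw [le_div_iff₀ ha]
    have := hcoer X (mem_affine_of_mem_primalOpt hX)
    rw [cost_eq_of_mem_primalOpt ρ hX hX₀] at this
    linarith

theorem isCompact_orthonormal (n k : ℕ) :
    IsCompact {V : Matrix (Fin n) (Fin k) ℝ | Vᵀ * V = 1} := by
  have : ProperSpace (Matrix (Fin n) (Fin k) ℝ) := FiniteDimensional.proper_real _
  refine Metric.isCompact_of_isClosed_isBounded (isClosed_eq (by fun_prop) continuous_const) ?_
  refine isBounded_iff_forall_norm_le.2 ⟨Real.sqrt k, fun V hV => Real.le_sqrt_of_sq_le ?_⟩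
  have hV1 : Vᵀ * V = 1 := hV
  rw [norm_sq_eq_trace, hV1]
  simp

theorem finrank_ker_le_maxNullity {X : Matrix (Fin n) (Fin n) ℝ} (hX : X ∈ D.primalOpt) :
    Module.finrank ℝ (LinearMap.ker X.mulVecLin) ≤ D.maxNullity := by
  refine le_csSup ⟨n, ?_⟩ ⟨X, hX, rfl⟩
  rintro _ ⟨Y, -, rfl⟩
  simpa using Submodule.finrank_le (LinearMap.ker Y.mulVecLin)

/-- `tr (Vᵀ X V) = 0` would put the range of `V` into the null space of `X`, which is too small. -/
theorem trace_transpose_mul_mul_pos {X : Matrix (Fin n) (Fin n) ℝ} (hX : X ∈ D.primalOpt) {k : ℕ}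
    (hk : D.maxNullity < k) {V : Matrix (Fin n) (Fin k) ℝ} (hV : Vᵀ * V = 1) :
    0 < (Vᵀ * X * V).trace := by
  have hVV : (V * Vᵀ).PosSemidef := by
    simpa using posSemidef_mul_mul_transpose V (PosSemidef.one (n := Fin k) (R := ℝ))
  have htr : traceInner X (V * Vᵀ) = (Vᵀ * X * V).trace := by
    rw [traceInner, hX.1.2.isSymm.eq, ← Matrix.mul_assoc, Matrix.trace_mul_comm, Matrix.mul_assoc]
  rw [← htr]
  refine lt_of_le_of_ne (traceInner_nonneg hX.1.2 hVV) fun h0 => ?_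
  have h1 := mul_eq_zero_of_traceInner_eq_zero hX.1.2 hVV h0.symm
  have hXV : X * V = 0 := by
    calc X * V = X * (V * Vᵀ) * V := by
          rw [Matrix.mul_assoc, Matrix.mul_assoc, hV, Matrix.mul_one]
      _ = 0 := by rw [h1, Matrix.zero_mul]
  have hinj : Function.Injective V.mulVecLin := by
    intro u v huv
    have := congrArg (fun z => Vᵀ *ᵥ z) huv
    simpa [Matrix.mulVec_mulVec, hV] using this
  have hle : LinearMap.range V.mulVecLin ≤ LinearMap.ker X.mulVecLin := by
    rintro _ ⟨u, rfl⟩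
    simp [Matrix.mulVec_mulVec, hXV]
  have h2 := Submodule.finrank_mono hle
  rw [LinearMap.finrank_range_of_inj hinj] at h2
  simp only [Module.finrank_fintype_fun_eq_card, Fintype.card_fin] at h2
  have := finrank_ker_le_maxNullity hX
  omega

/-- Uniformly over the primal solutions, the sum of the `k` smallest eigenvalues is bounded away
from `0` when `k` exceeds every nullity. -/
theorem exists_trace_lower_bound (hK : IsCompact D.primalOpt) {k : ℕ} (hk : D.maxNullity < k) :
    ∃ c : ℝ, 0 < c ∧ ∀ X ∈ D.primalOpt, ∀ V : Matrix (Fin n) (Fin k) ℝ, Vᵀ * V = 1 →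
      c ≤ (Vᵀ * X * V).trace := by
  have hcomp := hK.prod (isCompact_orthonormal n k)
  have hcont : Continuous fun q : Matrix (Fin n) (Fin n) ℝ × Matrix (Fin n) (Fin k) ℝ =>
      (q.2ᵀ * q.1 * q.2).trace := by fun_prop
  by_cases hne : (D.primalOpt ×ˢ {V : Matrix (Fin n) (Fin k) ℝ | Vᵀ * V = 1}).Nonempty
  · obtain ⟨q, hq, hmin⟩ := hcomp.exists_isMinOn hne hcont.continuousOn
    refine ⟨(q.2ᵀ * q.1 * q.2).trace, trace_transpose_mul_mul_pos hq.1 hk hq.2,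
      fun X hX V hV => ?_⟩
    have hmem : (X, V) ∈ D.primalOpt ×ˢ {V : Matrix (Fin n) (Fin k) ℝ | Vᵀ * V = 1} := ⟨hX, hV⟩
    have := hmin hmem
    rwa [Set.mem_ofPred_eq] at this
  · refine ⟨1, zero_lt_one, fun X hX V hV => absurd ?_ hne⟩
    have hmem : (X, V) ∈ D.primalOpt ×ˢ {V : Matrix (Fin n) (Fin k) ℝ | Vᵀ * V = 1} := ⟨hX, hV⟩
    exact Set.nonempty_of_mem hmem

end SDP

/-! ### The lower models -/

namespace SDP

variable {n m k r : ℕ} {D : SDP n m}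

theorem posSemidef_of_mem_modelSet {c : ℝ} {Wb W : Matrix (Fin n) (Fin n) ℝ}
    {P : Matrix (Fin n) (Fin r) ℝ} (hWb : Wb.PosSemidef) (hW : W ∈ modelSet c Wb P) :
    W.PosSemidef := by
  obtain ⟨γ, S, hγ, hS, -, rfl⟩ := hW
  exact (hWb.smul hγ).add (posSemidef_mul_mul_transpose P hS)

theorem trace_mul_mul_transpose {P : Matrix (Fin n) (Fin r) ℝ} (hP : Pᵀ * P = 1)
    (S : Matrix (Fin r) (Fin r) ℝ) : (P * S * Pᵀ).trace = S.trace := by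
  rw [Matrix.trace_mul_comm, ← Matrix.mul_assoc, hP, Matrix.one_mul]

theorem trace_le_of_mem_modelSet {c : ℝ} {Wb W : Matrix (Fin n) (Fin n) ℝ}
    {P : Matrix (Fin n) (Fin r) ℝ} (hWb : Wb.trace = 1) (hP : Pᵀ * P = 1)
    (hW : W ∈ modelSet c Wb P) : W.trace ≤ c := by
  obtain ⟨γ, S, -, -, h, rfl⟩ := hW
  rw [Matrix.trace_add, Matrix.trace_smul, hWb, trace_mul_mul_transpose hP, smul_eq_mul, mul_one]
  exact h

theorem zero_mem_modelSet {c : ℝ} (hc : 0 ≤ c) (Wb : Matrix (Fin n) (Fin n) ℝ)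
    (P : Matrix (Fin n) (Fin r) ℝ) : (0 : Matrix (Fin n) (Fin n) ℝ) ∈ modelSet c Wb P :=
  ⟨0, 0, le_rfl, PosSemidef.zero, by simpa using hc, by simp⟩

theorem smul_mem_modelSet {a c : ℝ} (ha : 0 ≤ a) {Wb W : Matrix (Fin n) (Fin n) ℝ}
    {P : Matrix (Fin n) (Fin r) ℝ} (hW : W ∈ modelSet c Wb P) :
    a • W ∈ modelSet (a * c) Wb P := by
  obtain ⟨γ, S, hγ, hS, h, rfl⟩ := hW
  refine ⟨a * γ, a • S, mul_nonneg ha hγ, hS.smul ha, ?_, ?_⟩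
  · rw [Matrix.trace_smul, smul_eq_mul, ← mul_add]
    exact mul_le_mul_of_nonneg_left h ha
  · rw [smul_add, smul_smul, Matrix.mul_smul, Matrix.smul_mul]

theorem convex_modelSet (c : ℝ) (Wb : Matrix (Fin n) (Fin n) ℝ) (P : Matrix (Fin n) (Fin r) ℝ) :
    Convex ℝ (modelSet c Wb P) := by
  rintro _ ⟨γ, S, hγ, hS, h, rfl⟩ _ ⟨γ', S', hγ', hS', h', rfl⟩ a b ha hb hab
  refine ⟨a * γ + b * γ', a • S + b • S', by positivity, (hS.smul ha).add (hS'.smul hb), ?_, ?_⟩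
  · simp only [Matrix.trace_add, Matrix.trace_smul, smul_eq_mul]
    have h1 := mul_le_mul_of_nonneg_left h ha
    have h2 := mul_le_mul_of_nonneg_left h' hb
    have h3 : (a + b) * c = c := by rw [hab, one_mul]
    linarith
  · simp only [Matrix.mul_add, Matrix.add_mul, Matrix.mul_smul, Matrix.smul_mul]
    module

theorem mul_mul_transpose_mem_modelSet {c : ℝ} (Wb : Matrix (Fin n) (Fin n) ℝ)
    {P : Matrix (Fin n) (Fin r) ℝ} (hP : Pᵀ * P = 1) {V : Matrix (Fin n) (Fin k) ℝ}
    (hV : Vᵀ * V = 1) {R : Matrix (Fin r) (Fin k) ℝ} (hVR : V = P * R)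
    {S : Matrix (Fin k) (Fin k) ℝ} (hS : S.PosSemidef) (hc : S.trace ≤ c) :
    V * S * Vᵀ ∈ modelSet c Wb P := by
  have hR : Rᵀ * R = 1 := by
    rw [← hV, hVR, Matrix.transpose_mul, Matrix.mul_assoc, ← Matrix.mul_assoc Pᵀ, hP,
      Matrix.one_mul]
  refine ⟨0, R * S * Rᵀ, le_rfl, posSemidef_mul_mul_transpose R hS, ?_, ?_⟩
  · rw [trace_mul_mul_transpose hR, zero_add]
    exact hc
  · rw [hVR, Matrix.transpose_mul, zero_smul, zero_add]
    simp only [Matrix.mul_assoc]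

theorem model_le {ρ : ℝ} (hρ : 0 < ρ) {Wb X : Matrix (Fin n) (Fin n) ℝ}
    {P : Matrix (Fin n) (Fin r) ℝ} {a : ℝ}
    (h : ∀ W ∈ modelSet ρ Wb P, traceInner (D.C - W) X ≤ a) : D.model ρ Wb P X ≤ a := by
  have hsup : sSup ((fun W => traceInner W (-X)) '' modelSet 1 Wb P) ≤
      (a - traceInner D.C X) / ρ := by
    refine csSup_le ⟨_, 0, zero_mem_modelSet zero_le_one Wb P, rfl⟩ ?_
    rintro _ ⟨W, hW, rfl⟩
    have h1 := smul_mem_modelSet hρ.le hW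
    rw [mul_one] at h1
    have h2 := h _ h1
    rw [traceInner_sub_left, traceInner_smul_left] at h2
    simp only [traceInner_neg_right]
    rw [le_div_iff₀ hρ]
    linarith
  rw [le_div_iff₀ hρ] at hsup
  rw [model]
  linarith

theorem le_model {ρ : ℝ} (hρ : 0 < ρ) {Wb X W : Matrix (Fin n) (Fin n) ℝ}
    {P : Matrix (Fin n) (Fin r) ℝ} (hWb : Wb.PosSemidef ∧ Wb.trace = 1) (hP : Pᵀ * P = 1)
    (hX : X.IsSymm) (hW : W ∈ modelSet ρ Wb P) :
    traceInner (D.C - W) X ≤ D.model ρ Wb P X := by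
  have hbdd : BddAbove ((fun W => traceInner W (-X)) '' modelSet 1 Wb P) := by
    refine ⟨psdDefect X, ?_⟩
    rintro _ ⟨W', hW', rfl⟩
    refine (traceInner_neg_le (posSemidef_of_mem_modelSet hWb.1 hW') hX).trans ?_
    exact mul_le_of_le_one_left (psdDefect_nonneg X) (trace_le_of_mem_modelSet hWb.2 hP hW')
  have h1 := smul_mem_modelSet (inv_nonneg.2 hρ.le) hW
  rw [inv_mul_cancel₀ hρ.ne'] at h1
  have h2 : traceInner (ρ⁻¹ • W) (-X) ≤ sSup ((fun W => traceInner W (-X)) '' modelSet 1 Wb P) :=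
    le_csSup hbdd ⟨_, h1, rfl⟩
  rw [traceInner_smul_left, inv_mul_le_iff₀ hρ, traceInner_neg_right] at h2
  rw [model, traceInner_sub_left]
  linarith

theorem model_le_cost {ρ : ℝ} (hρ : 0 < ρ) {Wb X : Matrix (Fin n) (Fin n) ℝ}
    {P : Matrix (Fin n) (Fin r) ℝ} (hWb : Wb.PosSemidef ∧ Wb.trace = 1) (hP : Pᵀ * P = 1)
    (hX : X.IsSymm) : D.model ρ Wb P X ≤ D.cost ρ X := by
  refine model_le hρ fun W hW => ?_
  have h1 := traceInner_neg_le (posSemidef_of_mem_modelSet hWb.1 hW) hX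
  have h2 := mul_le_mul_of_nonneg_right (trace_le_of_mem_modelSet hWb.2 hP hW) (psdDefect_nonneg X)
  rw [traceInner_neg_right] at h1
  rw [traceInner_sub_left, cost_eq]
  linarith

theorem norm_le_of_mem_modelSet {ρ : ℝ} {Wb W : Matrix (Fin n) (Fin n) ℝ}
    {P : Matrix (Fin n) (Fin r) ℝ} (hWb : Wb.PosSemidef ∧ Wb.trace = 1) (hP : Pᵀ * P = 1)
    (hW : W ∈ modelSet ρ Wb P) : ‖W‖ ≤ ρ :=
  (posSemidef_of_mem_modelSet hWb.1 hW).norm_le_trace.trans (trace_le_of_mem_modelSet hWb.2 hP hW)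

/-! ### Models containing the top eigenvectors of a point -/

theorem transpose_mul_submatrix_castLE {Q : Matrix (Fin n) (Fin n) ℝ} (hQ : Qᵀ * Q = 1)
    (h : k ≤ n) : (Q.submatrix id (Fin.castLE h))ᵀ * Q.submatrix id (Fin.castLE h) = 1 := by
  have : (Q.submatrix id (Fin.castLE h))ᵀ * Q.submatrix id (Fin.castLE h) =
      (Qᵀ * Q).submatrix (Fin.castLE h) (Fin.castLE h) := by
    rw [Matrix.submatrix_mul _ _ _ id _ Function.bijective_id, Matrix.transpose_submatrix]
  rw [this, hQ, Matrix.submatrix_one _ (Fin.castLE_injective h)]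

theorem dotProduct_mulVec_diagonal (Q : Matrix (Fin n) (Fin n) ℝ) (d : Fin n → ℝ)
    (w : Fin n → ℝ) :
    w ⬝ᵥ ((Q * diagonal d * Qᵀ) *ᵥ w) = ∑ j, d j * (Qᵀ *ᵥ w) j ^ 2 := by
  rw [← Matrix.mulVec_mulVec, ← Matrix.mulVec_mulVec, Matrix.dotProduct_mulVec,
    ← Matrix.mulVec_transpose, dotProduct]
  refine Finset.sum_congr rfl fun j _ => ?_
  rw [Matrix.mulVec_diagonal]
  ring

theorem dotProduct_self_transpose_mulVec {Q : Matrix (Fin n) (Fin n) ℝ} (hQ : Qᵀ * Q = 1)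
    (w : Fin n → ℝ) : w ⬝ᵥ w = ∑ j, (Qᵀ *ᵥ w) j ^ 2 := by
  have h := dotProduct_mulVec_diagonal Q (fun _ => 1) w
  rw [Matrix.diagonal_one, Matrix.mul_one, mul_eq_one_comm.1 hQ, Matrix.one_mulVec] at h
  simpa using h

theorem mulVec_dotProduct_mulVec {V : Matrix (Fin n) (Fin k) ℝ} (w : Fin n → ℝ) (a : Fin k → ℝ) :
    (V *ᵥ a) ⬝ᵥ w = a ⬝ᵥ (Vᵀ *ᵥ w) := by
  rw [dotProduct_comm, Matrix.dotProduct_mulVec, ← Matrix.mulVec_transpose, dotProduct_comm]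

/-- If the orthonormal columns of `V` lie in the span of those of `P`, then the model controls the
quadratic form of `-X` on the range of `V`. -/
theorem quad_le_model {ρ : ℝ} (hρ : 0 < ρ) {Wb X : Matrix (Fin n) (Fin n) ℝ}
    {P : Matrix (Fin n) (Fin r) ℝ} (hWb : Wb.PosSemidef ∧ Wb.trace = 1) (hP : Pᵀ * P = 1)
    {V : Matrix (Fin n) (Fin k) ℝ} (hV : Vᵀ * V = 1) {R : Matrix (Fin r) (Fin k) ℝ}
    (hVR : V = P * R) (hX : X.IsSymm) (a : Fin k → ℝ) :
    -(ρ * ((V *ᵥ a) ⬝ᵥ (X *ᵥ (V *ᵥ a)))) ≤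
      (D.model ρ Wb P X - traceInner D.C X) * (a ⬝ᵥ a) := by
  rcases (dotProduct_self_nonneg_real a).eq_or_lt with h0 | h0
  · have : a = 0 := dotProduct_self_eq_zero.1 h0.symm
    simp [this]
  have hmem : V * ((ρ / (a ⬝ᵥ a)) • vecMulVec a a) * Vᵀ ∈ modelSet ρ Wb P := by
    refine mul_mul_transpose_mem_modelSet Wb hP hV hVR
      ((posSemidef_vecMulVec a).smul (by positivity)) ?_
    rw [Matrix.trace_smul, Matrix.trace_vecMulVec, smul_eq_mul, div_mul_cancel₀ _ h0.ne']
  have h1 := le_model (D := D) hρ hWb hP hX hmem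
  have h2 : V * ((ρ / (a ⬝ᵥ a)) • vecMulVec a a) * Vᵀ =
      (ρ / (a ⬝ᵥ a)) • vecMulVec (V *ᵥ a) (V *ᵥ a) := by
    rw [Matrix.mul_smul, Matrix.smul_mul, Matrix.mul_vecMulVec, Matrix.vecMulVec_mul,
      Matrix.vecMul_transpose]
  rw [traceInner_sub_left, h2, traceInner_smul_left, traceInner_vecMulVec] at h1
  have h3 := mul_le_mul_of_nonneg_right h1 h0.le
  rw [sub_mul] at h3
  have h4 : ρ / (a ⬝ᵥ a) * ((V *ᵥ a) ⬝ᵥ (X *ᵥ (V *ᵥ a))) * (a ⬝ᵥ a) =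
      ρ * ((V *ᵥ a) ⬝ᵥ (X *ᵥ (V *ᵥ a))) := by
    field_simp
  rw [h4] at h3
  linarith

/-- The elementary estimate behind the quadratic accuracy of the model: `x = |w₁|²`, `y = |w₂|²`,
`c = w₁ᵀ E w₂`, `e = ‖E‖`. -/
theorem two_mul_add_le {x y c e δ : ℝ} (hx : 0 ≤ x) (hy : 0 ≤ y) (he : 0 ≤ e) (hδ : 0 < δ)
    (hc : c ^ 2 ≤ e ^ 2 * (x * y)) :
    2 * c + e * y - δ * y ≤ 6 / δ * e ^ 2 * (x + y) := by
  rcases le_or_gt e (δ / 2) with h | h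
  · have h1 : 2 * c ≤ 2 / δ * e ^ 2 * x + δ / 2 * y := by
      refine (le_abs_self _).trans (abs_le_of_sq_le_sq ?_ (by positivity))
      have h2 : 4 * (2 / δ * e ^ 2 * x) * (δ / 2 * y) = 4 * (e ^ 2 * (x * y)) := by
        field_simp
      nlinarith [sq_nonneg (2 / δ * e ^ 2 * x - δ / 2 * y)]
    have h3 : e * y ≤ δ / 2 * y := mul_le_mul_of_nonneg_right h hy
    have h4 : 0 ≤ 1 / δ * e ^ 2 * x := by positivity
    have h5 : 0 ≤ 1 / δ * e ^ 2 * y := by positivity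
    have h6 : 6 / δ * e ^ 2 * (x + y) = 6 * (1 / δ * e ^ 2 * x) + 6 * (1 / δ * e ^ 2 * y) := by
      ring
    have h7 : 2 / δ * e ^ 2 * x = 2 * (1 / δ * e ^ 2 * x) := by ring
    linarith
  · have h1 : 2 * c ≤ e * (x + y) := by
      refine (le_abs_self _).trans (abs_le_of_sq_le_sq ?_ (by positivity))
      nlinarith [mul_nonneg (sq_nonneg e) (sq_nonneg (x - y))]
    have h2 : 3 * e ≤ 6 / δ * e ^ 2 := by
      rw [div_mul_eq_mul_div, le_div_iff₀ hδ]
      nlinarith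
    have h3 := mul_le_mul_of_nonneg_right h2 (add_nonneg hx hy)
    have h4 : 0 ≤ e * x := mul_nonneg he hx
    have h5 : 0 ≤ δ * y := mul_nonneg hδ.le hy
    nlinarith

/-- **Quadratic accuracy of the model.** If the span of `P` contains top eigenvectors `V` of `-Xh`
and the remaining eigenvalues of `-Xh` are at most `-δ`, then the model is accurate up to a
quadratic error around `Xh`. No gap between consecutive eigenvalues is needed, because the penalty
only sees the positive part of the largest eigenvalue. -/
theorem cost_le_model_add {ρ δ : ℝ} (hρ : 0 < ρ) (hδ : 0 < δ)
    {Wb X Xh : Matrix (Fin n) (Fin n) ℝ} {P : Matrix (Fin n) (Fin r) ℝ}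
    (hWb : Wb.PosSemidef ∧ Wb.trace = 1) (hP : Pᵀ * P = 1) (hX : X.IsSymm)
    {Q : Matrix (Fin n) (Fin n) ℝ} {d : Fin n → ℝ} (hQ : IsSpectralDecomposition (-Xh) Q d)
    (h : k ≤ n) {V : Matrix (Fin n) (Fin k) ℝ} (hV : V = Q.submatrix id (Fin.castLE h))
    {R : Matrix (Fin r) (Fin k) ℝ} (hVR : V = P * R) (hd : ∀ j : Fin n, k ≤ j → d j ≤ -δ) :
    D.cost ρ X ≤ D.model ρ Wb P X + ρ * (6 / δ) * ‖X - Xh‖ ^ 2 := by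
  obtain ⟨hQ1, -, hXh⟩ := hQ
  have hV1 : Vᵀ * V = 1 := hV ▸ transpose_mul_submatrix_castLE hQ1 h
  set u := (D.model ρ Wb P X - traceInner D.C X) / ρ with hu
  have hρu : D.model ρ Wb P X - traceInner D.C X = ρ * u := by rw [hu]; field_simp
  have hu0 : 0 ≤ u := by
    have h1 := le_model (D := D) hρ hWb hP hX (zero_mem_modelSet hρ.le Wb P)
    rw [sub_zero] at h1
    exact div_nonneg (by linarith) hρ.le
  have hdef : psdDefect X ≤ u + 6 / δ * ‖X - Xh‖ ^ 2 := by
    refine psdDefect_le_of_quad hX (by positivity) fun w => ?_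
    obtain ⟨a, ha⟩ : ∃ a, a = Vᵀ *ᵥ w := ⟨_, rfl⟩
    obtain ⟨w₁, hw₁⟩ : ∃ w₁, w₁ = V *ᵥ a := ⟨_, rfl⟩
    obtain ⟨w₂, hw₂⟩ : ∃ w₂, w₂ = w - w₁ := ⟨_, rfl⟩
    have hw : w = w₁ + w₂ := by rw [hw₂]; abel
    have hVw₂ : Vᵀ *ᵥ w₂ = 0 := by
      rw [hw₂, Matrix.mulVec_sub, hw₁, Matrix.mulVec_mulVec, hV1, Matrix.one_mulVec, ha, sub_self]
    have h12 : w₁ ⬝ᵥ w₂ = 0 := by rw [hw₁, mulVec_dotProduct_mulVec, hVw₂, dotProduct_zero]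
    have h11 : w₁ ⬝ᵥ w₁ = a ⬝ᵥ a := by
      nth_rewrite 2 [hw₁]
      rw [hw₁, mulVec_dotProduct_mulVec, Matrix.mulVec_mulVec, hV1, Matrix.one_mulVec]
    have hww : w ⬝ᵥ w = w₁ ⬝ᵥ w₁ + w₂ ⬝ᵥ w₂ := by
      rw [hw, add_dotProduct, dotProduct_add, dotProduct_add, dotProduct_comm w₂ w₁, h12]
      ring
    -- on the orthogonal complement of the range of `V`, the form of `-Xh` is at most `-δ`
    have hz : ∀ j : Fin n, (j : ℕ) < k → (Qᵀ *ᵥ w₂) j = 0 := by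
      intro j hj
      have := congrFun hVw₂ ⟨j, hj⟩
      rw [hV] at this
      simpa [Matrix.mulVec, dotProduct] using this
    have h22 : w₂ ⬝ᵥ ((-Xh) *ᵥ w₂) ≤ -(δ * (w₂ ⬝ᵥ w₂)) := by
      rw [hXh, dotProduct_mulVec_diagonal, dotProduct_self_transpose_mulVec hQ1, ← neg_mul,
        Finset.mul_sum]
      refine Finset.sum_le_sum fun j _ => ?_
      rcases lt_or_ge (j : ℕ) k with hj | hj
      · rw [hz j hj]
        simp
      · exact mul_le_mul_of_nonneg_right (hd j hj) (sq_nonneg _)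
    have hXhS : (-Xh).IsSymm := by
      rw [hXh]
      exact isSymm_mul_mul_transpose _ (Matrix.isSymm_diagonal d)
    have hXhV : (-Xh) * V = V * diagonal (fun j => d (Fin.castLE h j)) := by
      have h1 : (-Xh) * Q = Q * diagonal d := by
        rw [hXh, Matrix.mul_assoc, hQ1, Matrix.mul_one]
      ext i j
      have h2 := congrFun (congrFun h1 i) (Fin.castLE h j)
      rw [Matrix.mul_diagonal] at h2
      rw [Matrix.mul_diagonal, hV, Matrix.submatrix_apply, id_eq, ← h2]
      simp [Matrix.mul_apply]
    have hcross : w₁ ⬝ᵥ ((-Xh) *ᵥ w₂) = 0 := by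
      rw [IsSymm.dotProduct_mulVec_comm hXhS, hw₁, Matrix.mulVec_mulVec, hXhV,
        ← Matrix.mulVec_mulVec, dotProduct_comm, mulVec_dotProduct_mulVec, hVw₂, dotProduct_zero]
    have hmod := quad_le_model (D := D) hρ hWb hP hV1 hVR hX a
    rw [hρu, ← hw₁, ← h11] at hmod
    have hmod' : -(w₁ ⬝ᵥ (X *ᵥ w₁)) ≤ u * (w₁ ⬝ᵥ w₁) := by
      refine le_of_mul_le_mul_left ?_ hρ
      linarith
    have hx := dotProduct_self_nonneg_real w₁
    have hy := dotProduct_self_nonneg_real w₂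
    have hE := sq_dotProduct_mulVec_le w₁ w₂ (X - Xh)
    have hE2 := (abs_le.1 (abs_dotProduct_mulVec_self_le w₂ (X - Xh))).1
    have hest := two_mul_add_le (c := -(w₁ ⬝ᵥ ((X - Xh) *ᵥ w₂))) hx hy (norm_nonneg (X - Xh)) hδ
      (by rw [neg_sq]; exact hE)
    rw [Matrix.sub_mulVec, dotProduct_sub] at hest hE2
    rw [Matrix.neg_mulVec, dotProduct_neg] at hcross h22
    have hexp : w ⬝ᵥ (X *ᵥ w) = w₁ ⬝ᵥ (X *ᵥ w₁) + 2 * (w₁ ⬝ᵥ (X *ᵥ w₂)) + w₂ ⬝ᵥ (X *ᵥ w₂) := by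
      rw [hw, Matrix.mulVec_add, add_dotProduct, dotProduct_add, dotProduct_add,
        IsSymm.dotProduct_mulVec_comm hX w₂ w₁]
      ring
    rw [hexp, hww]
    have huy := mul_nonneg hu0 hy
    linarith
  have := mul_le_mul_of_nonneg_left hdef hρ.le
  rw [cost_eq]
  linarith

/-- If the span of `P` contains an eigenvector for the largest eigenvalue of `-Xh`, then one of the
affine functions of the model agrees with the cost at `Xh`. -/
theorem exists_mem_modelSet_cost_le {ρ : ℝ} (hρ : 0 < ρ) (Wb : Matrix (Fin n) (Fin n) ℝ)
    {Xh : Matrix (Fin n) (Fin n) ℝ}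
    {P : Matrix (Fin n) (Fin r) ℝ} (hP : Pᵀ * P = 1) (hXhs : Xh.IsSymm)
    {V : Matrix (Fin n) (Fin k) ℝ} (hk : 0 < k) (hV : IsTopEigenvectors (-Xh) V)
    {R : Matrix (Fin r) (Fin k) ℝ} (hVR : V = P * R) :
    ∃ W ∈ modelSet ρ Wb P, D.cost ρ Xh ≤ traceInner (D.C - W) Xh := by
  obtain ⟨h, Q, d, ⟨hQ1, hanti, hXh⟩, hVQ⟩ := hV
  have hV1 : Vᵀ * V = 1 := hVQ ▸ transpose_mul_submatrix_castLE hQ1 h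
  set j₀ : Fin n := Fin.castLE h ⟨0, hk⟩ with hj₀
  have hdj : ∀ j, d j ≤ d j₀ := fun j => hanti (Fin.mk_le_mk.2 (Nat.zero_le _))
  have hdef : ∀ s, 0 ≤ s → d j₀ ≤ s → psdDefect Xh ≤ s := by
    intro s hs hds
    refine psdDefect_le_of_quad hXhs hs fun w => ?_
    have h1 : w ⬝ᵥ ((-Xh) *ᵥ w) ≤ s * (w ⬝ᵥ w) := by
      rw [hXh, dotProduct_mulVec_diagonal, dotProduct_self_transpose_mulVec hQ1, Finset.mul_sum]
      exact Finset.sum_le_sum fun j _ =>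
        mul_le_mul_of_nonneg_right ((hdj j).trans hds) (sq_nonneg _)
    rw [Matrix.neg_mulVec, dotProduct_neg] at h1
    linarith
  rcases le_or_gt (d j₀) 0 with h0 | h0
  · refine ⟨0, zero_mem_modelSet hρ.le Wb P, ?_⟩
    rw [cost_eq, le_antisymm (hdef 0 le_rfl h0) (psdDefect_nonneg _), sub_zero, mul_zero, add_zero]
  · set a : Fin k → ℝ := Pi.single ⟨0, hk⟩ 1 with ha
    refine ⟨V * (ρ • vecMulVec a a) * Vᵀ, mul_mul_transpose_mem_modelSet Wb hP hV1 hVR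
      ((posSemidef_vecMulVec a).smul hρ.le) ?_, ?_⟩
    · simp [Matrix.trace_vecMulVec, ha]
    · have h2 : V * (ρ • vecMulVec a a) * Vᵀ = ρ • vecMulVec (V *ᵥ a) (V *ᵥ a) := by
        rw [Matrix.mul_smul, Matrix.smul_mul, Matrix.mul_vecMulVec, Matrix.vecMulVec_mul,
          Matrix.vecMul_transpose]
      have hQv : Qᵀ *ᵥ (V *ᵥ a) = Pi.single j₀ 1 := by
        have : V *ᵥ a = Q *ᵥ Pi.single j₀ 1 := by
          ext i
          simp [ha, hVQ, hj₀]
        rw [this, Matrix.mulVec_mulVec, hQ1, Matrix.one_mulVec]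
      have h3 : (V *ᵥ a) ⬝ᵥ ((-Xh) *ᵥ (V *ᵥ a)) = d j₀ := by
        rw [hXh, dotProduct_mulVec_diagonal, hQv, Finset.sum_eq_single j₀]
        · simp
        · intro j _ hj
          simp [hj]
        · simp
      rw [Matrix.neg_mulVec, dotProduct_neg] at h3
      rw [cost_eq, traceInner_sub_left, h2, traceInner_smul_left, traceInner_vecMulVec]
      have := mul_le_mul_of_nonneg_left (hdef (d j₀) h0.le le_rfl) hρ.le
      have h4 : (V *ᵥ a) ⬝ᵥ (Xh *ᵥ (V *ᵥ a)) = -d j₀ := by linarith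
      rw [h4]
      linarith

/-! ### The master problem -/

theorem nonneg_of_forall_add_sq {p q : ℝ} (h : ∀ t : ℝ, 0 ≤ t → t ≤ 1 → 0 ≤ t * p + t ^ 2 * q) :
    0 ≤ p := by
  by_contra! hp
  set t := min 1 (-p / (2 * (|q| + 1))) with ht
  have ht0 : 0 < t := lt_min one_pos (div_pos (by linarith) (by positivity))
  have h1 := h t ht0.le (min_le_left _ _)
  have h2 : t * (|q| + 1) ≤ -p / 2 := by
    have := min_le_right 1 (-p / (2 * (|q| + 1)))
    rw [← ht, le_div_iff₀ (by positivity)] at this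
    linarith
  have h3 : t * q ≤ t * (|q| + 1) := mul_le_mul_of_nonneg_left (by linarith [le_abs_self q]) ht0.le
  have h4 : 0 ≤ t * (p + t * q) := by linarith [sq t ▸ h1]
  have h5 := nonneg_of_mul_nonneg_right h4 ht0
  linarith

/-- First-order optimality of `(W, y)` in the dual form of the master problem: with
`X' = Ω + α⁻¹ (W - C + 𝒜*(y))`, stationarity in `y` says `𝒜(X') = b` and optimality in `W` says that
`W` attains the maximum that defines the model at `X'`. -/
theorem dualMaster_optimality {ρ α : ℝ} (hα : 0 < α) {Wb Ω W : Matrix (Fin n) (Fin n) ℝ}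
    {P : Matrix (Fin n) (Fin r) ℝ} {y : Fin m → ℝ} (hW : W ∈ modelSet ρ Wb P)
    (hopt : ∀ W' ∈ modelSet ρ Wb P, ∀ y' : Fin m → ℝ,
      D.dualMaster α Ω W y ≤ D.dualMaster α Ω W' y') :
    D.map (Ω + α⁻¹ • (W - D.C + D.adj y)) = D.b ∧
    ∀ W' ∈ modelSet ρ Wb P, traceInner (D.C - W') (Ω + α⁻¹ • (W - D.C + D.adj y)) ≤
      traceInner (D.C - W) (Ω + α⁻¹ • (W - D.C + D.adj y)) := by
  set E := W - D.C + D.adj y with hE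
  have hexp : ∀ H : Matrix (Fin n) (Fin n) ℝ, 1 / (2 * α) * ‖E + H‖ ^ 2 =
      1 / (2 * α) * ‖E‖ ^ 2 + α⁻¹ * traceInner E H + 1 / (2 * α) * ‖H‖ ^ 2 := by
    intro H
    rw [norm_add_sq_eq]
    field_simp
  constructor
  · have hy : ∀ v : Fin m → ℝ, 0 ≤ -((D.b - D.map Ω) ⬝ᵥ v) + α⁻¹ * traceInner E (D.adj v) := by
      intro v
      refine nonneg_of_forall_add_sq (q := 1 / (2 * α) * ‖D.adj v‖ ^ 2) fun t _ _ => ?_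
      have h1 := hopt W hW (y + t • v)
      have h2 : D.adj (y + t • v) = D.adj y + t • D.adj v := by
        simp only [adj, Pi.add_apply, Pi.smul_apply, add_smul, Finset.sum_add_distrib,
          Finset.smul_sum, smul_smul, smul_eq_mul]
      have h3 : W - D.C + D.adj (y + t • v) = E + t • D.adj v := by rw [h2, hE]; abel
      rw [dualMaster, dualMaster, h3, hexp, dotProduct_add, dotProduct_smul, smul_eq_mul,
        traceInner_smul_right, norm_smul, mul_pow, Real.norm_eq_abs, sq_abs] at h1
      linarith
    have hy0 : ∀ v : Fin m → ℝ, -((D.b - D.map Ω) ⬝ᵥ v) + α⁻¹ * traceInner E (D.adj v) = 0 := by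
      intro v
      refine le_antisymm ?_ (hy v)
      have h1 := hy (-v)
      have h2 : D.adj (-v) = -D.adj v := by simp [adj]
      rw [h2, dotProduct_neg, traceInner_neg_right] at h1
      linarith
    rw [map_add, map_smul]
    refine sub_eq_zero.1 (dotProduct_eq_zero _ fun v => ?_)
    have h1 := hy0 v
    rw [traceInner_comm, traceInner_adj, dotProduct_comm v] at h1
    rw [sub_dotProduct] at h1 ⊢
    rw [add_dotProduct, smul_dotProduct, smul_eq_mul]
    linarith
  · intro W' hW'
    have hp : 0 ≤ traceInner (W' - W) Ω + α⁻¹ * traceInner E (W' - W) := by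
      refine nonneg_of_forall_add_sq (q := 1 / (2 * α) * ‖W' - W‖ ^ 2) fun t ht0 ht1 => ?_
      have hmem : W + t • (W' - W) ∈ modelSet ρ Wb P := by
        have := convex_modelSet ρ Wb P hW hW' (sub_nonneg.2 ht1) ht0 (by ring)
        convert this using 1
        module
      have h1 := hopt _ hmem y
      have h3 : W + t • (W' - W) - D.C + D.adj y = E + t • (W' - W) := by rw [hE]; abel
      have h4 : traceInner (W + t • (W' - W) - D.C) Ω =
          traceInner (W - D.C) Ω + t * traceInner (W' - W) Ω := by
        simp only [traceInner_sub_left, traceInner_add_left, traceInner_smul_left]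
        ring
      rw [dualMaster, dualMaster, h3, h4, hexp, traceInner_smul_right, norm_smul, mul_pow,
        Real.norm_eq_abs, sq_abs] at h1
      linarith
    have h5 : traceInner (W' - W) (Ω + α⁻¹ • E) =
        traceInner (W' - W) Ω + α⁻¹ * traceInner E (W' - W) := by
      rw [traceInner_add_right, traceInner_smul_right, traceInner_comm E]
    rw [← h5, traceInner_sub_left] at hp
    rw [traceInner_sub_left, traceInner_sub_left]
    linarith

/-- The affine minorant `⟨C - W, ·⟩` plus the proximal term is, on the affine space, a perfect
square around the stationary point `c`. -/
theorem prox_identity {α : ℝ} {Ω W c : Matrix (Fin n) (Fin n) ℝ} {y : Fin m → ℝ}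
    (hc : α • (c - Ω) = W - D.C + D.adj y) (hcb : D.map c = D.b) {X : Matrix (Fin n) (Fin n) ℝ}
    (hX : D.map X = D.b) :
    traceInner (D.C - W) X + α / 2 * ‖X - Ω‖ ^ 2 =
      traceInner (D.C - W) c + α / 2 * ‖c - Ω‖ ^ 2 + α / 2 * ‖X - c‖ ^ 2 := by
  have h1 : X - Ω = (c - Ω) + (X - c) := by abel
  have h2 : traceInner (D.C - W) (X - c) = -(α * traceInner (c - Ω) (X - c)) := by
    have h3 : D.C - W = D.adj y - α • (c - Ω) := by rw [hc]; abel
    rw [h3, traceInner_sub_left, traceInner_adj, map_sub, hX, hcb, sub_self, dotProduct_zero,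
      traceInner_smul_left]
    ring
  rw [h1, norm_add_sq_eq]
  rw [traceInner_sub_right] at h2
  linarith

/-- The primal and dual forms of the master problem determine each other. -/
theorem master_eq {ρ α : ℝ} (hρ : 0 < ρ) (hα : 0 < α) {Wb Ω W c : Matrix (Fin n) (Fin n) ℝ}
    {P : Matrix (Fin n) (Fin r) ℝ} {y : Fin m → ℝ} (hWb : Wb.PosSemidef ∧ Wb.trace = 1)
    (hP : Pᵀ * P = 1) (hΩ : Ω.IsSymm) (hW : W ∈ modelSet ρ Wb P)
    (hopt : ∀ W' ∈ modelSet ρ Wb P, ∀ y' : Fin m → ℝ,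
      D.dualMaster α Ω W y ≤ D.dualMaster α Ω W' y')
    (hc : c ∈ D.affine) (hmin : IsMinOn
      (fun X => D.model ρ Wb P X + α / 2 * ‖X - Ω‖ ^ 2) D.affine c) :
    α • (c - Ω) = W - D.C + D.adj y ∧ D.model ρ Wb P c = traceInner (D.C - W) c := by
  obtain ⟨h1, h2⟩ := dualMaster_optimality hα hW hopt
  obtain ⟨X', hX'⟩ : ∃ X', X' = Ω + α⁻¹ • (W - D.C + D.adj y) := ⟨_, rfl⟩
  rw [← hX'] at h1 h2
  have hX'eq : α • (X' - Ω) = W - D.C + D.adj y := by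
    rw [hX', add_sub_cancel_left, smul_smul, mul_inv_cancel₀ hα.ne', one_smul]
  have hX's : X'.IsSymm := by
    rw [hX']
    exact hΩ.add ((((posSemidef_of_mem_modelSet hWb.1 hW).isSymm.sub D.C_symm).add
      (D.adj_isSymm y)).smul _)
  have hmod : D.model ρ Wb P X' = traceInner (D.C - W) X' :=
    le_antisymm (model_le hρ h2) (le_model hρ hWb hP hX's hW)
  have h3 := isMinOn_iff.1 hmin X' ⟨hX's, h1⟩
  simp only [hmod] at h3
  have h4 := le_model (D := D) hρ hWb hP hc.1 hW
  have h5 := prox_identity hX'eq h1 hc.2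
  have h6 : α / 2 * ‖c - X'‖ ^ 2 ≤ 0 := by linarith
  have h7 : ‖c - X'‖ ^ 2 ≤ 0 := by
    by_contra! h7
    have := mul_pos (half_pos hα) h7
    linarith
  have h8 : c = X' := by
    have := pow_eq_zero_iff two_ne_zero |>.1 (le_antisymm h7 (sq_nonneg _))
    exact sub_eq_zero.1 (norm_eq_zero.1 this)
  rw [h8]
  exact ⟨hX'eq, hmod⟩

/-- The optimal `W` of one iteration stays available to the next model: the part of `S` kept in the
span of the new `P` and the part moved into the weight add up to it. -/
theorem mem_modelSet_update {ρ γ : ℝ} {rp rc : ℕ} {Wb Wb' : Matrix (Fin n) (Fin n) ℝ}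
    {P P' : Matrix (Fin n) (Fin (rp + rc)) ℝ} {S Q : Matrix (Fin (rp + rc)) (Fin (rp + rc)) ℝ}
    {σ : Fin (rp + rc) → ℝ} (hγ : 0 ≤ γ) (hS : S.PosSemidef) (htr : γ + S.trace ≤ ρ)
    (hP : Pᵀ * P = 1) (hP' : P'ᵀ * P' = 1) (hQ : IsSpectralDecomposition S Q σ)
    (hspan : ∃ R : Matrix (Fin (rp + rc)) (Fin rp) ℝ,
      P * Q.submatrix id (Fin.castAdd rc) = P' * R)
    (hWb' : (γ + ∑ j : Fin rc, σ (Fin.natAdd rp j)) • Wb' =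
      γ • Wb + P * (Q.submatrix id (Fin.natAdd rp) * diagonal (fun j => σ (Fin.natAdd rp j))
        * (Q.submatrix id (Fin.natAdd rp))ᵀ) * Pᵀ) :
    γ • Wb + P * S * Pᵀ ∈ modelSet ρ Wb' P' := by
  obtain ⟨hQ1, -, hSQ⟩ := hQ
  obtain ⟨R, hR⟩ := hspan
  have hσ : ∀ i, 0 ≤ σ i := by
    have h1 : (diagonal σ).PosSemidef := by
      have h2 : diagonal σ = Qᵀ * S * Qᵀᵀ := by
        rw [hSQ, Matrix.transpose_transpose]
        calc diagonal σ = Qᵀ * Q * diagonal σ * (Qᵀ * Q) := by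
              rw [hQ1, Matrix.one_mul, Matrix.mul_one]
          _ = _ := by simp only [Matrix.mul_assoc]
      rw [h2]
      exact posSemidef_mul_mul_transpose _ hS
    exact posSemidef_diagonal_iff.1 h1
  set Q₁ := Q.submatrix id (Fin.castAdd rc) with hQ₁
  set Q₂ := Q.submatrix id (Fin.natAdd rp) with hQ₂
  set σ₁ : Fin rp → ℝ := fun j => σ (Fin.castAdd rc j) with hσ₁
  set σ₂ : Fin rc → ℝ := fun j => σ (Fin.natAdd rp j) with hσ₂
  have hsplit : S = Q₁ * diagonal σ₁ * Q₁ᵀ + Q₂ * diagonal σ₂ * Q₂ᵀ := by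
    rw [hSQ]
    ext i j
    simp only [Matrix.add_apply, Matrix.mul_apply (M := Q * diagonal σ),
      Matrix.mul_apply (M := Q₁ * diagonal σ₁), Matrix.mul_apply (M := Q₂ * diagonal σ₂),
      Matrix.mul_diagonal, Fin.sum_univ_add]
    rfl
  have hQ₁1 : Q₁ᵀ * Q₁ = 1 := by
    have : Q₁ᵀ * Q₁ = (Qᵀ * Q).submatrix (Fin.castAdd rc) (Fin.castAdd rc) := by
      rw [Matrix.submatrix_mul _ _ _ id _ Function.bijective_id, ← Matrix.transpose_submatrix]
    rw [this, hQ1, Matrix.submatrix_one _ (Fin.castAdd_injective rp rc)]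
  have hPQ : (P * Q₁)ᵀ * (P * Q₁) = 1 := by
    rw [Matrix.transpose_mul, Matrix.mul_assoc, ← Matrix.mul_assoc Pᵀ, hP, Matrix.one_mul, hQ₁1]
  have htrS : S.trace = ∑ j, σ₁ j + ∑ j, σ₂ j := by
    rw [hSQ, trace_mul_mul_transpose hQ1, Matrix.trace_diagonal, Fin.sum_univ_add]
  have hR1 : Rᵀ * R = 1 := by
    rw [← hPQ, hR, Matrix.transpose_mul, Matrix.mul_assoc, ← Matrix.mul_assoc P'ᵀ, hP',
      Matrix.one_mul]
  refine ⟨γ + ∑ j, σ₂ j, R * diagonal σ₁ * Rᵀ, add_nonneg hγ (Finset.sum_nonneg fun j _ => hσ _),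
    posSemidef_mul_mul_transpose R (posSemidef_diagonal_iff.2 fun j => hσ _), ?_, ?_⟩
  · rw [trace_mul_mul_transpose hR1, Matrix.trace_diagonal]
    linarith
  · have h1 : P' * (R * diagonal σ₁ * Rᵀ) * P'ᵀ = P * (Q₁ * diagonal σ₁ * Q₁ᵀ) * Pᵀ := by
      calc _ = (P' * R) * diagonal σ₁ * (P' * R)ᵀ := by
            simp only [Matrix.transpose_mul, Matrix.mul_assoc]
        _ = _ := by
            rw [← hR]
            simp only [Matrix.transpose_mul, Matrix.mul_assoc]
    rw [hWb', h1]
    nth_rewrite 1 [hsplit]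
    rw [Matrix.mul_add, Matrix.add_mul]
    abel

end SDP

/-! ### One iteration of the bundle method -/

namespace SDP

variable {n m : ℕ} {D : SDP n m}

theorem cost_convex {ρ : ℝ} (hρ : 0 ≤ ρ) {X Y : Matrix (Fin n) (Fin n) ℝ} (hX : X.IsSymm)
    (hY : Y.IsSymm) {a b : ℝ} (ha : 0 ≤ a) (hb : 0 ≤ b) :
    D.cost ρ (a • X + b • Y) ≤ a * D.cost ρ X + b * D.cost ρ Y := by
  have := mul_le_mul_of_nonneg_left (psdDefect_convex hX hY ha hb) hρ
  simp only [cost_eq, traceInner_add_right, traceInner_smul_right]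
  linarith

theorem cost_le_add_norm {ρ : ℝ} (hρ : 0 ≤ ρ) {X Y : Matrix (Fin n) (Fin n) ℝ} (hX : X.IsSymm)
    (hY : Y.IsSymm) : D.cost ρ Y ≤ D.cost ρ X + (‖D.C‖ + ρ) * ‖Y - X‖ := by
  have h1 := mul_le_mul_of_nonneg_left (psdDefect_le_add_norm hX hY) hρ
  have h2 := traceInner_le D.C (Y - X)
  rw [traceInner_sub_right] at h2
  simp only [cost_eq]
  linarith

theorem psdDefect_le_norm {X : Matrix (Fin n) (Fin n) ℝ} (hX : X.IsSymm) : psdDefect X ≤ ‖X‖ := by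
  have := psdDefect_le_add_norm (X := 0) (by simp [Matrix.IsSymm]) hX
  rwa [psdDefect_eq_zero PosSemidef.zero, zero_add, sub_zero] at this

namespace SBMPRun

variable {ρ α β : ℝ} {rp rc : ℕ} (R : D.SBMPRun ρ α β rp rc)

theorem P_orthonormal : ∀ t, (R.P t)ᵀ * R.P t = 1
  | 0 => by
    obtain ⟨h, Q, d, hQ, hP⟩ := R.init_P
    rw [hP]
    exact transpose_mul_submatrix_castLE hQ.1 h
  | t + 1 => R.P_orth t

theorem Wb_normal : ∀ t, (R.Wb t).PosSemidef ∧ (R.Wb t).trace = 1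
  | 0 => R.init_Wb
  | t + 1 => R.Wb_normalized t

theorem Ω_succ (t : ℕ) : R.Ω (t + 1) = R.cand t ∨ R.Ω (t + 1) = R.Ω t ∧
    (t = 0 → D.map (R.Ω 0) = D.b) ∧
    ¬ D.DescentTest ρ β (R.Wb t) (R.P t) (R.Ω t) (R.cand t) := by
  by_cases h0 : t = 0 → D.map (R.Ω 0) = D.b
  · by_cases h1 : D.DescentTest ρ β (R.Wb t) (R.P t) (R.Ω t) (R.cand t)
    · exact Or.inl (R.step_descent t h0 h1)
    · exact Or.inr ⟨R.step_null t h0 h1, h0, h1⟩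
  · push Not at h0
    obtain ⟨rfl, h⟩ := h0
    exact Or.inl (R.step_affine h)

theorem Ω_isSymm : ∀ t, (R.Ω t).IsSymm
  | 0 => R.init_symm
  | t + 1 => by
    rcases R.Ω_succ t with h | h
    · rw [h]
      exact (R.master t).1.1
    · rw [h.1]
      exact Ω_isSymm t

theorem Ω_succ_mem_affine : ∀ t, R.Ω (t + 1) ∈ D.affine
  | 0 => by
    rcases R.Ω_succ 0 with h | ⟨h, h0, -⟩
    · rw [h]
      exact (R.master 0).1
    · rw [h]
      exact ⟨R.init_symm, h0 rfl⟩
  | t + 1 => by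
    rcases R.Ω_succ (t + 1) with h | ⟨h, -, -⟩
    · rw [h]
      exact (R.master (t + 1)).1
    · rw [h]
      exact Ω_succ_mem_affine t

theorem W_mem (t : ℕ) : R.W t ∈ modelSet ρ (R.Wb t) (R.P t) :=
  ⟨R.γ t, R.S t, R.γ_nonneg t, R.S_posSemidef t, R.γ_add_trace t, R.W_eq t⟩

theorem W_mem_succ (t : ℕ) : R.W t ∈ modelSet ρ (R.Wb (t + 1)) (R.P (t + 1)) := by
  rw [R.W_eq t]
  exact mem_modelSet_update (R.γ_nonneg t) (R.S_posSemidef t) (R.γ_add_trace t)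
    (R.P_orthonormal t) (R.P_orthonormal (t + 1)) (R.S_eig t) (R.P_span_past t) (R.Wb_update t)

/-- The optimal value of the master problem at iteration `t`. -/
noncomputable def masterValue (t : ℕ) : ℝ :=
  traceInner (D.C - R.W t) (R.cand t) + α / 2 * ‖R.cand t - R.Ω t‖ ^ 2

/-- The amount by which the master problem at iteration `t` promises to improve on its center. -/
noncomputable def promise (t : ℕ) : ℝ := D.cost ρ (R.Ω t) - R.masterValue t

section

variable {R} (hρ : 0 < ρ) (hα : 0 < α)
include hρ hα

theorem cand_sub_eq (t : ℕ) : α • (R.cand t - R.Ω t) = R.W t - D.C + D.adj (R.y t) :=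
  (master_eq hρ hα (R.Wb_normal t) (R.P_orthonormal t) (R.Ω_isSymm t) (R.W_mem t) (R.dual_master t)
    (R.master t).1 (R.master t).2).1

theorem model_cand (t : ℕ) :
    D.model ρ (R.Wb t) (R.P t) (R.cand t) = traceInner (D.C - R.W t) (R.cand t) :=
  (master_eq hρ hα (R.Wb_normal t) (R.P_orthonormal t) (R.Ω_isSymm t) (R.W_mem t) (R.dual_master t)
    (R.master t).1 (R.master t).2).2

theorem prox_eq (t : ℕ) {X : Matrix (Fin n) (Fin n) ℝ} (hX : X ∈ D.affine) :
    traceInner (D.C - R.W t) X + α / 2 * ‖X - R.Ω t‖ ^ 2 =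
      R.masterValue t + α / 2 * ‖X - R.cand t‖ ^ 2 :=
  prox_identity (R.cand_sub_eq hρ hα t) (R.master t).1.2 hX.2

omit hα in
theorem minorant_le_cost (t : ℕ) {X : Matrix (Fin n) (Fin n) ℝ} (hX : X.IsSymm) :
    traceInner (D.C - R.W t) X ≤ D.cost ρ X :=
  (le_model hρ (R.Wb_normal t) (R.P_orthonormal t) hX (R.W_mem t)).trans
    (model_le_cost hρ (R.Wb_normal t) (R.P_orthonormal t) hX)

/-- The model predicts at least as much decrease as the promise, and the step length is controlled
by the promise. -/
theorem promise_bounds {t : ℕ} (hΩ : R.Ω t ∈ D.affine) :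
    α / 2 * ‖R.cand t - R.Ω t‖ ^ 2 ≤ R.promise t ∧
    R.promise t ≤ D.cost ρ (R.Ω t) - traceInner (D.C - R.W t) (R.cand t) := by
  have h1 := R.prox_eq hρ hα t hΩ
  have h2 := R.minorant_le_cost hρ t hΩ.1
  rw [sub_self, norm_zero, norm_sub_rev] at h1
  have h3 : 0 ≤ α / 2 * ‖R.cand t - R.Ω t‖ ^ 2 := by positivity
  simp only [promise, masterValue] at *
  constructor <;> linarith

theorem promise_nonneg {t : ℕ} (hΩ : R.Ω t ∈ D.affine) : 0 ≤ R.promise t :=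
  le_trans (by positivity) (R.promise_bounds hρ hα hΩ).1

/-- The master value is at most the value of the proximal subproblem of the true cost; testing on
the segment from the center to `X` gives a lower bound for the promise. -/
theorem le_promise {t : ℕ} (hΩ : R.Ω t ∈ D.affine) {X : Matrix (Fin n) (Fin n) ℝ}
    (hX : X ∈ D.affine) {s : ℝ} (hs0 : 0 ≤ s) (hs1 : s ≤ 1) :
    s * (D.cost ρ (R.Ω t) - D.cost ρ X) - α / 2 * s ^ 2 * ‖X - R.Ω t‖ ^ 2 ≤ R.promise t := by
  have hY : (1 - s) • R.Ω t + s • X ∈ D.affine :=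
    convex_affine hΩ hX (by linarith) hs0 (by ring)
  have h1 := R.prox_eq hρ hα t hY
  have h2 := R.minorant_le_cost hρ t hY.1
  have h3 := cost_convex (D := D) hρ.le hΩ.1 hX.1 (a := 1 - s) (b := s) (by linarith) hs0
  have h4 : (1 - s) • R.Ω t + s • X - R.Ω t = s • (X - R.Ω t) := by module
  rw [h4, norm_smul, mul_pow, Real.norm_eq_abs, sq_abs] at h1
  have h5 : 0 ≤ α / 2 * ‖(1 - s) • R.Ω t + s • X - R.cand t‖ ^ 2 := by positivity
  rw [promise]
  linarith

theorem promise_le (t : ℕ) :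
    R.promise t ≤ ρ * psdDefect (R.Ω t) + ‖D.C‖ ^ 2 / (2 * α) := by
  have h1 := le_model (D := D) hρ (R.Wb_normal t) (R.P_orthonormal t) (R.master t).1.1
    (zero_mem_modelSet hρ.le _ _)
  rw [R.model_cand hρ hα, sub_zero] at h1
  have h2 := (abs_le.1 (abs_traceInner_le D.C (R.cand t - R.Ω t))).1
  rw [traceInner_sub_right] at h2
  have h3 : ‖D.C‖ * ‖R.cand t - R.Ω t‖ ≤
      ‖D.C‖ ^ 2 / (2 * α) + α / 2 * ‖R.cand t - R.Ω t‖ ^ 2 := by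
    have h4 : ‖D.C‖ ^ 2 / (2 * α) + α / 2 * ‖R.cand t - R.Ω t‖ ^ 2 -
        ‖D.C‖ * ‖R.cand t - R.Ω t‖ = (‖D.C‖ - α * ‖R.cand t - R.Ω t‖) ^ 2 / (2 * α) := by
      field_simp
      ring
    have h5 : 0 ≤ (‖D.C‖ - α * ‖R.cand t - R.Ω t‖) ^ 2 / (2 * α) := by positivity
    linarith
  rw [promise, masterValue, cost_eq]
  linarith

theorem descent_le {t : ℕ} (hβ : 0 < β) (hΩ : R.Ω t ∈ D.affine)
    (h : D.DescentTest ρ β (R.Wb t) (R.P t) (R.Ω t) (R.cand t)) :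
    D.cost ρ (R.cand t) ≤ D.cost ρ (R.Ω t) - β * R.promise t := by
  rw [DescentTest, R.model_cand hρ hα] at h
  have := mul_le_mul_of_nonneg_left (R.promise_bounds hρ hα hΩ).2 hβ.le
  linarith

theorem cost_succ_le (hβ : 0 < β) {t : ℕ} (hΩ : R.Ω t ∈ D.affine) :
    D.cost ρ (R.Ω (t + 1)) ≤ D.cost ρ (R.Ω t) := by
  by_cases h : D.DescentTest ρ β (R.Wb t) (R.P t) (R.Ω t) (R.cand t)
  · have h0 : t = 0 → D.map (R.Ω 0) = D.b := by
      rintro rfl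
      exact hΩ.2
    rw [R.step_descent t h0 h]
    have := mul_nonneg hβ.le (R.promise_nonneg hρ hα hΩ)
    linarith [R.descent_le hρ hα hβ hΩ h]
  · have h0 : t = 0 → D.map (R.Ω 0) = D.b := by
      rintro rfl
      exact hΩ.2
    rw [R.step_null t h0 h]

/-- After a null step the promise drops by a definite amount. The aggregated minorant makes the
master value grow by `α/2 d²`, where `d` is the distance of consecutive candidates, while the new
eigenvectors make it grow by the model error at the old candidate minus `2 G d`. -/
theorem promise_succ_le (hrc : 1 ≤ rc) (hβ : β ≤ 1 / 2) {t : ℕ} (hΩ : R.Ω t ∈ D.affine)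
    (hnull : R.Ω (t + 1) = R.Ω t)
    (h : ¬ D.DescentTest ρ β (R.Wb t) (R.P t) (R.Ω t) (R.cand t)) :
    R.promise (t + 1) ≤ R.promise t -
      min (R.promise t / 4) (α * R.promise t ^ 2 / (128 * (‖D.C‖ + ρ) ^ 2)) := by
  obtain ⟨hb1, hb2⟩ := R.promise_bounds hρ hα hΩ
  have hv0 := R.promise_nonneg hρ hα hΩ
  obtain ⟨G, hG⟩ : ∃ G, G = ‖D.C‖ + ρ := ⟨_, rfl⟩
  have hG0 : 0 < G := by rw [hG]; positivity
  obtain ⟨e, he⟩ : ∃ e, e = D.cost ρ (R.cand t) - traceInner (D.C - R.W t) (R.cand t) := ⟨_, rfl⟩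
  have hev : R.promise t / 2 ≤ e := by
    rw [DescentTest, R.model_cand hρ hα, not_le] at h
    have := mul_le_mul_of_nonneg_right hβ (hv0.trans hb2)
    linarith
  obtain ⟨d, hd⟩ : ∃ d, d = ‖R.cand (t + 1) - R.cand t‖ := ⟨_, rfl⟩
  have hd0 : 0 ≤ d := hd ▸ norm_nonneg _
  have hc := (R.master t).1
  have hc' := (R.master (t + 1)).1
  have hmod := R.model_cand hρ hα (t + 1)
  -- growth through the aggregated minorant
  have hinc1 : R.masterValue t + α / 2 * d ^ 2 ≤ R.masterValue (t + 1) := by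
    have h1 := R.prox_eq hρ hα t hc'
    have h2 := le_model (D := D) hρ (R.Wb_normal (t + 1)) (R.P_orthonormal (t + 1)) hc'.1
      (R.W_mem_succ t)
    rw [hmod] at h2
    rw [← hd] at h1
    have h3 : R.masterValue (t + 1) = traceInner (D.C - R.W (t + 1)) (R.cand (t + 1)) +
        α / 2 * ‖R.cand (t + 1) - R.Ω t‖ ^ 2 := by rw [masterValue, hnull]
    linarith
  -- growth through the new eigenvectors
  have hinc2 : R.masterValue t + e - 2 * G * d ≤ R.masterValue (t + 1) := by
    obtain ⟨Rm, hRm⟩ := R.P_span_V t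
    obtain ⟨W', hW', hcost⟩ := exists_mem_modelSet_cost_le (D := D) hρ (R.Wb (t + 1))
      (R.P_orthonormal (t + 1)) hc.1 hrc (R.V_top t) hRm
    have h1 := le_model (D := D) hρ (R.Wb_normal (t + 1)) (R.P_orthonormal (t + 1)) hc'.1 hW'
    rw [hmod] at h1
    have hCW : ‖D.C - W'‖ ≤ G := by
      rw [hG]
      refine (norm_sub_le _ _).trans (add_le_add le_rfl ?_)
      exact norm_le_of_mem_modelSet (R.Wb_normal (t + 1)) (R.P_orthonormal (t + 1)) hW'
    have h2 : -(G * d) ≤ traceInner (D.C - W') (R.cand (t + 1)) - traceInner (D.C - W') (R.cand t) := by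
      have h3 := (abs_le.1 (abs_traceInner_le (D.C - W') (R.cand (t + 1) - R.cand t))).1
      rw [traceInner_sub_right, ← hd] at h3
      have := mul_le_mul_of_nonneg_right hCW hd0
      linarith
    have h4 : α * ‖R.cand t - R.Ω t‖ ≤ G := by
      have h5 := R.prox_eq hρ hα t hΩ
      rw [sub_self, norm_zero, norm_sub_rev, masterValue] at h5
      have h6 := traceInner_le (D.C - R.W t) (R.Ω t - R.cand t)
      rw [traceInner_sub_right, norm_sub_rev (R.Ω t)] at h6
      have h7 : ‖D.C - R.W t‖ ≤ G := by
        rw [hG]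
        refine (norm_sub_le _ _).trans (add_le_add le_rfl ?_)
        exact norm_le_of_mem_modelSet (R.Wb_normal t) (R.P_orthonormal t) (R.W_mem t)
      have h8 := mul_le_mul_of_nonneg_right h7 (norm_nonneg (R.cand t - R.Ω t))
      rcases (norm_nonneg (R.cand t - R.Ω t)).eq_or_lt with h9 | h9
      · rw [← h9, mul_zero]
        exact hG0.le
      · refine le_of_mul_le_mul_right ?_ h9
        linarith
    have h5 : ‖R.cand t - R.Ω t‖ ^ 2 - 2 * ‖R.cand t - R.Ω t‖ * d ≤
        ‖R.cand (t + 1) - R.Ω t‖ ^ 2 := by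
      have h6 : R.cand (t + 1) - R.Ω t = (R.cand t - R.Ω t) + (R.cand (t + 1) - R.cand t) := by abel
      rw [h6, norm_add_sq_eq, ← hd]
      have h7 := (abs_le.1 (abs_traceInner_le (R.cand t - R.Ω t) (R.cand (t + 1) - R.cand t))).1
      rw [← hd] at h7
      linarith [sq_nonneg d]
    have h6 := mul_le_mul_of_nonneg_left h5 (half_pos hα).le
    have h7 := mul_le_mul_of_nonneg_right h4 hd0
    have h8 : R.masterValue (t + 1) = traceInner (D.C - R.W (t + 1)) (R.cand (t + 1)) +
        α / 2 * ‖R.cand (t + 1) - R.Ω t‖ ^ 2 := by rw [masterValue, hnull]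
    rw [h8, masterValue]
    linarith
  have hmain : min (R.promise t / 4) (α * R.promise t ^ 2 / (128 * G ^ 2)) ≤
      R.masterValue (t + 1) - R.masterValue t := by
    rcases le_or_gt (2 * G * d) (e / 2) with h1 | h1
    · exact (min_le_left _ _).trans (by linarith)
    · refine (min_le_right _ _).trans ?_
      have h2 : R.promise t / (8 * G) ≤ d := by
        rw [div_le_iff₀ (by positivity)]
        linarith
      have h3 : (R.promise t / (8 * G)) ^ 2 ≤ d ^ 2 := pow_le_pow_left₀ (by positivity) h2 2
      have h4 : α * R.promise t ^ 2 / (128 * G ^ 2) = α / 2 * (R.promise t / (8 * G)) ^ 2 := by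
        field_simp
        ring
      have h5 := mul_le_mul_of_nonneg_left h3 (half_pos hα).le
      linarith
  rw [← hG]
  rw [promise, promise, hnull] at *
  linarith

end

end SBMPRun

end SDP

/-! ### A uniform bound on the number of iterations -/

namespace SDP

variable {n m : ℕ} {D : SDP n m}

/-- A potential argument: while `gap t` exceeds `ε`, the potential `Φ` drops by `κ` per step. -/
theorem le_of_potential {gap Φ : ℕ → ℝ} {ε κ Φmax : ℝ} (hκ : 0 < κ) (hanti : Antitone gap)
    (hΦ0 : ∀ j, 0 ≤ Φ j) (hΦmax : Φ 0 ≤ Φmax)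
    (hstep : ∀ j, ε < gap j → Φ (j + 1) ≤ Φ j - κ) {j : ℕ} (hj : Φmax / κ < j) : gap j ≤ ε := by
  by_contra! hgap
  have hall : ∀ i ≤ j, Φ i ≤ Φmax - i * κ := by
    intro i
    induction i with
    | zero => simpa using hΦmax
    | succ i ih =>
      intro hi
      have h1 := ih (Nat.le_of_succ_le hi)
      have h2 := hstep i (hgap.trans_le (hanti (Nat.le_of_succ_le hi)))
      push_cast
      linarith
  have h1 := hall j le_rfl
  have h2 := hΦ0 j
  rw [div_lt_iff₀ hκ] at hj
  linarith

/-- Solving the quadratic inequality for `x`, up to constants. -/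
theorem le_of_mul_sq_le {x r g α : ℝ} (hr : 0 ≤ r) (hg : 0 ≤ g) (hα : 0 < α)
    (h : α / 2 * x ^ 2 ≤ g * x + α / 2 * r ^ 2) : x ≤ r + 2 * g / α := by
  by_contra! hx
  have h0 : 0 ≤ 2 * g / α := by positivity
  have h1 : α / 2 * (r + 2 * g / α) = α / 2 * r + g := by field_simp
  have h2 : 0 < x := by linarith
  have h3 : α / 2 * r + g < α / 2 * x := by
    rw [← h1]
    exact mul_lt_mul_of_pos_left hx (half_pos hα)
  have h4 := mul_lt_mul_of_pos_right h3 h2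
  have h5 : α / 2 * r * r ≤ α / 2 * r * x := by
    refine mul_le_mul_of_nonneg_left (by linarith) (by positivity)
  nlinarith

namespace SBMPRun

/-- The cost after the first iteration is bounded in terms of the starting point, also when the
starting point violates the affine constraint. -/
theorem cost_one_le {ρ α β : ℝ} {rp rc : ℕ} {R : D.SBMPRun ρ α β rp rc} (hρ : 0 < ρ) (hα : 0 < α)
    (hβ : 0 < β) {X₀ : Matrix (Fin n) (Fin n) ℝ} (hX₀ : X₀ ∈ D.affine) :
    D.cost ρ (R.Ω 1) ≤ max (D.cost ρ (R.Ω 0)) (D.cost ρ X₀ +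
      (‖D.C‖ + ρ) * (‖X₀ - R.Ω 0‖ + 2 * (‖D.C‖ + ρ) / α)) := by
  by_cases h0 : D.map (R.Ω 0) = D.b
  · exact le_max_of_le_left (R.cost_succ_le hρ hα hβ ⟨R.init_symm, h0⟩)
  · refine le_max_of_le_right ?_
    rw [R.step_affine h0]
    have hc := (R.master 0).1
    have h1 := R.prox_eq hρ hα 0 hX₀
    have h2 := traceInner_le (D.C - R.W 0) (X₀ - R.cand 0)
    rw [traceInner_sub_right] at h2
    have h3 : ‖D.C - R.W 0‖ ≤ ‖D.C‖ + ρ :=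
      (norm_sub_le _ _).trans (add_le_add le_rfl
        (norm_le_of_mem_modelSet (R.Wb_normal 0) (R.P_orthonormal 0) (R.W_mem 0)))
    have h4 := mul_le_mul_of_nonneg_right h3 (norm_nonneg (X₀ - R.cand 0))
    have h5 : 0 ≤ α / 2 * ‖R.cand 0 - R.Ω 0‖ ^ 2 := by positivity
    have h6 : ‖X₀ - R.cand 0‖ ≤ ‖X₀ - R.Ω 0‖ + 2 * (‖D.C‖ + ρ) / α := by
      refine le_of_mul_sq_le (norm_nonneg _) (by positivity) hα ?_
      rw [masterValue] at h1
      linarith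
    have h7 := cost_le_add_norm (D := D) hρ.le hX₀.1 hc.1
    rw [norm_sub_rev] at h7
    have h8 := mul_le_mul_of_nonneg_left h6 (by positivity : 0 ≤ ‖D.C‖ + ρ)
    linarith

end SBMPRun

/-- After a number of iterations that does not depend on the run, the cost gap of the reference
points is at most `ε`. -/
theorem exists_iteration_bound {ρ α β : ℝ} (hρ : 0 < ρ) (hα : 0 < α) (hβ : 0 < β)
    (hβ2 : β ≤ 1 / 2) {X₀ : Matrix (Fin n) (Fin n) ℝ} (hX₀ : X₀ ∈ D.affine) {a B : ℝ} (ha : 0 < a)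
    (hcoer : ∀ X ∈ D.affine, a * ‖X‖ ≤ D.cost ρ X + B)
    (hmin : ∀ X ∈ D.affine, D.cost ρ X₀ ≤ D.cost ρ X) (Ω₀ : Matrix (Fin n) (Fin n) ℝ) {ε : ℝ}
    (hε : 0 < ε) : ∃ N : ℕ, 0 < N ∧ ∀ rp rc : ℕ, 1 ≤ rc → ∀ R : D.SBMPRun ρ α β rp rc,
      R.Ω 0 = Ω₀ → ∀ t, N ≤ t → D.cost ρ (R.Ω t) - D.cost ρ X₀ ≤ ε := by
  obtain ⟨M, hM⟩ : ∃ M, M = max (D.cost ρ Ω₀) (D.cost ρ X₀ +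
      (‖D.C‖ + ρ) * (‖X₀ - Ω₀‖ + 2 * (‖D.C‖ + ρ) / α)) := ⟨_, rfl⟩
  -- radius of the level set, and the resulting bounds on the promise
  obtain ⟨r, hr⟩ : ∃ r, r = |(M + B) / a| + ‖X₀‖ + 1 := ⟨_, rfl⟩
  have hr0 : 0 < r := by rw [hr]; positivity
  obtain ⟨s, hs⟩ : ∃ s, s = min 1 (ε / (α * r ^ 2)) := ⟨_, rfl⟩
  have hs0 : 0 < s := by rw [hs]; exact lt_min one_pos (by positivity)
  have hs1 : s ≤ 1 := by rw [hs]; exact min_le_left _ _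
  have hsr : α * r ^ 2 * s ≤ ε := by
    have := min_le_right 1 (ε / (α * r ^ 2))
    rw [← hs, le_div_iff₀ (by positivity)] at this
    linarith
  obtain ⟨v, hv⟩ : ∃ v, v = s * ε / 2 := ⟨_, rfl⟩
  have hv0 : 0 < v := by rw [hv]; positivity
  obtain ⟨Bv, hBv⟩ : ∃ Bv, Bv = ρ * r + ‖D.C‖ ^ 2 / (2 * α) := ⟨_, rfl⟩
  have hBv0 : 0 ≤ Bv := by rw [hBv]; positivity
  obtain ⟨κ, hκ⟩ : ∃ κ, κ = min (v / 4) (α * v ^ 2 / (128 * (‖D.C‖ + ρ) ^ 2)) := ⟨_, rfl⟩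
  have hκ0 : 0 < κ := by rw [hκ]; exact lt_min (by positivity) (by positivity)
  obtain ⟨K, hK⟩ : ∃ K, K = (Bv + κ) / (β * v) := ⟨_, rfl⟩
  have hK0 : 0 ≤ K := by rw [hK]; positivity
  have hKv : K * (β * v) = Bv + κ := by rw [hK]; field_simp
  obtain ⟨j₀, hj₀⟩ := exists_nat_gt ((K * (M - D.cost ρ X₀) + Bv) / κ)
  refine ⟨j₀ + 1, Nat.succ_pos _, fun rp rc hrc R hR t ht => ?_⟩
  obtain ⟨j, rfl⟩ : ∃ j, t = j + 1 := ⟨t - 1, by omega⟩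
  have haff : ∀ j, R.Ω (j + 1) ∈ D.affine := R.Ω_succ_mem_affine
  have hanti : Antitone fun j => D.cost ρ (R.Ω (j + 1)) - D.cost ρ X₀ :=
    antitone_nat_of_succ_le fun j => by
      linarith [R.cost_succ_le hρ hα hβ (haff j)]
  have hfirst : D.cost ρ (R.Ω 1) ≤ M := by
    rw [hM, ← hR]
    exact R.cost_one_le hρ hα hβ hX₀
  have hnorm : ∀ j, ‖R.Ω (j + 1)‖ ≤ |(M + B) / a| := by
    intro j
    refine le_trans ?_ (le_abs_self _)
    rw [le_div_iff₀ ha]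
    have h1 : D.cost ρ (R.Ω (j + 1)) - D.cost ρ X₀ ≤ D.cost ρ (R.Ω (0 + 1)) - D.cost ρ X₀ :=
      hanti (Nat.zero_le j)
    rw [zero_add] at h1
    linarith [hcoer _ (haff j)]
  have hpB : ∀ j, R.promise (j + 1) ≤ Bv := by
    intro j
    refine (R.promise_le hρ hα (j + 1)).trans ?_
    have h1 : psdDefect (R.Ω (j + 1)) ≤ r := by
      have h2 := psdDefect_le_norm (haff j).1
      have h3 := norm_nonneg X₀
      linarith [hnorm j]
    rw [hBv]
    have := mul_le_mul_of_nonneg_left h1 hρ.le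
    linarith
  have hpv : ∀ j, ε < D.cost ρ (R.Ω (j + 1)) - D.cost ρ X₀ → v ≤ R.promise (j + 1) := by
    intro j hj
    refine le_trans ?_ (R.le_promise hρ hα (haff j) hX₀ hs0.le hs1)
    have h1 : ‖X₀ - R.Ω (j + 1)‖ ≤ r := by
      have h2 := norm_sub_le X₀ (R.Ω (j + 1))
      linarith [hnorm j]
    have h2 : ‖X₀ - R.Ω (j + 1)‖ ^ 2 ≤ r ^ 2 := pow_le_pow_left₀ (norm_nonneg _) h1 2
    have h3 := mul_le_mul_of_nonneg_left h2 (by positivity : 0 ≤ α / 2 * s ^ 2)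
    have h4 := mul_le_mul_of_nonneg_left hsr hs0.le
    have h5 := mul_le_mul_of_nonneg_left hj.le hs0.le
    rw [hv]
    linarith
  refine le_of_potential (Φ := fun j => K * (D.cost ρ (R.Ω (j + 1)) - D.cost ρ X₀) +
      R.promise (j + 1)) hκ0 hanti ?_ ?_ ?_ (j := j)
      (hj₀.trans_le (by exact_mod_cast Nat.le_of_succ_le_succ ht))
  · intro j
    exact add_nonneg (mul_nonneg hK0 (sub_nonneg.2 (hmin _ (haff j))))
      (R.promise_nonneg hρ hα (haff j))
  · have := mul_le_mul_of_nonneg_left hfirst hK0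
    have h2 := hpB 0
    simp only [zero_add] at h2 ⊢
    linarith
  · intro j hj
    have hvj := hpv j hj
    by_cases hdt : D.DescentTest ρ β (R.Wb (j + 1)) (R.P (j + 1)) (R.Ω (j + 1)) (R.cand (j + 1))
    · have h1 := R.descent_le hρ hα hβ (haff j) hdt
      rw [← R.step_descent (j + 1) (by simp) hdt] at h1
      have h2 := mul_le_mul_of_nonneg_left hvj hβ.le
      have h3 : K * D.cost ρ (R.Ω (j + 1 + 1)) ≤ K * (D.cost ρ (R.Ω (j + 1)) - β * v) :=
        mul_le_mul_of_nonneg_left (by linarith) hK0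
      have h4 := hpB (j + 1)
      linarith
    · have hnull := R.step_null (j + 1) (by simp) hdt
      have h1 := R.promise_succ_le hρ hα hrc hβ2 (haff j) hnull hdt
      have h2 : κ ≤ min (R.promise (j + 1) / 4)
          (α * R.promise (j + 1) ^ 2 / (128 * (‖D.C‖ + ρ) ^ 2)) := by
        rw [hκ]
        refine min_le_min (by linarith) ?_
        refine div_le_div_of_nonneg_right ?_ (by positivity)
        exact mul_le_mul_of_nonneg_left (pow_le_pow_left₀ hv0.le hvj 2) hα.le
      rw [hnull]
      linarith

/-! ### Near the solution set every step is a descent step -/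

theorem trace_compression_eq_sum {n k : ℕ} {Xh Q : Matrix (Fin n) (Fin n) ℝ} {d : Fin n → ℝ}
    (hQ : IsSpectralDecomposition (-Xh) Q d) (h : k ≤ n) :
    ((Q.submatrix id (Fin.castLE h))ᵀ * (-Xh) * Q.submatrix id (Fin.castLE h)).trace =
      ∑ j : Fin k, d (Fin.castLE h j) := by
  obtain ⟨hQ1, -, hXh⟩ := hQ
  have h1 : (Q.submatrix id (Fin.castLE h))ᵀ * (-Xh) * Q.submatrix id (Fin.castLE h) =
      (Qᵀ * (-Xh) * Q).submatrix (Fin.castLE h) (Fin.castLE h) := by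
    rw [Matrix.submatrix_mul _ _ _ id _ Function.bijective_id,
      Matrix.submatrix_mul _ _ _ id _ Function.bijective_id, Matrix.transpose_submatrix,
      Matrix.submatrix_id_id]
  have h2 : Qᵀ * (-Xh) * Q = diagonal d := by
    rw [hXh]
    calc Qᵀ * (Q * diagonal d * Qᵀ) * Q = (Qᵀ * Q) * diagonal d * (Qᵀ * Q) := by
          simp only [Matrix.mul_assoc]
      _ = diagonal d := by rw [hQ1, Matrix.one_mul, Matrix.mul_one]
  rw [h1, h2]
  simp [Matrix.trace]

/-- Near the primal solution set, all but the `maxNullity` largest eigenvalues of `-Xh` are bounded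
away from `0`. -/
theorem eigenvalue_le_neg {c : ℝ}
    (hc : ∀ X ∈ D.primalOpt, ∀ V : Matrix (Fin n) (Fin (D.maxNullity + 1)) ℝ, Vᵀ * V = 1 →
      c ≤ (Vᵀ * X * V).trace) {X Xh Q : Matrix (Fin n) (Fin n) ℝ} {d : Fin n → ℝ}
    (hX : X ∈ D.primalOpt) (hnear : ‖Xh - X‖ ≤ c / (2 * (D.maxNullity + 1)))
    (hQ : IsSpectralDecomposition (-Xh) Q d) (j : Fin n) (hj : D.maxNullity ≤ j) :
    d j ≤ -(c / (2 * (D.maxNullity + 1))) := by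
  have hk : D.maxNullity + 1 ≤ n := by omega
  obtain ⟨V, hV⟩ : ∃ V, V = Q.submatrix id (Fin.castLE hk) := ⟨_, rfl⟩
  have hV1 : Vᵀ * V = 1 := hV ▸ transpose_mul_submatrix_castLE hQ.1 hk
  have h1 := hc X hX V hV1
  have h2 := trace_compression_eq_sum hQ hk
  rw [← hV] at h2
  have h3 : ((D.maxNullity : ℝ) + 1) * d j ≤ ∑ i : Fin (D.maxNullity + 1), d (Fin.castLE hk i) := by
    have : ∀ i ∈ Finset.univ, d j ≤ d (Fin.castLE hk (i : Fin (D.maxNullity + 1))) := by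
      intro i _
      refine hQ.2.1 (Fin.le_def.2 ?_)
      have := i.2
      simp only [Fin.val_castLE]
      omega
    have := Finset.card_nsmul_le_sum _ _ _ this
    simpa using this
  have h4 : (Vᵀ * X * V).trace = (Vᵀ * (X - Xh) * V).trace - (Vᵀ * (-Xh) * V).trace := by
    rw [← Matrix.trace_sub, ← Matrix.sub_mul, ← Matrix.mul_sub]
    congr 3
    abel
  have h5 : (Vᵀ * (X - Xh) * V).trace ≤ (D.maxNullity + 1) * ‖Xh - X‖ := by
    have h6 : (Vᵀ * (X - Xh) * V).trace = traceInner (V * Vᵀ) (X - Xh) := by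
      have := traceInner_mul_mul_transpose V (1 : Matrix (Fin (D.maxNullity + 1)) _ ℝ) (X - Xh)
      rw [Matrix.mul_one, traceInner_comm 1, traceInner_one_right, ← Matrix.trace_transpose] at this
      rw [this, Matrix.trace_transpose]
    rw [h6, norm_sub_rev]
    refine (traceInner_le _ _).trans (mul_le_mul_of_nonneg_right ?_ (norm_nonneg _))
    have hVV : (V * Vᵀ).PosSemidef := by
      simpa using posSemidef_mul_mul_transpose V (PosSemidef.one (n := Fin (D.maxNullity + 1)) (R := ℝ))
    refine hVV.norm_le_trace.trans ?_
    rw [Matrix.trace_mul_comm, hV1]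
    simp
  have hk0 : (0 : ℝ) < D.maxNullity + 1 := by positivity
  have h7 := mul_le_mul_of_nonneg_left hnear hk0.le
  have h8 : ((D.maxNullity : ℝ) + 1) * (c / (2 * (D.maxNullity + 1))) = c / 2 := by
    field_simp
  refine le_of_mul_le_mul_left ?_ hk0
  rw [mul_neg, h8]
  linarith

namespace SBMPRun

variable {ρ α β : ℝ} {rp rc : ℕ} {R : D.SBMPRun ρ α β rp rc}

theorem descentTest_of_accurate (hρ : 0 < ρ) (hα : 0 < α) (hβ2 : β ≤ 1 / 2) {t : ℕ}
    (hΩ : R.Ω t ∈ D.affine) (hacc : D.cost ρ (R.cand t) ≤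
      D.model ρ (R.Wb t) (R.P t) (R.cand t) + α / 2 * ‖R.cand t - R.Ω t‖ ^ 2) :
    D.DescentTest ρ β (R.Wb t) (R.P t) (R.Ω t) (R.cand t) := by
  have h1 := R.prox_eq hρ hα t hΩ
  have h2 := R.minorant_le_cost hρ t hΩ.1
  rw [sub_self, norm_zero, norm_sub_rev, masterValue] at h1
  rw [DescentTest, R.model_cand hρ hα]
  rw [R.model_cand hρ hα] at hacc
  have h3 : 0 ≤ α / 2 * ‖R.cand t - R.Ω t‖ ^ 2 := by positivity
  have h4 := mul_le_mul_of_nonneg_right hβ2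
    (by linarith : 0 ≤ D.cost ρ (R.Ω t) - traceInner (D.C - R.W t) (R.cand t))
  linarith

/-- Suppose that top eigenvectors at points with cost gap at most `ε` make the model accurate up
to `α/2` times the squared distance. Then, once the gap of the reference point is at most `ε`, the
model is accurate around the reference point: either that point is the last candidate, whose
eigenvectors were just added, or it was kept by a null step, which accuracy of the previous model
excludes. -/
theorem accurate_of_gap_le (hρ : 0 < ρ) (hα : 0 < α) (hβ2 : β ≤ 1 / 2) {δ f ε : ℝ}
    (hδ : 0 < δ) (hαδ : ρ * (6 / δ) ≤ α / 2) (hrc : D.maxNullity ≤ rc)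
    (hsep : ∀ Xh ∈ D.affine, D.cost ρ Xh - f ≤ ε → ∀ (Q : Matrix (Fin n) (Fin n) ℝ)
      (d : Fin n → ℝ), IsSpectralDecomposition (-Xh) Q d →
        ∀ j : Fin n, D.maxNullity ≤ j → d j ≤ -δ) :
    ∀ t, R.Ω t ∈ D.affine → D.cost ρ (R.Ω t) - f ≤ ε → ∀ X : Matrix (Fin n) (Fin n) ℝ, X.IsSymm →
      D.cost ρ X ≤ D.model ρ (R.Wb t) (R.P t) X + α / 2 * ‖X - R.Ω t‖ ^ 2 := by
  intro t
  induction t with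
  | zero =>
    intro hΩ hg X hX
    obtain ⟨h, Q, d, hQ, hP⟩ := R.init_P
    have h1 := cost_le_model_add (D := D) hρ hδ (R.Wb_normal 0) (R.P_orthonormal 0) hX hQ h hP
      (R := 1) (by rw [Matrix.mul_one])
      fun j hj => hsep _ hΩ hg Q d hQ j (by omega)
    have h2 := mul_le_mul_of_nonneg_right hαδ (sq_nonneg ‖X - R.Ω 0‖)
    linarith
  | succ t ih =>
    intro hΩ hg X hX
    have hcand : R.Ω (t + 1) = R.cand t := by
      rcases R.Ω_succ t with h | ⟨h, h0, hnd⟩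
      · exact h
      · rw [h] at hΩ hg
        exact absurd (R.descentTest_of_accurate hρ hα hβ2 hΩ
          (ih hΩ hg _ (R.master t).1.1)) hnd
    rw [hcand] at hΩ hg ⊢
    obtain ⟨h, Q, d, hQ, hV⟩ := R.V_top t
    obtain ⟨Rm, hRm⟩ := R.P_span_V t
    have h1 := cost_le_model_add (D := D) hρ hδ (R.Wb_normal (t + 1)) (R.P_orthonormal (t + 1)) hX
      hQ h hV hRm fun j hj => hsep _ hΩ hg Q d hQ j (by omega)
    have h2 := mul_le_mul_of_nonneg_right hαδ (sq_nonneg ‖X - R.cand t‖)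
    linarith

end SBMPRun

end SDP

/-! ### Linear convergence of exact proximal steps -/

namespace SDP

variable {n m : ℕ} {D : SDP n m}

theorem sq_mul_infDist_le {ρ μ f : ℝ} (hμ : 0 < μ)
    (hgrow : ∀ X ∈ D.affine, D.cost ρ X - f ≤ 1 →
      ∃ X' ∈ D.primalOpt, μ * ‖X - X'‖ ^ 2 ≤ D.cost ρ X - f)
    {X : Matrix (Fin n) (Fin n) ℝ} (hX : X ∈ D.affine) (hg : D.cost ρ X - f ≤ 1) :
    μ * Metric.infDist X D.primalOpt ^ 2 ≤ D.cost ρ X - f := by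
  obtain ⟨X', hX', h⟩ := hgrow X hX hg
  have h1 : Metric.infDist X D.primalOpt ≤ ‖X - X'‖ := by
    rw [← dist_eq_norm]
    exact Metric.infDist_le_dist_of_mem hX'
  have h2 := pow_le_pow_left₀ Metric.infDist_nonneg h1 2
  have h3 := mul_le_mul_of_nonneg_left h2 hμ.le
  linarith

/-- Compare the proximal step with the projection of `Ω` onto the solution set. -/
theorem infDist_le_of_prox {ρ α μ f : ℝ} (hα : 0 < α) (hμ : 0 < μ) (hK : IsCompact D.primalOpt)
    (hne : D.primalOpt.Nonempty) (hf : ∀ X ∈ D.primalOpt, D.cost ρ X = f)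
    {Ω c : Matrix (Fin n) (Fin n) ℝ}
    (hgrow : μ * Metric.infDist c D.primalOpt ^ 2 ≤ D.cost ρ c - f)
    (hprox : ∀ X ∈ D.affine, D.cost ρ c ≤
      D.cost ρ X + α / 2 * ‖X - Ω‖ ^ 2 - α / 2 * ‖X - c‖ ^ 2) :
    Metric.infDist c D.primalOpt ≤ √(α / (α + 2 * μ)) * Metric.infDist Ω D.primalOpt := by
  obtain ⟨X, hX, hd⟩ := hK.exists_infDist_eq_dist hne Ω
  have h1 := hprox X (mem_affine_of_mem_primalOpt hX)
  rw [hf X hX, norm_sub_rev X Ω, ← dist_eq_norm Ω X, ← hd, norm_sub_rev, ← dist_eq_norm] at h1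
  have h2 : Metric.infDist c D.primalOpt ≤ dist c X := Metric.infDist_le_dist_of_mem hX
  have h3 := pow_le_pow_left₀ Metric.infDist_nonneg h2 2
  have h4 := mul_le_mul_of_nonneg_left h3 (half_pos hα).le
  refine abs_le_of_sq_le_sq' ?_ (mul_nonneg (Real.sqrt_nonneg _) Metric.infDist_nonneg) |>.2
  rw [mul_pow, Real.sq_sqrt (by positivity), div_mul_eq_mul_div, le_div_iff₀ (by positivity)]
  linarith

/-- Compare the proximal step with the point at relative distance `s = min {1, μ/α}` on the
segment from `Ω` to its projection onto the solution set. -/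
theorem gap_le_of_prox {ρ α μ f : ℝ} (hρ : 0 < ρ) (hα : 0 < α) (hμ : 0 < μ)
    (hK : IsCompact D.primalOpt) (hne : D.primalOpt.Nonempty)
    (hf : ∀ X ∈ D.primalOpt, D.cost ρ X = f) {Ω c : Matrix (Fin n) (Fin n) ℝ} (hΩ : Ω ∈ D.affine)
    (hgrow : μ * Metric.infDist Ω D.primalOpt ^ 2 ≤ D.cost ρ Ω - f)
    (hprox : ∀ X ∈ D.affine, D.cost ρ c ≤
      D.cost ρ X + α / 2 * ‖X - Ω‖ ^ 2 - α / 2 * ‖X - c‖ ^ 2) :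
    D.cost ρ c - f ≤ (1 - min 1 (μ / α) / 2) * (D.cost ρ Ω - f) := by
  obtain ⟨X, hX, hd⟩ := hK.exists_infDist_eq_dist hne Ω
  obtain ⟨s, hs⟩ : ∃ s, s = min 1 (μ / α) := ⟨_, rfl⟩
  have hs0 : 0 < s := by rw [hs]; exact lt_min one_pos (by positivity)
  have hs1 : s ≤ 1 := by rw [hs]; exact min_le_left _ _
  have hs2 : α * s ≤ μ := by
    have := min_le_right 1 (μ / α)
    rw [← hs, le_div_iff₀ hα] at this
    linarith
  rw [← hs]
  have hXa := mem_affine_of_mem_primalOpt hX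
  have h1 := hprox _ (convex_affine hΩ hXa (by linarith : 0 ≤ 1 - s) hs0.le (by ring))
  have h2 := cost_convex (D := D) hρ.le hΩ.1 hXa.1 (a := 1 - s) (b := s) (by linarith) hs0.le
  have h3 : (1 - s) • Ω + s • X - Ω = s • (X - Ω) := by module
  rw [h3, norm_smul, mul_pow, Real.norm_eq_abs, sq_abs, norm_sub_rev X Ω, ← dist_eq_norm Ω X,
    ← hd] at h1
  rw [hf X hX] at h2
  have h4 : 0 ≤ α / 2 * ‖(1 - s) • Ω + s • X - c‖ ^ 2 := by positivity
  have h5 : α * s * Metric.infDist Ω D.primalOpt ^ 2 ≤ D.cost ρ Ω - f :=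
    (mul_le_mul_of_nonneg_right hs2 (sq_nonneg _)).trans hgrow
  have h6 := mul_le_mul_of_nonneg_left h5 hs0.le
  linarith

theorem norm_sub_sq_le_of_prox {ρ α : ℝ} {Ω c : Matrix (Fin n) (Fin n) ℝ}
    (hΩ : Ω ∈ D.affine) (hprox : ∀ X ∈ D.affine, D.cost ρ c ≤
      D.cost ρ X + α / 2 * ‖X - Ω‖ ^ 2 - α / 2 * ‖X - c‖ ^ 2) :
    α / 2 * ‖c - Ω‖ ^ 2 ≤ D.cost ρ Ω - D.cost ρ c := by
  have h1 := hprox Ω hΩ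
  rw [sub_self, norm_zero, norm_sub_rev] at h1
  linarith

/-- A sequence with geometrically decreasing steps and distances to a compact set converges
geometrically to a point of the set. -/
theorem exists_limit_of_geometric {S : Set (Matrix (Fin n) (Fin n) ℝ)} (hS : IsCompact S)
    (hne : S.Nonempty) {u : ℕ → Matrix (Fin n) (Fin n) ℝ} {q C : ℝ} (hq0 : 0 < q) (hq1 : q < 1)
    (hstep : ∀ k, ‖u (k + 1) - u k‖ ≤ C * q ^ k)
    (hdist : ∀ k, Metric.infDist (u (k + 1)) S ≤ q * Metric.infDist (u k) S) :
    ∃ X ∈ S, ∀ k, ‖u k - X‖ ≤ C / (1 - q) * q ^ k := by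
  have : ProperSpace (Matrix (Fin n) (Fin n) ℝ) := FiniteDimensional.proper_real _
  have hstep' : ∀ k, dist (u k) (u (k + 1)) ≤ C * q ^ k := fun k => by
    rw [dist_comm, dist_eq_norm]
    exact hstep k
  obtain ⟨X, hX⟩ := cauchySeq_tendsto_of_complete (cauchySeq_of_le_geometric q C hq1 hstep')
  have hpow : ∀ k, Metric.infDist (u k) S ≤ Metric.infDist (u 0) S * q ^ k := by
    intro k
    induction k with
    | zero => simp
    | succ k ih =>
      refine (hdist k).trans ?_
      have := mul_le_mul_of_nonneg_left ih hq0.le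
      rw [pow_succ]
      linarith
  have hlim0 : Filter.Tendsto (fun k => Metric.infDist (u k) S) Filter.atTop (nhds 0) := by
    refine squeeze_zero (fun k => Metric.infDist_nonneg) hpow ?_
    simpa using (tendsto_pow_atTop_nhds_zero_of_lt_one hq0.le hq1).const_mul
      (Metric.infDist (u 0) S)
  have hlim := ((Metric.continuous_infDist_pt S).tendsto X).comp hX
  have h0 : Metric.infDist X S = 0 := tendsto_nhds_unique hlim hlim0
  refine ⟨X, (hS.isClosed.mem_iff_infDist_zero hne).2 h0, fun k => ?_⟩
  have := dist_le_of_le_geometric_of_tendsto q C hq1 hstep' hX k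
  rw [dist_eq_norm] at this
  rwa [div_mul_eq_mul_div]

/-! ### Accuracy of the primal-dual iterates -/

theorem neg_le_lambdaMin_of_near {X Y : Matrix (Fin n) (Fin n) ℝ} (hX : X.IsSymm)
    (hY : Y.PosSemidef) {e : ℝ} (he : ‖X - Y‖ ≤ e) : -e ≤ lambdaMin X := by
  have he0 : 0 ≤ e := (norm_nonneg _).trans he
  refine neg_le_lambdaMin he0 (posSemidef_add_smul_one hX fun w => ?_)
  have h1 := quad_ge_neg_psdDefect hX w
  have h2 := psdDefect_le_add_norm hY.isSymm hX
  rw [psdDefect_eq_zero hY, zero_add] at h2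
  have h3 := mul_le_mul_of_nonneg_right (h2.trans he) (dotProduct_self_nonneg_real w)
  linarith

namespace SBMPRun

variable {ρ α β : ℝ} {rp rc : ℕ} {R : D.SBMPRun ρ α β rp rc}

theorem norm_dual_residual (hρ : 0 < ρ) (hα : 0 < α) (t : ℕ) :
    ‖R.W t + D.adj (R.y t) - D.C‖ = α * ‖R.cand t - R.Ω t‖ := by
  have h1 : R.W t + D.adj (R.y t) - D.C = R.W t - D.C + D.adj (R.y t) := by abel
  rw [h1, ← R.cand_sub_eq hρ hα t, norm_smul, Real.norm_of_nonneg hα.le]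

theorem abs_duality_gap_le (hρ : 0 < ρ) (hα : 0 < α) {t : ℕ} (hΩ : R.Ω t ∈ D.affine)
    {X : Matrix (Fin n) (Fin n) ℝ} (hX : X.PosSemidef) {e₁ e₂ r : ℝ}
    (h₁ : ‖R.cand t - X‖ ≤ e₁) (h₂ : ‖R.cand t - R.Ω t‖ ≤ e₂) (hr : ‖R.Ω t‖ ≤ r) :
    |traceInner D.C (R.Ω t) - D.b ⬝ᵥ R.y t| ≤ ρ * e₁ + ρ * e₂ + α * e₂ * r := by
  have hc := (R.master t).1
  have hWm := R.W_mem t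
  have heq : traceInner D.C (R.Ω t) - D.b ⬝ᵥ R.y t =
      traceInner (R.W t) (R.cand t) - traceInner (R.W t) (R.cand t - R.Ω t)
        - α * traceInner (R.cand t - R.Ω t) (R.Ω t) := by
    have h3 : D.C = R.W t + D.adj (R.y t) - α • (R.cand t - R.Ω t) := by
      rw [R.cand_sub_eq hρ hα t]
      abel
    nth_rewrite 1 [h3]
    rw [traceInner_sub_left, traceInner_add_left, traceInner_adj, hΩ.2, traceInner_smul_left,
      traceInner_sub_right (R.W t), dotProduct_comm D.b]
    ring
  have hW : ‖R.W t‖ ≤ ρ := norm_le_of_mem_modelSet (R.Wb_normal t) (R.P_orthonormal t) hWm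
  -- `W` maximizes over the model, which contains `0`
  have hWc : |traceInner (R.W t) (R.cand t)| ≤ ρ * e₁ := by
    have h3 := le_model (D := D) hρ (R.Wb_normal t) (R.P_orthonormal t) hc.1
      (zero_mem_modelSet hρ.le _ _)
    rw [R.model_cand hρ hα, sub_zero, traceInner_sub_left] at h3
    have h4 := R.minorant_le_cost hρ t hc.1
    rw [traceInner_sub_left, cost_eq] at h4
    have h5 := psdDefect_le_add_norm hX.isSymm hc.1
    rw [psdDefect_eq_zero hX, zero_add] at h5
    have h6 := mul_le_mul_of_nonneg_left (h5.trans h₁) hρ.le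
    rw [abs_le]
    constructor <;> linarith
  have h7 : |traceInner (R.W t) (R.cand t - R.Ω t)| ≤ ρ * e₂ :=
    (abs_traceInner_le _ _).trans (mul_le_mul hW h₂ (norm_nonneg _) hρ.le)
  have h8 : |α * traceInner (R.cand t - R.Ω t) (R.Ω t)| ≤ α * e₂ * r := by
    rw [abs_mul, abs_of_pos hα, mul_assoc]
    refine mul_le_mul_of_nonneg_left ((abs_traceInner_le _ _).trans ?_) hα.le
    exact mul_le_mul h₂ hr (norm_nonneg _) ((norm_nonneg _).trans h₂)
  rw [heq]
  rw [abs_le] at *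
  constructor <;> linarith [h7.1, h7.2, h8.1, h8.2, hWc.1, hWc.2]

end SBMPRun

/-- A geometric sequence falls below `min ε 1` within `O(max {1, log (1/ε)})` steps. -/
theorem exists_pow_le {A q ε : ℝ} (hA : 1 ≤ A) (hq0 : 0 < q) (hq1 : q < 1) (hε : 0 < ε) :
    ∃ k : ℕ, (k : ℝ) ≤ ((Real.log A + 1) / Real.log (1 / q) + 1) * max 1 (Real.log (1 / ε)) ∧
      A * q ^ k ≤ min ε 1 := by
  have hl : 0 < Real.log (1 / q) := Real.log_pos (by rw [lt_div_iff₀ hq0]; linarith)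
  have hlA : 0 ≤ Real.log A := Real.log_nonneg hA
  obtain ⟨M, hM⟩ : ∃ M, M = max 1 (Real.log (1 / ε)) := ⟨_, rfl⟩
  have hM1 : 1 ≤ M := by rw [hM]; exact le_max_left _ _
  have hM2 : Real.log (1 / ε) ≤ M := by rw [hM]; exact le_max_right _ _
  have hx0 : 0 ≤ (Real.log A + M) / Real.log (1 / q) := by positivity
  refine ⟨⌈(Real.log A + M) / Real.log (1 / q)⌉₊, ?_, ?_⟩
  · refine (Nat.ceil_lt_add_one hx0).le.trans ?_
    rw [← hM]
    have h1 : (Real.log A + M) / Real.log (1 / q) ≤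
        (Real.log A + 1) / Real.log (1 / q) * M := by
      rw [div_mul_eq_mul_div]
      refine div_le_div_of_nonneg_right ?_ hl.le
      nlinarith
    linarith
  · have h1 := Nat.le_ceil ((Real.log A + M) / Real.log (1 / q))
    rw [div_le_iff₀ hl] at h1
    generalize ⌈(Real.log A + M) / Real.log (1 / q)⌉₊ = k at h1
    have hpos : 0 < A * q ^ k := by positivity
    have h2 : Real.log (A * q ^ k) ≤ -M := by
      rw [Real.log_mul (by positivity) (by positivity), Real.log_pow]
      rw [one_div, Real.log_inv] at h1
      linarith
    refine le_min ?_ ?_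
    · rw [← Real.log_le_log_iff hpos hε]
      rw [one_div, Real.log_inv] at hM2
      linarith
    · rw [← Real.log_le_log_iff hpos one_pos, Real.log_one]
      linarith

end SDP

/-! ### The tail of a run -/

namespace SDP

variable {n m : ℕ} {D : SDP n m}

/-- Consequences of performing, from iteration `T` on, descent steps that are at least as good as
proximal steps for the true cost. The rate `q` dominates the contraction factor of the distance, and
`q ^ 2` that of the cost gap, as the step lengths decay like the square root of the gap. -/
theorem SBMPRun.tail_convergence {ρ α β μ f q : ℝ} {rp rc T : ℕ} {R : D.SBMPRun ρ α β rp rc}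
    (hρ : 0 < ρ) (hα : 0 < α) (hμ : 0 < μ) (hK : IsCompact D.primalOpt)
    (hne : D.primalOpt.Nonempty) (hf : ∀ X ∈ D.primalOpt, D.cost ρ X = f)
    (hgrow : ∀ X ∈ D.affine, D.cost ρ X - f ≤ 1 →
      ∃ X' ∈ D.primalOpt, μ * ‖X - X'‖ ^ 2 ≤ D.cost ρ X - f)
    (hq0 : 0 < q) (hq1 : q < 1) (hqd : √(α / (α + 2 * μ)) ≤ q)
    (hqg : 1 - min 1 (μ / α) / 2 ≤ q ^ 2) (haff : ∀ t, T ≤ t → R.Ω t ∈ D.affine)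
    (hgap : ∀ t, T ≤ t → D.cost ρ (R.Ω t) - f ≤ 1)
    (hprox : ∀ t, T ≤ t → ∀ X ∈ D.affine, D.cost ρ (R.Ω (t + 1)) ≤
      D.cost ρ X + α / 2 * ‖X - R.Ω t‖ ^ 2 - α / 2 * ‖X - R.Ω (t + 1)‖ ^ 2) :
    (∀ t, T ≤ t → D.cost ρ (R.Ω (t + 1)) - f ≤ q * (D.cost ρ (R.Ω t) - f) ∧
      Metric.infDist (R.Ω (t + 1)) D.primalOpt ≤ q * Metric.infDist (R.Ω t) D.primalOpt) ∧
    (∀ k, D.cost ρ (R.Ω (T + k)) - f ≤ q ^ k) ∧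
    (∀ k, ‖R.Ω (T + k + 1) - R.Ω (T + k)‖ ≤ √(2 / α) * q ^ k) ∧
    ∃ X ∈ D.primalOpt, ∀ k, ‖R.Ω (T + k) - X‖ ≤ √(2 / α) / (1 - q) * q ^ k := by
  have hg : ∀ t, T ≤ t → μ * Metric.infDist (R.Ω t) D.primalOpt ^ 2 ≤ D.cost ρ (R.Ω t) - f :=
    fun t ht => sq_mul_infDist_le hμ hgrow (haff t ht) (hgap t ht)
  have hg0 : ∀ t, T ≤ t → 0 ≤ D.cost ρ (R.Ω t) - f :=
    fun t ht => le_trans (by positivity) (hg t ht)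
  have hdist : ∀ t, T ≤ t → Metric.infDist (R.Ω (t + 1)) D.primalOpt ≤
      q * Metric.infDist (R.Ω t) D.primalOpt := fun t ht =>
    (infDist_le_of_prox hα hμ hK hne hf (hg (t + 1) (by omega)) (hprox t ht)).trans
      (mul_le_mul_of_nonneg_right hqd Metric.infDist_nonneg)
  have hcost : ∀ t, T ≤ t → D.cost ρ (R.Ω (t + 1)) - f ≤ q ^ 2 * (D.cost ρ (R.Ω t) - f) :=
    fun t ht => (gap_le_of_prox hρ hα hμ hK hne hf (haff t ht) (hg t ht) (hprox t ht)).trans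
      (mul_le_mul_of_nonneg_right hqg (hg0 t ht))
  have hpow : ∀ k, D.cost ρ (R.Ω (T + k)) - f ≤ (q ^ k) ^ 2 := by
    intro k
    induction k with
    | zero => simpa using hgap T le_rfl
    | succ k ih =>
      refine (hcost (T + k) (by omega)).trans ?_
      have := mul_le_mul_of_nonneg_left ih (sq_nonneg q)
      calc q ^ 2 * (D.cost ρ (R.Ω (T + k)) - f) ≤ q ^ 2 * (q ^ k) ^ 2 := this
        _ = (q ^ (k + 1)) ^ 2 := by ring
  have hstep : ∀ k, ‖R.Ω (T + k + 1) - R.Ω (T + k)‖ ≤ √(2 / α) * q ^ k := by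
    intro k
    have h1 := norm_sub_sq_le_of_prox (haff (T + k) (by omega)) (hprox (T + k) (by omega))
    have h2 := hg0 (T + k + 1) (by omega)
    have h3 := hpow k
    refine abs_le_of_sq_le_sq' ?_ (by positivity) |>.2
    rw [mul_pow, Real.sq_sqrt (by positivity), div_mul_eq_mul_div, le_div_iff₀ hα]
    linarith
  refine ⟨fun t ht => ⟨(hcost t ht).trans ?_, hdist t ht⟩, fun k => (hpow k).trans ?_, hstep, ?_⟩
  · refine mul_le_mul_of_nonneg_right ?_ (hg0 t ht)
    rw [sq]
    exact mul_le_of_le_one_left hq0.le hq1.le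
  · rw [sq]
    exact mul_le_of_le_one_left (by positivity) (pow_le_one₀ hq0.le hq1.le)
  · exact exists_limit_of_geometric (u := fun k => R.Ω (T + k)) hK hne hq0 hq1 hstep
      fun k => hdist (T + k) (by omega)

/-- Geometric convergence of a tail yields the accuracy conditions as soon as the geometric term,
with a suitable constant, is at most `min ε 1`. -/
theorem SBMPRun.isAccurate {ρ α β f q r ε : ℝ} {rp rc T k : ℕ} {R : D.SBMPRun ρ α β rp rc}
    (hρ : 0 < ρ) (hα : 0 < α) (hf : ∀ X ∈ D.primalOpt, D.cost ρ X = f) (hq0 : 0 < q) (hq1 : q < 1)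
    (haff : R.Ω (T + k) ∈ D.affine) (hcand : R.Ω (T + k + 1) = R.cand (T + k))
    (hr : ∀ X ∈ D.primalOpt, ‖X‖ ≤ r) {s e A : ℝ} (hs : 0 ≤ s) (he : 0 ≤ e)
    (hA : A = 1 + e + α * s + (ρ * e + ρ * s + α * s * (r + e)))
    (hgap : D.cost ρ (R.Ω (T + k)) - f ≤ q ^ k)
    (hstep : ‖R.Ω (T + k + 1) - R.Ω (T + k)‖ ≤ s * q ^ k) {X : Matrix (Fin n) (Fin n) ℝ}
    (hX : X ∈ D.primalOpt) (hlim : ‖R.Ω (T + k) - X‖ ≤ e * q ^ k)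
    (hlim' : ‖R.Ω (T + k + 1) - X‖ ≤ e * q ^ (k + 1)) (hk : A * q ^ k ≤ min ε 1) :
    D.IsAccurate ρ ε (R.Ω (T + k)) (R.W (T + k)) (R.y (T + k)) := by
  have hε1 : A * q ^ k ≤ ε := hk.trans (min_le_left _ _)
  have h1 : A * q ^ k ≤ 1 := hk.trans (min_le_right _ _)
  have hqk0 : 0 < q ^ k := by positivity
  have hqk1 : q ^ k ≤ 1 := pow_le_one₀ hq0.le hq1.le
  have hr0 : 0 ≤ r := (norm_nonneg _).trans (hr X hX)
  have hpos : 0 ≤ ρ * e + ρ * s + α * s * (r + e) := by positivity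
  have hαs : 0 ≤ α * s := by positivity
  have hA0 : 0 ≤ A := by rw [hA]; positivity
  have hAe : (A * q ^ k) ^ 2 ≤ ε := by
    rw [sq]
    exact (mul_le_of_le_one_left (by positivity) h1).trans hε1
  have hle : ∀ x, x ≤ A → x * q ^ k ≤ A * q ^ k := fun x hx =>
    mul_le_mul_of_nonneg_right hx hqk0.le
  refine ⟨fun Y hY => ?_, ⟨?_, ?_⟩, ⟨?_, ?_⟩, ?_⟩
  · rw [hf Y hY]
    have := hle 1 (by rw [hA]; linarith)
    linarith
  · rw [haff.2, sub_self]
  · have h2 := neg_le_lambdaMin_of_near haff.1 hX.1.2 hlim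
    have := hle e (by rw [hA]; linarith)
    linarith
  · refine le_trans (pow_le_pow_left₀ (norm_nonneg _) ?_ 2) hAe
    rw [R.norm_dual_residual hρ hα, ← hcand]
    refine (mul_le_mul_of_nonneg_left hstep hα.le).trans ?_
    rw [← mul_assoc]
    exact hle _ (by rw [hA]; linarith)
  · exact posSemidef_of_mem_modelSet (R.Wb_normal _).1 (R.W_mem _)
  · refine le_trans ?_ (Real.le_sqrt_of_sq_le hAe)
    have h2 : ‖R.cand (T + k) - X‖ ≤ e * q ^ k := by
      rw [← hcand]
      refine hlim'.trans (mul_le_mul_of_nonneg_left ?_ he)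
      exact pow_le_pow_of_le_one hq0.le hq1.le (Nat.le_succ k)
    have h3 : ‖R.Ω (T + k)‖ ≤ r + e := by
      have h4 := norm_add_le (R.Ω (T + k) - X) X
      rw [sub_add_cancel] at h4
      have h5 := mul_le_of_le_one_right he hqk1
      linarith [hr X hX]
    rw [hcand] at hstep
    refine (R.abs_duality_gap_le hρ hα haff hX.1.2 h2 hstep h3).trans ?_
    calc ρ * (e * q ^ k) + ρ * (s * q ^ k) + α * (s * q ^ k) * (r + e)
        = (ρ * e + ρ * s + α * s * (r + e)) * q ^ k := by ring
      _ ≤ A * q ^ k := hle _ (by rw [hA]; linarith)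

/-- Existence of the separation constant `δ` and of the gap level `ε` below which the top
eigenvectors determine the cost up to a quadratic error. -/
theorem exists_separation {ρ μ f : ℝ} (hμ : 0 < μ) (hK : IsCompact D.primalOpt)
    (hgrow : ∀ X ∈ D.affine, D.cost ρ X - f ≤ 1 →
      ∃ X' ∈ D.primalOpt, μ * ‖X - X'‖ ^ 2 ≤ D.cost ρ X - f) :
    ∃ δ ε : ℝ, 0 < δ ∧ 0 < ε ∧ ε ≤ 1 ∧ ∀ Xh ∈ D.affine, D.cost ρ Xh - f ≤ ε →
      ∀ (Q : Matrix (Fin n) (Fin n) ℝ) (d : Fin n → ℝ), IsSpectralDecomposition (-Xh) Q d →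
        ∀ j : Fin n, D.maxNullity ≤ j → d j ≤ -δ := by
  obtain ⟨c, hc0, hc⟩ := exists_trace_lower_bound hK (Nat.lt_succ_self D.maxNullity)
  obtain ⟨δ, hδ⟩ : ∃ δ, δ = c / (2 * ((D.maxNullity : ℝ) + 1)) := ⟨_, rfl⟩
  have hδ0 : 0 < δ := by rw [hδ]; positivity
  refine ⟨δ, min 1 (μ * δ ^ 2), hδ0, lt_min one_pos (by positivity), min_le_left _ _,
    fun Xh hXh hg Q d hQ j hj => ?_⟩
  obtain ⟨X, hX, hXle⟩ := hgrow Xh hXh (hg.trans (min_le_left _ _))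
  have h1 : ‖Xh - X‖ ^ 2 ≤ δ ^ 2 :=
    le_of_mul_le_mul_left (hXle.trans (hg.trans (min_le_right _ _))) hμ
  have h2 : ‖Xh - X‖ ≤ δ := abs_le_of_sq_le_sq' h1 hδ0.le |>.2
  rw [hδ] at h2 ⊢
  exact eigenvalue_le_neg hc hX h2 hQ j hj

end SDP

theorem mainTheorem2 {n m : ℕ} (D : SDP n m)
    (hA : LinearIndependent ℝ D.A) (hSlater : D.Slater) (hSC : D.StrictComplementarity)
    (ρ : ℝ) (hρ : 2 * D.maxDualTrace + 1 < ρ) :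
    ∃ η : ℝ, 0 < η ∧
      ∀ α : ℝ, η ≤ α → ∀ β : ℝ, 0 < β → β ≤ 1 / 2 →
      ∀ Ω₀ : Matrix (Fin n) (Fin n) ℝ, Ω₀.IsSymm →
      ∃ (T₀ : ℕ) (q K : ℝ), 0 < T₀ ∧ 0 < q ∧ q < 1 ∧ 0 < K ∧
        ∀ rp rc : ℕ, 1 ≤ rc → D.maxNullity ≤ rc →
        ∀ R : D.SBMPRun ρ α β rp rc, R.Ω 0 = Ω₀ →
          (∀ t, T₀ ≤ t →
            R.IsDescentStep t ∧
            (∀ X ∈ D.primalOpt,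
              D.cost ρ (R.Ω (t + 1)) - D.cost ρ X ≤ q * (D.cost ρ (R.Ω t) - D.cost ρ X)) ∧
            Metric.infDist (R.Ω (t + 1)) D.primalOpt ≤ q * Metric.infDist (R.Ω t) D.primalOpt) ∧
          (∃ X ∈ D.primalOpt, ∀ t, T₀ ≤ t → ‖R.Ω t - X‖ ≤ K * q ^ (t - T₀)) ∧
          (∀ ε : ℝ, 0 < ε → ∃ t : ℕ, (t : ℝ) ≤ T₀ + K * max 1 (Real.log (1 / ε)) ∧
            ∀ s, t ≤ s → D.IsAccurate ρ ε (R.Ω s) (R.W s) (R.y s)) := by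
  obtain ⟨X₀, hX₀, p, hp, hrank⟩ := hSC
  have htr0 : 0 ≤ p.2.trace := hp.1.2.trace_nonneg
  have htr := SDP.trace_le_maxDualTrace hSlater hp
  have hρp : p.2.trace < ρ := by linarith
  have hρ0 : 0 < ρ := by linarith
  obtain ⟨f, hfdef⟩ : ∃ f, f = traceInner D.C X₀ := ⟨_, rfl⟩
  have hf : ∀ X ∈ D.primalOpt, D.cost ρ X = f := fun X hX =>
    hfdef ▸ SDP.cost_eq_of_mem_primalOpt ρ hX hX₀
  have hne : D.primalOpt.Nonempty := ⟨X₀, hX₀⟩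
  have hX₀a := SDP.mem_affine_of_mem_primalOpt hX₀
  have hK := SDP.isCompact_primalOpt hSlater hX₀ hp hρp
  obtain ⟨a, B, ha, hcoer⟩ := SDP.exists_coercive hSlater hp hρp
  obtain ⟨μ, hμ, hgrow⟩ := SDP.exists_quadratic_growth hSlater hX₀ hp hrank hρp
  rw [← hfdef] at hgrow
  obtain ⟨δ, ε₀, hδ, hε₀, hε₀1, hsep⟩ := SDP.exists_separation hμ hK hgrow
  have hmin : ∀ X ∈ D.affine, D.cost ρ X₀ ≤ D.cost ρ X := fun X hX => by
    by_contra! hlt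
    obtain ⟨X', -, h⟩ := hgrow X hX (by rw [← hf X₀ hX₀]; linarith)
    have : 0 ≤ μ * ‖X - X'‖ ^ 2 := by positivity
    rw [← hf X₀ hX₀] at h
    linarith
  obtain ⟨r, hr⟩ := isBounded_iff_forall_norm_le.1 hK.isBounded
  refine ⟨12 * ρ / δ, by positivity, fun α hα β hβ hβ2 Ω₀ _ => ?_⟩
  have hα0 : 0 < α := lt_of_lt_of_le (by positivity) hα
  have hαδ : ρ * (6 / δ) ≤ α / 2 := by
    have : ρ * (6 / δ) = 12 * ρ / δ / 2 := by ring
    rw [this]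
    linarith
  obtain ⟨N, hN, hNR⟩ := SDP.exists_iteration_bound hρ0 hα0 hβ hβ2 hX₀a ha hcoer hmin Ω₀ hε₀
  rw [hf X₀ hX₀] at hNR
  -- the common rate
  obtain ⟨g, hg⟩ : ∃ g, g = 1 - min 1 (μ / α) / 2 := ⟨_, rfl⟩
  have hmin0 : 0 < min 1 (μ / α) := lt_min one_pos (by positivity)
  have hmin1 : min 1 (μ / α) ≤ 1 := min_le_left _ _
  have hg0 : 0 < g := by rw [hg]; linarith
  have hg1 : g < 1 := by rw [hg]; linarith
  obtain ⟨q, hq⟩ : ∃ q, q = max √(α / (α + 2 * μ)) √g := ⟨_, rfl⟩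
  have hq0 : 0 < q := by
    rw [hq]
    exact lt_max_of_lt_right (Real.sqrt_pos.2 hg0)
  have hq1 : q < 1 := by
    rw [hq]
    refine max_lt ?_ ?_
    · rw [Real.sqrt_lt' one_pos, one_pow, div_lt_one (by positivity)]
      linarith
    · rw [Real.sqrt_lt' one_pos, one_pow]
      exact hg1
  have hqd : √(α / (α + 2 * μ)) ≤ q := by rw [hq]; exact le_max_left _ _
  have hqg : 1 - min 1 (μ / α) / 2 ≤ q ^ 2 := by
    have h1 : √g ≤ q := by rw [hq]; exact le_max_right _ _
    have h2 := pow_le_pow_left₀ (Real.sqrt_nonneg g) h1 2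
    rwa [Real.sq_sqrt hg0.le, hg] at h2
  -- the constants of the geometric bounds
  obtain ⟨e, he⟩ : ∃ e, e = √(2 / α) / (1 - q) := ⟨_, rfl⟩
  have he0 : 0 ≤ e := by
    rw [he]
    exact div_nonneg (Real.sqrt_nonneg _) (by linarith)
  have hr0 : 0 ≤ r := (norm_nonneg _).trans (hr X₀ hX₀)
  obtain ⟨A, hA'⟩ : ∃ A, A = 1 + e + α * √(2 / α) +
      (ρ * e + ρ * √(2 / α) + α * √(2 / α) * (r + e)) := ⟨_, rfl⟩
  have hA1 : 1 ≤ A := by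
    have h1 : 0 ≤ e + α * √(2 / α) + (ρ * e + ρ * √(2 / α) + α * √(2 / α) * (r + e)) := by
      positivity
    rw [hA']
    linarith
  obtain ⟨K, hKdef⟩ : ∃ K, K = max (e + 1) ((Real.log A + 1) / Real.log (1 / q) + 1) := ⟨_, rfl⟩
  have hK0 : 0 < K := by
    rw [hKdef]
    exact lt_max_of_lt_left (by linarith)
  refine ⟨N, q, K, hN, hq0, hq1, hK0, fun rp rc hrc hrcN R hR => ?_⟩
  have haff : ∀ t, N ≤ t → R.Ω t ∈ D.affine := fun t ht => by
    obtain ⟨j, rfl⟩ : ∃ j, t = j + 1 := ⟨t - 1, by omega⟩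
    exact R.Ω_succ_mem_affine j
  have hgap : ∀ t, N ≤ t → D.cost ρ (R.Ω t) - f ≤ ε₀ := hNR rp rc hrc R hR
  have hacc : ∀ t, N ≤ t → ∀ X : Matrix (Fin n) (Fin n) ℝ, X.IsSymm →
      D.cost ρ X ≤ D.model ρ (R.Wb t) (R.P t) X + α / 2 * ‖X - R.Ω t‖ ^ 2 := fun t ht =>
    R.accurate_of_gap_le hρ0 hα0 hβ2 hδ hαδ hrcN hsep t (haff t ht) (hgap t ht)
  have hdesc : ∀ t, N ≤ t → R.IsDescentStep t := fun t ht => by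
    have h0 : t = 0 → D.map (R.Ω 0) = D.b := by omega
    have h1 := R.descentTest_of_accurate hρ0 hα0 hβ2 (haff t ht)
      (hacc t ht _ (R.master t).1.1)
    exact ⟨h0, h1, R.step_descent t h0 h1⟩
  have hprox : ∀ t, N ≤ t → ∀ X ∈ D.affine, D.cost ρ (R.Ω (t + 1)) ≤
      D.cost ρ X + α / 2 * ‖X - R.Ω t‖ ^ 2 - α / 2 * ‖X - R.Ω (t + 1)‖ ^ 2 := by
    intro t ht X hX
    rw [(hdesc t ht).2.2]
    have h1 := hacc t ht _ (R.master t).1.1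
    rw [R.model_cand hρ0 hα0] at h1
    have h2 := R.prox_eq hρ0 hα0 t hX
    have h3 := R.minorant_le_cost hρ0 t hX.1
    rw [SDP.SBMPRun.masterValue] at h2
    linarith
  obtain ⟨h1, h2, h3, X, hX, h4⟩ := R.tail_convergence hρ0 hα0 hμ hK hne hf hgrow hq0 hq1 hqd hqg
    haff (fun t ht => (hgap t ht).trans hε₀1) hprox
  rw [← he] at h4
  refine ⟨fun t ht => ⟨hdesc t ht, fun Y hY => ?_, (h1 t ht).2⟩, ⟨X, hX, fun t ht => ?_⟩,
    fun ε hε => ?_⟩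
  · rw [hf Y hY]
    exact (h1 t ht).1
  · obtain ⟨k, rfl⟩ := Nat.exists_eq_add_of_le ht
    rw [Nat.add_sub_cancel_left]
    refine (h4 k).trans (mul_le_mul_of_nonneg_right ?_ (by positivity))
    rw [hKdef]
    exact (by linarith : e ≤ e + 1).trans (le_max_left _ _)
  · obtain ⟨k₀, hk₀, hk₀A⟩ := SDP.exists_pow_le hA1 hq0 hq1 hε
    refine ⟨N + k₀, ?_, fun s hs => ?_⟩
    · push_cast
      have h5 : ((Real.log A + 1) / Real.log (1 / q) + 1) * max 1 (Real.log (1 / ε)) ≤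
          K * max 1 (Real.log (1 / ε)) := by
        refine mul_le_mul_of_nonneg_right ?_ (le_max_of_le_left zero_le_one)
        rw [hKdef]
        exact le_max_right _ _
      linarith
    · obtain ⟨k, rfl⟩ := Nat.exists_eq_add_of_le ((Nat.le_add_right N k₀).trans hs)
      have hkA : A * q ^ k ≤ min ε 1 := by
        refine le_trans ?_ hk₀A
        refine mul_le_mul_of_nonneg_left ?_ (by linarith)
        exact pow_le_pow_of_le_one hq0.le hq1.le (by omega)
      exact R.isAccurate hρ0 hα0 hf hq0 hq1 (haff _ (by omega)) (hdesc _ (by omega)).2.2 hr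
        (Real.sqrt_nonneg _) he0 hA' (h2 k) (h3 k) hX (h4 k) (h4 (k + 1)) hkA
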